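/- **Setting.** Let $\mathcal A$ be a unital $*$-algebra over $\mathbb C$. A *twisted spectral triple* $(\mathcal A,\mathcal H,D)_\sigma$ consists of a $\mathbb Z_2$-graded Hilbert space $\mathcal H$ with grading operator $\gamma$, a unital $*$-representation of $\mathcal A$ by even bounded operators on $\mathcal H$, an algebra automorphism $\sigma$ of $\mathcal A$ with $\sigma(a)^*=\sigma^{-1}(a^*)$, and an odd selfadjoint unbounded operator $D$ on $\mathcal H$ such that $(D+i)^{-1}$ is compact and, for all $a\in\mathcal A$, $a(\operatorname{dom}D)\subset\operatorname{dom}D$ and $[D,a]_\sigma:=Da-\sigma(a)D$ is bounded. It is *$p$-summable* if $\operatorname{Tr}|D|^{-p}<\infty$ (with $|D|^{-p}:=0$ on $\ker D$). When $\mathcal A$ is a locally convex $*$-algebra (product and involution continuous), it is *smooth* if the maps $a\mapsto a$ and $a\mapsto[D,a]_\sigma$ from $\mathcal A$ to $\mathcal L(\mathcal H)$ are continuous and $\sigma$ is a homeomorphism. Let $\mathrm{HP}^0(\mathcal A)$ be the even periodic cyclic cohomology of $\mathcal A$, i.e. the even cohomology of the complex of finitely supported sequences of multilinear cochains with differential $b+B$,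 and, if $\mathcal A$ is a locally convex $*$-algebra, let $\mathbf{HP}^0(\mathcal A)$ be the analogue for continuous cochains. For a $p$-summable twisted spectral triple ($p\ge1$), an integer $q\ge\frac12(p-1)$ and $D$ invertible, put $$\tau^{D,\sigma}_{2q}(a^0,\dots,a^{2q})=\tfrac12(-1)^q\tfrac{q!}{(2q)!}\operatorname{Str}\bigl(D^{-1}[D,a^0]_\sigma\cdots D^{-1}[D,a^{2q}]_\sigma\bigr),\qquad \operatorname{Str}(T)=\operatorname{Tr}(\gamma T).$$ In general (whether or not $D$ is invertible), let $\overline\tau^{D,\sigma}_{2q}$ be given by the same formula with $\mathcal H$, $\gamma$, $D$ and the actions of $a$ and $\sigma(a)$ replaced by $\mathcal H\oplus\mathcal H$, $\begin{pmatrix}\gamma&0\\0&-\gamma\end{pmatrix}$, $\begin{pmatrix}D&1\\1&-D\end{pmatrix}$, $\begin{pmatrix}a&0\\0&0\end{pmatrix}$ and $\begin{pmatrix}\sigma(a)&0\\0&0\end{pmatrix}$. The *Connes–Chern character* $\mathrm{Ch}(D)_\sigma\in\mathrm{HP}^0(\mathcal A)$ is the common class of the cyclic cocycles $\overline\tau^{D,\sigma}_{2q}$,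 and, if $D$ is invertible, of the cyclic cocycles $\tau^{D,\sigma}_{2q}$, for all integers $q\ge\frac12(p-1)$. If the triple is smooth, these cocycles are continuous, and $\mathbf{Ch}(D)_\sigma\in\mathbf{HP}^0(\mathcal A)$ is their common class in $\mathbf{HP}^0(\mathcal A)$. **Statement.** Let $(\mathcal A,\mathcal H,D)_\sigma$ be a twisted spectral triple that is $p$-summable for some real $p\ge1$, and let $k\in\mathcal A$ be a positive invertible element (that is, $k^*=k$, $k$ is invertible in $\mathcal A$, and $k$ acts on $\mathcal H$ as a positive operator). Put $\hat\sigma(a)=k\sigma(kak^{-1})k^{-1}$ for $a\in\mathcal A$. Then $(\mathcal A,\mathcal H,kDk)_{\hat\sigma}$ is a $p$-summable twisted spectral triple, the Connes–Chern characters of both triples are well defined, and $$\mathrm{Ch}(kDk)_{\hat\sigma}=\mathrm{Ch}(D)_\sigma\quad\text{in }\mathrm{HP}^0(\mathcal A).$$ If moreover $\mathcal A$ is a locally convex $*$-algebra and $(\mathcal A,\mathcal H,D)_\sigma$ is smooth, then $(\mathcal A,\mathcal H,kDk)_{\hat\sigma}$ is smooth, the Connes–Chern characters of both triples in $\mathbf{HP}^0(\mathcal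 A)$ are well defined, and $$\mathbf{Ch}(kDk)_{\hat\sigma}=\mathbf{Ch}(D)_\sigma\quad\text{in }\mathbf{HP}^0(\mathcal A).$$ -/

import Mathlib

noncomputable section

universe u v

namespace TwistedST

/-! ## The cyclic mixed complex of a unital algebra -/

section Cyclic

variable (A : Type u) [Ring A] [Algebra ℂ A]

/-- The space `C^m(A)` of `(m+1)`-linear forms on `A`. -/
abbrev Cochain (m : ℕ) : Type u := MultilinearMap ℂ (fun _ : Fin (m + 1) => A) ℂ

variable {A}

/-- The map `φ ↦ φ ∘ d` on cochains, where `d : A^{n+1} → A^{m+1}` is such that each variable enters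
exactly one component of `d`, and linearly. -/
def precomp {m n : ℕ} (d : (Fin (n + 1) → A) → (Fin (m + 1) → A))
    (hd : ∀ (a : Fin (n + 1) → A) (i : Fin (n + 1)), ∃ (p : Fin (m + 1)) (L : A →ₗ[ℂ] A),
      ∀ x, d (Function.update a i x) = Function.update (d a) p (L x)) :
    Cochain A m →ₗ[ℂ] Cochain A n where
  toFun φ :=
    { toFun := fun a => φ (d a)
      map_update_add' := by
        intro inst a i x y
        obtain rfl : inst = instDecidableEqFin (n + 1) := Subsingleton.elim _ _
        obtain ⟨p, L, h⟩ := hd a i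
        simp only [h, map_add, MultilinearMap.map_update_add]
      map_update_smul' := by
        intro inst a i c x
        obtain rfl : inst = instDecidableEqFin (n + 1) := Subsingleton.elim _ _
        obtain ⟨p, L, h⟩ := hd a i
        simp only [h, map_smul, MultilinearMap.map_update_smul] }
  map_add' _ _ := rfl
  map_smul' _ _ := rfl

/-- `(a⁰, …, a^{m+1}) ↦ (a⁰, …, aʲaʲ⁺¹, …, a^{m+1})`, for `0 ≤ j ≤ m`. -/
def face {m : ℕ} (j : Fin (m + 1)) (a : Fin (m + 2) → A) : Fin (m + 1) → A :=
  Fin.contractNth j.castSucc (· * ·) a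

/-- `(a⁰, …, a^{m+1}) ↦ (a^{m+1}a⁰, a¹, …, a^m)`. -/
def lastFace {m : ℕ} (a : Fin (m + 2) → A) : Fin (m + 1) → A :=
  Fin.cons (a (Fin.last (m + 1)) * a 0) (fun i : Fin m => a i.succ.castSucc)

/-- `(a⁰, …, a^m) ↦ (a^m, a⁰, …, a^{m-1})`. -/
def rotate {m : ℕ} (a : Fin (m + 1) → A) : Fin (m + 1) → A :=
  Fin.cons (a (Fin.last m)) (fun i : Fin m => a i.castSucc)

theorem face_update {m : ℕ} (j : Fin (m + 1)) (a : Fin (m + 2) → A) (i : Fin (m + 2)) :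
    ∃ (p : Fin (m + 1)) (L : A →ₗ[ℂ] A),
      ∀ x, face j (Function.update a i x) = Function.update (face j a) p (L x) := by
  obtain ⟨i, hi⟩ := i
  obtain ⟨j, hj⟩ := j
  rcases lt_trichotomy i j with h | h | h
  · refine ⟨⟨i, by omega⟩, LinearMap.id, fun x => ?_⟩
    ext ⟨l, hl⟩
    simp only [face, Fin.contractNth, Function.update_apply, Fin.ext_iff, LinearMap.id_apply,
      Fin.val_castSucc, Fin.val_succ]
    split_ifs <;> first | rfl | omega
  · refine ⟨⟨j, hj⟩, LinearMap.mulRight ℂ (a ⟨j + 1, by omega⟩), fun x => ?_⟩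
    ext ⟨l, hl⟩
    simp only [face, Fin.contractNth, Function.update_apply, Fin.ext_iff, LinearMap.mulRight_apply,
      Fin.val_castSucc, Fin.val_succ]
    split_ifs <;> first | rfl | omega | (subst_vars; rfl)
  · rcases Nat.eq_or_lt_of_le h with h' | h'
    · refine ⟨⟨j, hj⟩, LinearMap.mulLeft ℂ (a ⟨j, by omega⟩), fun x => ?_⟩
      ext ⟨l, hl⟩
      simp only [face, Fin.contractNth, Function.update_apply, Fin.ext_iff, LinearMap.mulLeft_apply,
        Fin.val_castSucc, Fin.val_succ]
      split_ifs <;> first | rfl | omega | (subst_vars; rfl)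
    · refine ⟨⟨i - 1, by omega⟩, LinearMap.id, fun x => ?_⟩
      ext ⟨l, hl⟩
      simp only [face, Fin.contractNth, Function.update_apply, Fin.ext_iff, LinearMap.id_apply,
        Fin.val_castSucc, Fin.val_succ]
      split_ifs <;> first | rfl | omega

theorem lastFace_update {m : ℕ} (a : Fin (m + 2) → A) (i : Fin (m + 2)) :
    ∃ (p : Fin (m + 1)) (L : A →ₗ[ℂ] A),
      ∀ x, lastFace (Function.update a i x) = Function.update (lastFace a) p (L x) := by
  obtain ⟨i, hi⟩ := i
  by_cases h0 : i = 0
  · refine ⟨0, LinearMap.mulLeft ℂ (a (Fin.last (m + 1))), fun x => ?_⟩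
    ext l
    refine Fin.cases ?_ (fun l => ?_) l <;>
      simp [lastFace, Function.update_apply, Fin.ext_iff, h0]
  · by_cases h1 : i = m + 1
    · refine ⟨0, LinearMap.mulRight ℂ (a 0), fun x => ?_⟩
      ext l
      refine Fin.cases ?_ (fun l => ?_) l
      · simp [lastFace, Function.update_apply, Fin.ext_iff, h1]
      · have := l.2
        have h : (l : ℕ) ≠ m := by omega
        simp [lastFace, Function.update_apply, Fin.ext_iff, h1, h]
    · refine ⟨⟨i, by omega⟩, LinearMap.id, fun x => ?_⟩
      ext l
      have h0' : ¬ 0 = i := fun h => h0 h.symm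
      have h1' : ¬ m + 1 = i := fun h => h1 h.symm
      refine Fin.cases ?_ (fun l => ?_) l <;>
        simp [lastFace, Function.update_apply, Fin.ext_iff, h0', h1']

theorem rotate_update {m : ℕ} (a : Fin (m + 1) → A) (i : Fin (m + 1)) :
    ∃ (p : Fin (m + 1)) (L : A →ₗ[ℂ] A),
      ∀ x, rotate (Function.update a i x) = Function.update (rotate a) p (L x) := by
  obtain ⟨i, hi⟩ := i
  by_cases h1 : i = m
  · refine ⟨0, LinearMap.id, fun x => ?_⟩
    ext l
    refine Fin.cases ?_ (fun l => ?_) l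
    · simp [rotate, Function.update_apply, Fin.ext_iff, h1]
    · have := l.2
      have h : (l : ℕ) ≠ m := by omega
      simp [rotate, Function.update_apply, Fin.ext_iff, h1, h]
  · refine ⟨⟨i + 1, by omega⟩, LinearMap.id, fun x => ?_⟩
    ext l
    have h1' : ¬ m = i := fun h => h1 h.symm
    refine Fin.cases ?_ (fun l => ?_) l <;>
      simp [rotate, Function.update_apply, Fin.ext_iff, h1']

theorem cons_one_update {m : ℕ} (a : Fin (m + 1) → A) (i : Fin (m + 1)) :
    ∃ (p : Fin (m + 2)) (L : A →ₗ[ℂ] A), ∀ x,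
      (Fin.cons 1 (Function.update a i x) : Fin (m + 2) → A) =
        Function.update (Fin.cons 1 a : Fin (m + 2) → A) p (L x) :=
  ⟨i.succ, LinearMap.id, fun x => by
    simp [Fin.cons_update (α := fun _ : Fin (m + 2) => A)]⟩

/-- The Hochschild coboundary `b : C^m(A) → C^{m+1}(A)`,
`(bφ)(a⁰,…,a^{m+1}) = ∑_{j=0}^{m} (-1)^j φ(a⁰,…,aʲaʲ⁺¹,…,a^{m+1}) + (-1)^{m+1} φ(a^{m+1}a⁰,…,a^m)`. -/
def hochschild (m : ℕ) : Cochain A m →ₗ[ℂ] Cochain A (m + 1) :=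
  (∑ j : Fin (m + 1), (-1 : ℂ) ^ (j : ℕ) • precomp (face j) (face_update j)) +
    (-1 : ℂ) ^ (m + 1) • precomp lastFace lastFace_update

/-- The operator `T`, `(Tφ)(a⁰,…,a^m) = (-1)^m φ(a^m,a⁰,…,a^{m-1})`. -/
def cyclicT (m : ℕ) : Cochain A m →ₗ[ℂ] Cochain A m :=
  (-1 : ℂ) ^ m • precomp rotate rotate_update

/-- The operator `B₀`, `(B₀φ)(a⁰,…,a^m) = φ(1,a⁰,…,a^m)`. -/
def connesB₀ (m : ℕ) : Cochain A (m + 1) →ₗ[ℂ] Cochain A m :=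
  precomp (fun a => (Fin.cons 1 a : Fin (m + 2) → A)) cons_one_update

/-- Cyclic antisymmetrization `1 + T + ⋯ + T^m` on `C^m(A)`. -/
def cyclicSum (m : ℕ) : Cochain A m →ₗ[ℂ] Cochain A m :=
  ∑ j ∈ Finset.range (m + 1), cyclicT m ^ j

/-- The operator `B = (1 + T + ⋯ + T^m) B₀ (1 - T) : C^{m+1}(A) → C^m(A)`. -/
def connesB (m : ℕ) : Cochain A (m + 1) →ₗ[ℂ] Cochain A m :=
  cyclicSum m ∘ₗ connesB₀ m ∘ₗ (LinearMap.id - cyclicT (m + 1))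

/-- The operator `b + B` on sequences of cochains: its component in degree `0` is `B φ_1`, and its
component in degree `m + 1` is `b φ_m + B φ_{m+2}`. -/
def periodicDifferential : (∀ m, Cochain A m) →ₗ[ℂ] (∀ m, Cochain A m) :=
  LinearMap.pi fun m =>
    match m with
    | 0 => connesB 0 ∘ₗ LinearMap.proj 1
    | m + 1 => hochschild m ∘ₗ LinearMap.proj m + connesB (m + 1) ∘ₗ LinearMap.proj (m + 2)

/-- Given a class `V` of cochains (all cochains, or the continuous ones), the finitely supported
sequences of cochains in `V` that are supported in the degrees of parity `i`. -/
def periodicCochains (V : ∀ m, Submodule ℂ (Cochain A m)) (i : ZMod 2) :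
    Submodule ℂ (∀ m, Cochain A m) where
  carrier := {φ | (∃ N, ∀ m, N ≤ m → φ m = 0) ∧ ∀ m, φ m ∈ V m ∧ ((m : ZMod 2) ≠ i → φ m = 0)}
  zero_mem' := ⟨⟨0, fun _ _ => rfl⟩, fun m => ⟨(V m).zero_mem, fun _ => rfl⟩⟩
  add_mem' := by
    rintro φ ψ ⟨⟨N, hN⟩, hφ⟩ ⟨⟨N', hN'⟩, hψ⟩
    refine ⟨⟨max N N', fun m hm => ?_⟩, fun m => ⟨(V m).add_mem (hφ m).1 (hψ m).1, fun h => ?_⟩⟩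
    · rw [Pi.add_apply, hN m (le_trans (le_max_left _ _) hm),
        hN' m (le_trans (le_max_right _ _) hm), add_zero]
    · rw [Pi.add_apply, (hφ m).2 h, (hψ m).2 h, add_zero]
  smul_mem' := by
    rintro c φ ⟨⟨N, hN⟩, hφ⟩
    refine ⟨⟨N, fun m hm => ?_⟩, fun m => ⟨(V m).smul_mem c (hφ m).1, fun h => ?_⟩⟩
    · rw [Pi.smul_apply, hN m hm, smul_zero]
    · rw [Pi.smul_apply, (hφ m).2 h, smul_zero]

/-- Periodic cyclic cocycles of parity `i`. -/
def periodicCocycles (V : ∀ m, Submodule ℂ (Cochain A m)) (i : ZMod 2) :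
    Submodule ℂ (∀ m, Cochain A m) :=
  periodicCochains V i ⊓ LinearMap.ker periodicDifferential

/-- Periodic cyclic coboundaries of parity `i`. -/
def periodicCoboundaries (V : ∀ m, Submodule ℂ (Cochain A m)) (i : ZMod 2) :
    Submodule ℂ (∀ m, Cochain A m) :=
  (periodicCochains V (i + 1)).map periodicDifferential

/-- Periodic cyclic cohomology of parity `i`, computed with the cochains in `V`. -/
abbrev HP (V : ∀ m, Submodule ℂ (Cochain A m)) (i : ZMod 2) : Type u :=
  periodicCocycles V i ⧸ (periodicCoboundaries V i).submoduleOf (periodicCocycles V i)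

/-- All cochains; `HP (allCochains A) 0` is `HP⁰(A)`. -/
def allCochains (A : Type u) [Ring A] [Algebra ℂ A] : ∀ m, Submodule ℂ (Cochain A m) :=
  fun _ => ⊤

/-- The continuous cochains; `HP (continuousCochains A) 0` is continuous periodic cyclic
cohomology **HP**`⁰(A)`. -/
def continuousCochains (A : Type u) [Ring A] [Algebra ℂ A] [TopologicalSpace A] :
    ∀ m, Submodule ℂ (Cochain A m) := fun m =>
  { carrier := {φ | Continuous fun a : Fin (m + 1) → A => φ a}
    zero_mem' := continuous_const
    add_mem' := fun hφ hψ => Continuous.add hφ hψ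
    smul_mem' := fun c _ hφ => Continuous.const_smul hφ c }

/-- The function `f : A^{m+1} → ℂ` is a cyclic cocycle belonging to `V`, and its class in the
periodic cyclic cohomology computed with `V` is `c`. -/
def IsCyclicCocycleOfClass (V : ∀ m, Submodule ℂ (Cochain A m)) (i : ZMod 2) (m : ℕ)
    (f : (Fin (m + 1) → A) → ℂ) (c : HP V i) : Prop :=
  ∃ φ : Cochain A m, (∀ a, φ a = f a) ∧ φ ∈ V m ∧ cyclicT m φ = φ ∧ hochschild m φ = 0 ∧
    ∃ z : periodicCocycles V i,
      (z : ∀ m, Cochain A m) = Pi.single m φ ∧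
      Submodule.Quotient.mk z = c

end Cyclic

/-! ## Trace-class operators, and unbounded operators -/

section Operators

variable {H : Type v} [NormedAddCommGroup H] [InnerProductSpace ℂ H] [CompleteSpace H]

/-- The index set of a chosen Hilbert basis of `H`. -/
def basisIndex (H : Type v) [NormedAddCommGroup H] [InnerProductSpace ℂ H] [CompleteSpace H] :
    Set H :=
  (exists_hilbertBasis ℂ H).choose

/-- A chosen Hilbert basis of `H`. -/
def basis (H : Type v) [NormedAddCommGroup H] [InnerProductSpace ℂ H] [CompleteSpace H] :
    HilbertBasis (basisIndex H) ℂ H :=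
  (exists_hilbertBasis ℂ H).choose_spec.choose

/-- `S` is trace-class: `Tr |S| < ∞`. -/
def IsTraceClass (S : H →L[ℂ] H) : Prop :=
  Summable fun i => (inner ℂ (basis H i) (CFC.abs S (basis H i))).re

/-- The trace of a trace-class operator. -/
def trace (S : H →L[ℂ] H) : ℂ := ∑' i, inner ℂ (basis H i) (S (basis H i))

/-- The supertrace `Str S = Tr (γ S)` with respect to a grading operator `γ`. -/
def supertrace (γ S : H →L[ℂ] H) : ℂ := trace (γ * S)

/-- The bounded operator `R` is the inverse of the unbounded operator `D`. -/
def IsBoundedInverse (D : H →ₗ.[ℂ] H) (R : H →L[ℂ] H) : Prop :=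
  (∀ x, ∃ h : R x ∈ D.domain, D ⟨R x, h⟩ = x) ∧ ∀ x : D.domain, R (D x) = x

/-- `D` is invertible (with bounded inverse). -/
def IsInvertible (D : H →ₗ.[ℂ] H) : Prop := ∃ R, IsBoundedInverse D R

open Classical in
/-- `D⁻¹`, if `D` is invertible. -/
def inverse (D : H →ₗ.[ℂ] H) : H →L[ℂ] H :=
  if h : IsInvertible D then h.choose else 0

/-- The resolvent `(D + i)⁻¹` exists and is a compact operator. -/
def HasCompactResolvent (D : H →ₗ.[ℂ] H) : Prop :=
  ∃ R : H →L[ℂ] H, IsCompactOperator R ∧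
    (∀ x, ∃ h : R x ∈ D.domain, D ⟨R x, h⟩ + Complex.I • R x = x) ∧
    ∀ x : D.domain, R (D x + Complex.I • (x : H)) = x

/-- `R` is the partial inverse of the selfadjoint operator `D`: it vanishes on `ker D` and inverts
`D` on `(ker D)ᗮ`. -/
def IsPartialInverse (D : H →ₗ.[ℂ] H) (R : H →L[ℂ] H) : Prop :=
  IsSelfAdjoint R ∧ (∀ x : D.domain, D x = 0 → R x = 0) ∧
    ∀ x : D.domain, (∀ z : D.domain, D z = 0 → inner ℂ (z : H) (x : H) = 0) → R (D x) = x

/-- `Tr |D|^{-p} < ∞`, where `|D|^{-p}` is `0` on `ker D`, i.e. `|D|^{-p} = |R|^p` with `R` the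
partial inverse of `D`. -/
def IsSummable (D : H →ₗ.[ℂ] H) (p : ℝ) : Prop :=
  ∃ R : H →L[ℂ] H, IsPartialInverse D R ∧ IsTraceClass (cfc (fun t : ℝ => |t| ^ p) R)

/-- `S` maps `dom D` to itself, and `C` is the bounded extension of `D S - S' D`. -/
def IsTwistedCommutator (D : H →ₗ.[ℂ] H) (S S' C : H →L[ℂ] H) : Prop :=
  ∀ x : D.domain, ∃ h : S x ∈ D.domain, C x = D ⟨S x, h⟩ - S' (D x)

open Classical in
/-- The bounded operator `D S - S' D`, when it exists. -/
def twistedCommutator (D : H →ₗ.[ℂ] H) (S S' : H →L[ℂ] H) : H →L[ℂ] H :=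
  if h : ∃ C, IsTwistedCommutator D S S' C then h.choose else 0

/-- `k D k`, with domain `{x | k x ∈ dom D}`. -/
def sandwich (k : H →L[ℂ] H) (D : H →ₗ.[ℂ] H) : H →ₗ.[ℂ] H where
  domain := D.domain.comap k.toLinearMap
  toFun := k.toLinearMap ∘ₗ D.toFun ∘ₗ
    (k.toLinearMap.domRestrict (D.domain.comap k.toLinearMap)).codRestrict D.domain (fun x => x.2)

/-- The Hilbert space direct sum `H ⊕ H`. -/
abbrev Double (H : Type v) : Type v := WithLp 2 (H × H)

/-- The operator `diag(S, S')` on `H ⊕ H`. -/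
def diagonal (S S' : H →L[ℂ] H) : Double H →L[ℂ] Double H :=
  ((WithLp.prodContinuousLinearEquiv 2 ℂ H H).symm : H × H →L[ℂ] Double H) ∘L
    (S.prodMap S') ∘L (WithLp.prodContinuousLinearEquiv 2 ℂ H H : Double H →L[ℂ] H × H)

/-- The invertible double `(D, 1; 1, -D)` on `H ⊕ H`, with domain `dom D ⊕ dom D`. -/
def doubleOp (D : H →ₗ.[ℂ] H) : Double H →ₗ.[ℂ] Double H where
  domain :=
    { carrier := {x | x.fst ∈ D.domain ∧ x.snd ∈ D.domain}
      zero_mem' := ⟨D.domain.zero_mem, D.domain.zero_mem⟩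
      add_mem' := fun hx hy => ⟨D.domain.add_mem hx.1 hy.1, D.domain.add_mem hx.2 hy.2⟩
      smul_mem' := fun c _ hx => ⟨D.domain.smul_mem c hx.1, D.domain.smul_mem c hx.2⟩ }
  toFun :=
    { toFun := fun x => WithLp.toLp 2
        (D ⟨(x : Double H).fst, x.2.1⟩ + (x : Double H).snd,
          (x : Double H).fst - D ⟨(x : Double H).snd, x.2.2⟩)
      map_add' := by
        rintro ⟨x, hx⟩ ⟨y, hy⟩
        have h₁ : D ⟨(x + y).fst, D.domain.add_mem hx.1 hy.1⟩ =
            D ⟨x.fst, hx.1⟩ + D ⟨y.fst, hy.1⟩ := D.map_add ⟨x.fst, hx.1⟩ ⟨y.fst, hy.1⟩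
        have h₂ : D ⟨(x + y).snd, D.domain.add_mem hx.2 hy.2⟩ =
            D ⟨x.snd, hx.2⟩ + D ⟨y.snd, hy.2⟩ := D.map_add ⟨x.snd, hx.2⟩ ⟨y.snd, hy.2⟩
        refine (WithLp.ofLp_injective 2) (Prod.ext ?_ ?_)
        · change D ⟨(x + y).fst, _⟩ + (x.snd + y.snd) =
            (D ⟨x.fst, _⟩ + x.snd) + (D ⟨y.fst, _⟩ + y.snd)
          rw [h₁]; abel
        · change (x.fst + y.fst) - D ⟨(x + y).snd, _⟩ =
            (x.fst - D ⟨x.snd, _⟩) + (y.fst - D ⟨y.snd, _⟩)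
          rw [h₂]; abel
      map_smul' := by
        rintro c ⟨x, hx⟩
        have h₁ : D ⟨(c • x).fst, D.domain.smul_mem c hx.1⟩ = c • D ⟨x.fst, hx.1⟩ :=
          D.map_smul c ⟨x.fst, hx.1⟩
        have h₂ : D ⟨(c • x).snd, D.domain.smul_mem c hx.2⟩ = c • D ⟨x.snd, hx.2⟩ :=
          D.map_smul c ⟨x.snd, hx.2⟩
        refine (WithLp.ofLp_injective 2) (Prod.ext ?_ ?_)
        · change D ⟨(c • x).fst, _⟩ + c • x.snd = c • (D ⟨x.fst, _⟩ + x.snd)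
          rw [h₁, smul_add]
        · change c • x.fst - D ⟨(c • x).snd, _⟩ = c • (x.fst - D ⟨x.snd, _⟩)
          rw [h₂, smul_sub] }

end Operators

/-! ## Twisted spectral triples and their Connes-Chern character -/

section Triples

variable (A : Type u) [Ring A] [Algebra ℂ A] [StarRing A] [StarModule ℂ A]
  (H : Type v) [NormedAddCommGroup H] [InnerProductSpace ℂ H] [CompleteSpace H]

/-- The data of a twisted spectral triple: the grading operator `γ`, with `H^± = ker (γ ∓ 1)`, the
(unital) `*`-representation `π` of `A`, the automorphism `σ` of `A`, and the unbounded operator `D`.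
Their properties are collected in `IsTwistedSpectralTriple`. -/
structure TripleData where
  γ : H →L[ℂ] H
  π : A →⋆ₐ[ℂ] (H →L[ℂ] H)
  σ : A ≃ₐ[ℂ] A
  D : H →ₗ.[ℂ] H

variable {A H}

/-- `(A, H, D)_σ` is a twisted spectral triple. -/
structure IsTwistedSpectralTriple (X : TripleData A H) : Prop where
  γ_mul_self : X.γ * X.γ = 1
  γ_selfAdjoint : IsSelfAdjoint X.γ
  π_even : ∀ a, X.π a * X.γ = X.γ * X.π a
  σ_star : ∀ a, star (X.σ a) = X.σ.symm (star a)
  D_dense : Dense (X.D.domain : Set H)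
  D_selfAdjoint : IsSelfAdjoint X.D
  D_odd : ∀ x : X.D.domain, ∃ h : X.γ x ∈ X.D.domain, X.D ⟨X.γ x, h⟩ = -X.γ (X.D x)
  D_compactResolvent : HasCompactResolvent X.D
  D_commutator : ∀ a, ∃ C, IsTwistedCommutator X.D (X.π a) (X.π (X.σ a)) C

/-- The bounded operator `[D, a]_σ = D a - σ(a) D`. -/
def TripleData.commutator (X : TripleData A H) (a : A) : H →L[ℂ] H :=
  twistedCommutator X.D (X.π a) (X.π (X.σ a))

/-- Smoothness of a twisted spectral triple over a locally convex `*`-algebra. -/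
structure IsSmooth [TopologicalSpace A] (X : TripleData A H) : Prop where
  π_continuous : Continuous fun a => X.π a
  commutator_continuous : Continuous fun a => X.commutator a
  σ_continuous : Continuous fun a => X.σ a
  σ_symm_continuous : Continuous fun a => X.σ.symm a

/-- The automorphism `a ↦ k σ(k a k⁻¹) k⁻¹`. -/
def conformalTwist (σ : A ≃ₐ[ℂ] A) (k : Aˣ) : A ≃ₐ[ℂ] A where
  toFun a := k * σ (k * a * ↑k⁻¹) * ↑k⁻¹
  invFun a := ↑k⁻¹ * σ.symm (↑k⁻¹ * a * k) * k
  left_inv a := by simp [mul_assoc]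
  right_inv a := by simp [mul_assoc]
  map_mul' a b := by
    simp only [mul_assoc, map_mul, Units.inv_mul_cancel_left]
    rw [← mul_assoc (σ (↑k⁻¹ : A)) (σ (k : A)), ← map_mul σ (↑k⁻¹ : A), Units.inv_mul, map_one,
      one_mul]
  map_add' a b := by simp [mul_add, add_mul]
  commutes' c := by
    have h : (k : A) * algebraMap ℂ A c * ↑k⁻¹ = algebraMap ℂ A c := by
      rw [← Algebra.commutes c (k : A), mul_assoc, Units.mul_inv, mul_one]
    rw [h, AlgEquiv.commutes, h]

/-- The conformal deformation `(A, H, k D k)_{σ̂}`, `σ̂(a) = k σ(k a k⁻¹) k⁻¹`. -/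
def TripleData.conformalDeformation (X : TripleData A H) (k : Aˣ) : TripleData A H where
  γ := X.γ
  π := X.π
  σ := conformalTwist X.σ k
  D := sandwich (X.π k) X.D

/-- `k` is a positive (invertible) element of `A`: it is selfadjoint, and positive as an operator. -/
def IsPositiveElement (X : TripleData A H) (k : Aˣ) : Prop :=
  IsSelfAdjoint (k : A) ∧ (X.π k).IsPositive

/-- `D⁻¹[D, a⁰]_σ ⋯ D⁻¹[D, a^{2q}]_σ`, where `a` acts by `ρ a` and `σ(a)` by `ρ' a`. -/
def tauOperator {K : Type v} [NormedAddCommGroup K] [InnerProductSpace ℂ K] [CompleteSpace K]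
    (D : K →ₗ.[ℂ] K) (ρ ρ' : A → K →L[ℂ] K) (q : ℕ) (a : Fin (2 * q + 1) → A) : K →L[ℂ] K :=
  (List.ofFn fun j => inverse D * twistedCommutator D (ρ (a j)) (ρ' (a j))).prod

/-- The constant `c_q = ½ (-1)^q q! / (2q)!`. -/
def tauConst (q : ℕ) : ℂ := 1 / 2 * (-1) ^ q * (q.factorial : ℂ) / ((2 * q).factorial : ℂ)

/-- The product of operators in the definition of `τ_{2q}` (for `D` invertible). -/
def TripleData.tauOp (X : TripleData A H) (q : ℕ) (a : Fin (2 * q + 1) → A) : H →L[ℂ] H :=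
  tauOperator X.D (fun a => X.π a) (fun a => X.π (X.σ a)) q a

/-- The cochain `τ_{2q}(a⁰,…,a^{2q}) = c_q Str(D⁻¹[D,a⁰]_σ ⋯ D⁻¹[D,a^{2q}]_σ)`. -/
def TripleData.tau (X : TripleData A H) (q : ℕ) (a : Fin (2 * q + 1) → A) : ℂ :=
  tauConst q * supertrace X.γ (X.tauOp q a)

/-- The product of operators in the definition of `τ̄_{2q}`: the one of `τ_{2q}`, for the operator
`(D, 1; 1, -D)` on `H ⊕ H` and the (nonunital) action `a ↦ diag(a, 0)` of `A`. -/
def TripleData.tauBarOp (X : TripleData A H) (q : ℕ) (a : Fin (2 * q + 1) → A) :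
    Double H →L[ℂ] Double H :=
  tauOperator (doubleOp X.D) (fun a => diagonal (X.π a) 0) (fun a => diagonal (X.π (X.σ a)) 0) q a

/-- The cochain `τ̄_{2q}`; the grading of `H ⊕ H` is `diag(γ, -γ)`. -/
def TripleData.tauBar (X : TripleData A H) (q : ℕ) (a : Fin (2 * q + 1) → A) : ℂ :=
  tauConst q * supertrace (diagonal X.γ (-X.γ)) (X.tauBarOp q a)

/-- `c` is the Connes-Chern character of the `p`-summable triple `X`: for all integers
`q ≥ (p-1)/2`, the operators whose supertraces define `τ̄_{2q}` are trace-class, and `τ̄_{2q}` is a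
cyclic cocycle (in `V`) of class `c`; and the same holds for `τ_{2q}` if `D` is invertible. -/
def IsConnesChernCharacter (V : ∀ m, Submodule ℂ (Cochain A m)) (X : TripleData A H) (p : ℝ)
    (c : HP V 0) : Prop :=
  ∀ q : ℕ, (p - 1) / 2 ≤ q →
    ((∀ a, IsTraceClass (X.tauBarOp q a)) ∧
      IsCyclicCocycleOfClass V 0 (2 * q) (X.tauBar q) c) ∧
    (IsInvertible X.D →
      (∀ a, IsTraceClass (X.tauOp q a)) ∧ IsCyclicCocycleOfClass V 0 (2 * q) (X.tau q) c)

open Classical in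
/-- The Connes-Chern character, as a class in the periodic cyclic cohomology computed with the
cochains in `V`. -/
def connesChern (V : ∀ m, Submodule ℂ (Cochain A m)) (X : TripleData A H) (p : ℝ) : HP V 0 :=
  if h : ∃ c, IsConnesChernCharacter V X p c then h.choose else 0

end Triples

end TwistedST

end

/-!
Put `R = D⁻¹` for an invertible twisted operator `D`. The twisted commutators
`c(a) = D ρ(a) - ρ'(a) D` are bounded, where `ρ` is the action and `ρ' = ρ ∘ σ`, and
`ρ(a) - R c(a) = R ρ'(a) D` is a second homomorphism `π` of the algebra. Thus `(ρ, π)` is a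
quasihomomorphism: its difference `δ = R c` takes values in a Schatten class, and the cocycle
`τ_{2q}` is, up to a constant, `Str(δ(a⁰) ⋯ δ(a^{2q}))`. Unboundedness and the twist disappear from
the picture: everything is a statement about pairs of homomorphisms congruent modulo an operator
ideal, and about a supertrace. Such pairs and their traces are axiomatized by `HomPair` and
`TraceSystem`; the filtration of a `TraceSystem` is one of *functions* on a topological space, so
that it records continuity of the cochains as well as the order of vanishing. The case without
topology is that of the discrete topology on the algebra (`exists_common_character_algebraic`).

*Algebra.* The characters of a pair are cyclic cocycles, and those for `q` and `q + 1` differ by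
a `b + B` coboundary, so that they share a class (`HomPair.IsQuasi.exists_hasClass`).
If `y` is in the ideal and `y² = 0`, the characters of the pairs `(ρ, (1 + ty) π (1 - ty))` depend
polynomially on `t` and their derivative is the Hochschild coboundary of a cyclic cochain;
integration over `[0, 1]` shows that conjugating `π` by `1 + y` preserves the class. In
`2 × 2` matrices, `diag(u, u⁻¹)` with `u - 1` in the ideal is a product of three such factors, so
conjugation by any invertible `u` that is congruent to `1` preserves the class
(`HomPair.IsQuasi.hasClass_conj`).

*Comparison.* If `R₀` and `R₁` are inverses of `D₀` and `D₁ = m D₀ + W` with `W` bounded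
and `m` invertible, and `ρ₁' = m ρ₀' m⁻¹`, then the second homomorphisms of the two pairs are
conjugate by `R₁ m D₀ = 1 - R₁ W`, which is `1` modulo the ideal
(`OddInverse.hasClass_of_similar`). This applies twice. The invertible double of `D` is
`diag(D, -D)` plus a bounded operator, so that for invertible `D` it has the class of `τ`
(`isConnesChernCharacter_of_hasClass`). The double of `kDk` is `m D̄ + W` for the double `D̄` of `D`
and `m = diag(kσ(k), kσ(k))`, because `kDk = kσ(k) D + k [D, k]_σ`; and `σ̂(a)` is the conjugate of
`σ(a)` by `kσ(k)` (`hasClass_deformation`).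

*Analysis.* Schatten conditions are expressed by approximation numbers, which are submultiplicative
and are subadditive up to a doubling of the index. An operator with summable approximation numbers
is a pointwise sum of rank one operators with summable norms, hence has an absolutely convergent
trace, with `Tr(ST) = Tr(TS)` (`trace_comp_comm`). The definitions of trace class and of
`p`-summability become conditions on approximation numbers (`isTraceClass_iff`,
`isTraceClass_cfc_rpow_iff`), because those of Hilbert-Schmidt operators are square summable
(`sum_sq_approxNumber_le`) and those of `|T|ᵖ` are at most the `p`-th powers of those of `T`
(`approxNumber_cfc_rpow_le`). The resolvent of `kDk` comes from that of `D` by a Fredholm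
alternative, and resolvent and partial inverse are multiples of each other up to finite rank; thus
`p`-summability passes from `D` to `kDk`.
-/

noncomputable section

namespace TwistedST

universe u v w

/-! ### Words and the cyclic operators -/

theorem linearMap_comp_sum {ι E F G : Type*} [AddCommGroup E] [Module ℂ E] [AddCommGroup F]
    [Module ℂ F] [AddCommGroup G] [Module ℂ G] (s : Finset ι) (g : F →ₗ[ℂ] G)
    (f : ι → E →ₗ[ℂ] F) : g ∘ₗ ∑ i ∈ s, f i = ∑ i ∈ s, g ∘ₗ f i := by
  ext x
  simp

theorem linearMap_sum_comp {ι E F G : Type*} [AddCommGroup E] [Module ℂ E] [AddCommGroup F]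
    [Module ℂ F] [AddCommGroup G] [Module ℂ G] (s : Finset ι) (g : ι → F →ₗ[ℂ] G)
    (f : E →ₗ[ℂ] F) : (∑ i ∈ s, g i) ∘ₗ f = ∑ i ∈ s, g i ∘ₗ f := by
  ext x
  simp

section Cochains

variable {A : Type u} [Ring A] [Algebra ℂ A]

theorem hochschild_apply {m : ℕ} (φ : Cochain A m) (a : Fin (m + 2) → A) :
    hochschild m φ a = ∑ j : Fin (m + 1), (-1 : ℂ) ^ (j : ℕ) * φ (face j a) +
      (-1 : ℂ) ^ (m + 1) * φ (lastFace a) := by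
  simp [hochschild, precomp]

theorem cyclicT_apply {m : ℕ} (φ : Cochain A m) (a : Fin (m + 1) → A) :
    cyclicT m φ a = (-1 : ℂ) ^ m * φ (rotate a) := by
  simp [cyclicT, precomp]

theorem connesB₀_apply {m : ℕ} (φ : Cochain A (m + 1)) (a : Fin (m + 1) → A) :
    connesB₀ m φ a = φ (Fin.cons 1 a : Fin (m + 2) → A) := rfl

theorem face_zero {m : ℕ} (a : Fin (m + 2) → A) :
    face 0 a = Fin.cons (a 0 * a 1) (fun i : Fin m => a i.succ.succ) := by
  ext i
  refine Fin.cases ?_ (fun i => ?_) i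
  · simp [face, Fin.contractNth]
  · simp [face, Fin.contractNth]

theorem face_succ {m : ℕ} (j : Fin (m + 1)) (a : Fin (m + 3) → A) :
    face j.succ a = Fin.cons (a 0) (face j (Fin.tail a)) := by
  ext i
  refine Fin.cases ?_ (fun i => ?_) i
  · simp [face, Fin.contractNth]
  · simp only [face, Fin.contractNth, Fin.cons_succ, Fin.val_castSucc, Fin.val_succ, Fin.tail]
    simp only [Nat.add_lt_add_iff_right, Nat.add_right_cancel_iff, Fin.succ_castSucc]

theorem face_zero_rotate {m : ℕ} (a : Fin (m + 2) → A) : face 0 (rotate a) = lastFace a := by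
  rw [face_zero]
  rfl

theorem face_succ_rotate {m : ℕ} (j : Fin m) (a : Fin (m + 2) → A) :
    face j.succ (rotate a) = rotate (face j.castSucc a) := by
  obtain ⟨j, hj⟩ := j
  ext ⟨i, hi⟩
  rcases i with _ | i
  · have h1 : ¬ m < j := by omega
    have h2 : m ≠ j := by omega
    simp only [face, rotate, Fin.contractNth, Fin.val_succ, Fin.val_castSucc, Fin.zero_eta,
      Fin.cons_zero, Fin.val_last, h1, h2, if_false]
    simp
  · obtain ⟨m, rfl⟩ : ∃ k, m = k + 1 := ⟨m - 1, by omega⟩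
    have e1 : (⟨i + 1, hi⟩ : Fin (m + 2)) = Fin.succ ⟨i, by omega⟩ := rfl
    have e2 : ∀ h, (⟨i, h⟩ : Fin (m + 2)).succ = ⟨i + 1, by omega⟩ := fun _ => rfl
    simp only [face, rotate, Fin.contractNth, Fin.val_succ, Fin.val_castSucc, e1, Fin.cons_succ]
    simp only [Nat.add_lt_add_iff_right, Nat.add_right_cancel_iff]
    split_ifs <;> rfl

theorem lastFace_rotate {m : ℕ} (a : Fin (m + 2) → A) :
    lastFace (rotate a) = rotate (face (Fin.last m) a) := by
  ext i
  refine Fin.cases ?_ (fun i => ?_) i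
  · simp only [lastFace, rotate, face, Fin.cons_zero, Fin.contractNth, Fin.val_castSucc,
      Fin.val_last, lt_irrefl, if_false, if_true]
    rw [show (Fin.last (m + 1)) = (Fin.last m).succ from rfl, Fin.cons_succ]
  · simp only [lastFace, rotate, face, Fin.cons_succ, Fin.contractNth, Fin.val_castSucc,
      Fin.val_last, i.2, if_true]
    rfl

/-- The simplicial structure maps of the cyclic module, with their signs, as an `ℕ`-indexed family:
`±(φ ∘ face)` in degrees `0, …, m`, then continued by `D_{l + m + 1} = T D_l`. In degree `m + 1`
this is the cyclic face. -/
def signedFace (m : ℕ) : ℕ → (Cochain A m →ₗ[ℂ] Cochain A (m + 1))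
  | l => if h : l < m + 1 then (-1 : ℂ) ^ l • precomp (face ⟨l, h⟩) (face_update _)
      else cyclicT (m + 1) ∘ₗ signedFace m (l - (m + 1))
termination_by l => l

theorem signedFace_of_lt {m l : ℕ} (h : l < m + 1) :
    signedFace (A := A) m l = (-1 : ℂ) ^ l • precomp (face ⟨l, h⟩) (face_update _) := by
  rw [signedFace, dif_pos h]

theorem signedFace_add (m l : ℕ) :
    signedFace (A := A) m (m + 1 + l) = cyclicT (m + 1) ∘ₗ signedFace m l := by
  rw [signedFace, dif_neg (by omega), Nat.add_sub_cancel_left]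

theorem signedFace_last (m : ℕ) : signedFace (A := A) m (m + 1) =
    (-1 : ℂ) ^ (m + 1) • precomp lastFace lastFace_update := by
  have h := signedFace_add (A := A) m 0
  rw [add_zero] at h
  rw [h, signedFace_of_lt (Nat.succ_pos m)]
  ext φ a
  simp only [LinearMap.comp_apply, cyclicT_apply, pow_zero, one_smul, LinearMap.smul_apply,
    _root_.smul_apply, smul_eq_mul]
  congr 1
  exact congrArg φ (face_zero_rotate a)

/-- The simplicial relations `T D_{l+1} = D_l T` hold along the whole extended family, because
they pass from `l` to `l + m + 1`. -/
theorem cyclicT_comp_signedFace (m l : ℕ) :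
    cyclicT (m + 1) ∘ₗ signedFace (A := A) m (l + 1) = signedFace m l ∘ₗ cyclicT m := by
  induction l using Nat.strong_induction_on with
  | _ l ih =>
    rcases lt_trichotomy l m with h | rfl | h
    · rw [signedFace_of_lt (by omega), signedFace_of_lt (by omega)]
      ext φ a
      have := congrArg φ (face_succ_rotate ⟨l, h⟩ a)
      simp only [LinearMap.comp_apply, cyclicT_apply, LinearMap.smul_apply,
        _root_.smul_apply, smul_eq_mul]
      simp only [precomp, LinearMap.coe_mk, AddHom.coe_mk, MultilinearMap.coe_mk, cyclicT_apply]
      simp only [Fin.succ_mk, Fin.castSucc_mk] at this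
      rw [this]
      ring
    · rw [signedFace_last, signedFace_of_lt (by omega)]
      ext φ a
      have := congrArg φ (lastFace_rotate a)
      simp only [LinearMap.comp_apply, cyclicT_apply, LinearMap.smul_apply,
        _root_.smul_apply, smul_eq_mul]
      simp only [precomp, LinearMap.coe_mk, AddHom.coe_mk, MultilinearMap.coe_mk, cyclicT_apply]
      simp only [Fin.last] at this
      rw [this]
      ring
    · obtain ⟨k, rfl⟩ : ∃ k, l = m + 1 + k := ⟨l - (m + 1), by omega⟩
      rw [add_assoc (m + 1) k 1, signedFace_add, signedFace_add, ih k (by omega), LinearMap.comp_assoc]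

theorem hochschild_eq_sum_signedFace (m : ℕ) :
    hochschild (A := A) m = ∑ l ∈ Finset.range (m + 2), signedFace m l := by
  rw [Finset.sum_range_succ, signedFace_last, hochschild, Finset.sum_range]
  congr 1
  exact Finset.sum_congr rfl fun j _ => (signedFace_of_lt j.2).symm

theorem signedFace_comp_pow (m i j : ℕ) :
    signedFace (A := A) m i ∘ₗ (cyclicT m ^ j) = (cyclicT (m + 1) ^ j) ∘ₗ signedFace m (i + j) := by
  induction j generalizing i with
  | zero => rfl
  | succ j ih =>
    rw [pow_succ', Module.End.mul_eq_comp, ← LinearMap.comp_assoc, ← cyclicT_comp_signedFace,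
      LinearMap.comp_assoc, ih, ← LinearMap.comp_assoc, ← Module.End.mul_eq_comp, ← pow_succ',
      add_assoc i 1 j, add_comm 1 j]

/-- The relation `b N = N b'`, where `b'` is the alternating sum of the noncyclic faces. -/
theorem hochschild_comp_cyclicSum (m : ℕ) :
    hochschild (A := A) m ∘ₗ cyclicSum m =
      cyclicSum (m + 1) ∘ₗ ∑ l ∈ Finset.range (m + 1), signedFace m l := by
  have key : ∀ j ∈ Finset.range (m + 1), hochschild (A := A) m ∘ₗ (cyclicT m ^ j) =
      (cyclicT (m + 1) ^ j) ∘ₗ (∑ l ∈ Finset.Ico j (m + 1), signedFace m l) +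
      (cyclicT (m + 1) ^ (j + 1)) ∘ₗ (∑ l ∈ Finset.range (j + 1), signedFace m l) := by
    intro j hj
    have hj := Finset.mem_range.1 hj
    have h1 : ∑ i ∈ Finset.range (m + 2), signedFace (A := A) m (i + j) =
        ∑ l ∈ Finset.Ico j (m + 1), signedFace m l +
          ∑ l ∈ Finset.range (j + 1), signedFace m (m + 1 + l) := by
      have e1 : ∑ i ∈ Finset.range (m + 2), signedFace (A := A) m (i + j) =
          ∑ l ∈ Finset.Ico j (m + 1 + (j + 1)), signedFace m l := by
        rw [Finset.sum_Ico_eq_sum_range, show m + 1 + (j + 1) - j = m + 2 by omega]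
        exact Finset.sum_congr rfl fun i _ => by rw [add_comm i j]
      have e2 : ∑ l ∈ Finset.range (j + 1), signedFace (A := A) m (m + 1 + l) =
          ∑ l ∈ Finset.Ico (m + 1) (m + 1 + (j + 1)), signedFace m l := by
        rw [Finset.sum_Ico_eq_sum_range, Nat.add_sub_cancel_left]
      rw [e1, e2, Finset.sum_Ico_consecutive _ (by omega) (by omega)]
    rw [hochschild_eq_sum_signedFace, linearMap_sum_comp]
    simp only [signedFace_comp_pow]
    rw [← linearMap_comp_sum, h1, LinearMap.comp_add]
    simp only [signedFace_add]
    rw [← linearMap_comp_sum, ← LinearMap.comp_assoc (R₁ := ℂ), ← Module.End.mul_eq_comp,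
      ← pow_succ]
  have tail : ∑ j ∈ Finset.range (m + 1), (cyclicT (m + 1) ^ (j + 1)) ∘ₗ
      (∑ l ∈ Finset.range (j + 1), signedFace (A := A) m l) =
      ∑ j ∈ Finset.range (m + 2), (cyclicT (m + 1) ^ j) ∘ₗ
      (∑ l ∈ Finset.range j, signedFace (A := A) m l) := by
    rw [Finset.sum_range_succ' _ (m + 1)]
    simp
  have head : ∑ j ∈ Finset.range (m + 1), (cyclicT (m + 1) ^ j) ∘ₗ
      (∑ l ∈ Finset.Ico j (m + 1), signedFace (A := A) m l) =
      ∑ j ∈ Finset.range (m + 2), (cyclicT (m + 1) ^ j) ∘ₗ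
      (∑ l ∈ Finset.Ico j (m + 1), signedFace (A := A) m l) := by
    rw [Finset.sum_range_succ _ (m + 1)]
    simp
  rw [cyclicSum, linearMap_comp_sum, Finset.sum_congr rfl key, Finset.sum_add_distrib, tail, head,
    ← Finset.sum_add_distrib, cyclicSum, linearMap_sum_comp]
  refine Finset.sum_congr rfl fun j hj => ?_
  have hj := Finset.mem_range.1 hj
  rw [← LinearMap.comp_add, ← Finset.sum_range_add_sum_Ico (signedFace m) (show j ≤ m + 1 by omega)]
  exact congrArg _ (add_comm _ _)

theorem rotate_iterate_last {m : ℕ} (a : Fin (m + 1) → A) : rotate^[m + 1] a = a := by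
  have key : ∀ j, ∀ i : Fin (m + 1), rotate^[j] a i = a (i - Fin.ofNat (m + 1) j) := by
    intro j
    induction j with
    | zero => intro i; simp
    | succ j ih =>
      intro i
      rw [Function.iterate_succ_apply']
      refine Fin.cases ?_ (fun i => ?_) i
      · simp only [rotate, Fin.cons_zero]
        rw [ih]
        congr 1
        have : (Fin.last m) = (0 : Fin (m + 1)) - 1 := by
          rw [zero_sub, eq_neg_iff_add_eq_zero, Fin.last_add_one]
        rw [this]
        have : Fin.ofNat (m + 1) (j + 1) = Fin.ofNat (m + 1) j + 1 := by
          ext; simp [Fin.val_add]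
        rw [this]
        abel
      · simp only [rotate, Fin.cons_succ]
        rw [ih]
        congr 1
        have : i.castSucc = i.succ - 1 := by
          rw [eq_sub_iff_add_eq, Fin.coeSucc_eq_succ]
        rw [this]
        have : Fin.ofNat (m + 1) (j + 1) = Fin.ofNat (m + 1) j + 1 := by
          ext; simp [Fin.val_add]
        rw [this]
        abel
  funext i
  rw [key]
  simp

theorem cyclicT_pow_apply {m : ℕ} (j : ℕ) (φ : Cochain A m) (a : Fin (m + 1) → A) :
    (cyclicT m ^ j) φ a = ((-1 : ℂ) ^ m) ^ j * φ (rotate^[j] a) := by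
  induction j generalizing a with
  | zero => simp
  | succ j ih =>
    rw [pow_succ', Module.End.mul_apply, cyclicT_apply, ih, Function.iterate_succ_apply]
    ring

theorem cyclicT_pow_succ_self (m : ℕ) : cyclicT (A := A) m ^ (m + 1) = 1 := by
  ext φ a
  rw [cyclicT_pow_apply, rotate_iterate_last, ← pow_mul, (Nat.even_mul_succ_self m).neg_one_pow]
  simp

theorem cyclicT_comp_cyclicSum (m : ℕ) : cyclicT (A := A) m ∘ₗ cyclicSum m = cyclicSum m := by
  rw [cyclicSum, linearMap_comp_sum]
  simp only [← Module.End.mul_eq_comp, ← pow_succ']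
  rw [← sub_eq_zero, ← Finset.sum_sub_distrib, Finset.sum_range_sub, cyclicT_pow_succ_self]
  simp

theorem cyclicSum_comp_cyclicT (m : ℕ) : cyclicSum (A := A) m ∘ₗ cyclicT m = cyclicSum m := by
  rw [cyclicSum, linearMap_sum_comp]
  simp only [← Module.End.mul_eq_comp, ← pow_succ]
  rw [← sub_eq_zero, ← Finset.sum_sub_distrib, Finset.sum_range_sub, cyclicT_pow_succ_self]
  simp

theorem cyclicSum_of_cyclic {m : ℕ} {φ : Cochain A m} (h : cyclicT m φ = φ) :
    cyclicSum m φ = ((m : ℂ) + 1) • φ := by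
  have : ∀ j, (cyclicT m ^ j) φ = φ := fun j => by
    induction j with
    | zero => simp
    | succ j ih => rw [pow_succ', Module.End.mul_apply, ih, h]
  simp [cyclicSum, LinearMap.sum_apply, this, add_smul, Nat.cast_smul_eq_nsmul]

theorem connesB_of_cyclic {m : ℕ} {φ : Cochain A (m + 1)} (h : cyclicT (m + 1) φ = φ) :
    connesB m φ = 0 := by
  simp [connesB, h]

end Cochains

/-! ### Quasihomomorphisms and their characters -/

section Words

variable {A : Type u} [Ring A] [Algebra ℂ A] {B : Type w} [Ring B] [Algebra ℂ B]

/-- The multilinear map `(a₁, …, aₙ) ↦ L₁(a₁) ⋯ Lₙ(aₙ)`. -/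
def wordMap {n : ℕ} (L : Fin n → A →ₗ[ℂ] B) : MultilinearMap ℂ (fun _ : Fin n => A) B :=
  (MultilinearMap.mkPiAlgebraFin ℂ n B).compLinearMap L

theorem wordMap_apply {n : ℕ} (L : Fin n → A →ₗ[ℂ] B) (a : Fin n → A) :
    wordMap L a = (List.ofFn fun i => L i (a i)).prod := rfl

theorem wordMap_zero (L : Fin 0 → A →ₗ[ℂ] B) (a : Fin 0 → A) : wordMap L a = 1 := by
  simp [wordMap_apply]

theorem wordMap_succ {n : ℕ} (L : Fin (n + 1) → A →ₗ[ℂ] B) (a : Fin (n + 1) → A) :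
    wordMap L a = L 0 (a 0) * wordMap (Fin.tail L) (Fin.tail a) := by
  rw [wordMap_apply, List.ofFn_succ, List.prod_cons]
  rfl

theorem wordMap_succ' {n : ℕ} (L : Fin (n + 1) → A →ₗ[ℂ] B) (a : Fin (n + 1) → A) :
    wordMap L a = wordMap (Fin.init L) (Fin.init a) * L (Fin.last n) (a (Fin.last n)) := by
  rw [wordMap_apply, List.ofFn_succ', List.prod_concat]
  rfl

/-- The word `δ(a₁) ⋯ δ(aₙ)`. -/
abbrev powWord (δ : A →ₗ[ℂ] B) {n : ℕ} (a : Fin n → A) : B := wordMap (fun _ => δ) a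

theorem powWord_cons (δ : A →ₗ[ℂ] B) {n : ℕ} (x : A) (a : Fin n → A) :
    powWord δ (Fin.cons x a : Fin (n + 1) → A) = δ x * powWord δ a := by
  rw [powWord, wordMap_succ]
  simp [Fin.tail_def]

theorem powWord_succ (δ : A →ₗ[ℂ] B) {n : ℕ} (a : Fin (n + 1) → A) :
    powWord δ a = δ (a 0) * powWord δ (Fin.tail a) := wordMap_succ _ _

theorem powWord_succ' (δ : A →ₗ[ℂ] B) {n : ℕ} (a : Fin (n + 1) → A) :
    powWord δ a = powWord δ (Fin.init a) * δ (a (Fin.last n)) := wordMap_succ' _ _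

/-- If `δ(xy) = π₂(x)δ(y) + δ(x)π₁(y)` with `π₁ = π₂ + δ`, then the alternating sum of the inner
faces of the word `δ(a₀) ⋯ δ(a_{n+1})` telescopes. -/
theorem sum_face_powWord (π₁ π₂ δ : A →ₗ[ℂ] B) (h : ∀ x, π₁ x = π₂ x + δ x)
    (hδ : ∀ x y, δ (x * y) = π₂ x * δ y + δ x * π₁ y) {n : ℕ} (a : Fin (n + 2) → A) :
    ∑ j : Fin (n + 1), (-1 : ℂ) ^ (j : ℕ) • powWord δ (face j a) =
      π₂ (a 0) * powWord δ (Fin.tail a) +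
        (-1 : ℂ) ^ n • (powWord δ (Fin.init a) * π₂ (a (Fin.last (n + 1)))) +
        (if Even n then powWord δ a else 0) := by
  induction n with
  | zero =>
    simp only [Fin.sum_univ_succ, Finset.univ_eq_empty, Finset.sum_empty]
    rw [face_zero, powWord_cons]
    simp only [powWord_succ, powWord, wordMap_zero]
    simp only [Fin.tail, Fin.init, hδ, h]
    simp
    noncomm_ring
  | succ n ih =>
    rw [Fin.sum_univ_succ]
    have e : ∀ j : Fin (n + 1), (-1 : ℂ) ^ ((j.succ : Fin (n + 2)) : ℕ) • powWord δ (face j.succ a) =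
        -(δ (a 0) * ((-1 : ℂ) ^ (j : ℕ) • powWord δ (face j (Fin.tail a)))) := by
      intro j
      rw [face_succ, powWord_cons, Fin.val_succ, pow_succ]
      simp
    rw [Finset.sum_congr rfl fun j _ => e j, Finset.sum_neg_distrib, ← Finset.mul_sum, ih,
      face_zero, powWord_cons]
    have e1 : (fun i : Fin (n + 1) => a i.succ.succ) = Fin.tail (Fin.tail a) := rfl
    have e2 : powWord δ (Fin.tail a) = δ (a 1) * powWord δ (Fin.tail (Fin.tail a)) :=
      powWord_succ _ _
    have e3 : powWord δ a = δ (a 0) * powWord δ (Fin.tail a) := powWord_succ _ _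
    have e4 : powWord δ (Fin.init a) = δ (a 0) * powWord δ (Fin.init (Fin.tail a)) :=
      powWord_succ _ _
    have e5 : Fin.tail a 0 = a 1 := rfl
    have e6 : Fin.tail a (Fin.last (n + 1)) = a (Fin.last (n + 1 + 1)) := rfl
    rw [e1, e4, e3, e2, e5, e6, hδ, h]
    simp only [Nat.even_add_one, pow_succ]
    split_ifs with hn
    · simp [hn.neg_one_pow]
      noncomm_ring
    · have := (Nat.not_even_iff_odd.1 hn).neg_one_pow (α := ℂ)
      simp [this]
      noncomm_ring

end Words

/-- A filtered algebra `B` with a trace on the terms of filtration degree at least `N`. The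
filtration is one of functions with values in `B`, so that it also records in which sense elements
of `B` depend continuously on parameters; the model is the filtration of bounded operators by
Schatten classes. -/
structure TraceSystem (B : Type w) [Ring B] [Algebra ℂ B] where
  /-- The functions `X → B` of filtration degree `k`. -/
  fil : ∀ (X : Type u) [TopologicalSpace X], ℕ → Submodule ℂ (X → B)
  const_mem : ∀ (X : Type u) [TopologicalSpace X] (b : B), (fun _ => b) ∈ fil X 0
  antitone : ∀ (X : Type u) [TopologicalSpace X] (k : ℕ), fil X (k + 1) ≤ fil X k
  mul_mem : ∀ (X : Type u) [TopologicalSpace X] {k l : ℕ} {F G : X → B}, F ∈ fil X k →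
    G ∈ fil X l → F * G ∈ fil X (k + l)
  comp_mem : ∀ {X Y : Type u} [TopologicalSpace X] [TopologicalSpace Y] {k : ℕ} {F : Y → B}
    {g : X → Y}, F ∈ fil Y k → Continuous g → F ∘ g ∈ fil X k
  /-- The trace. -/
  τ : B →ₗ[ℂ] ℂ
  /-- The filtration degree from which on `τ` is a continuous trace. -/
  N : ℕ
  trace_comm : ∀ (X : Type u) [TopologicalSpace X] {k l : ℕ} {F G : X → B}, F ∈ fil X k →
    G ∈ fil X l → N ≤ k + l → ∀ ξ, τ (F ξ * G ξ) = τ (G ξ * F ξ)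
  continuous_trace : ∀ (X : Type u) [TopologicalSpace X] {F : X → B}, F ∈ fil X N →
    Continuous fun ξ => τ (F ξ)

namespace TraceSystem

variable {B : Type w} [Ring B] [Algebra ℂ B] (S : TraceSystem.{u} B)

theorem fil_anti (X : Type u) [TopologicalSpace X] {k l : ℕ} (h : k ≤ l) : S.fil X l ≤ S.fil X k :=
  antitone_nat_of_succ_le (S.antitone X) h

/-- The elements of `B` of filtration degree `k`. -/
def ideal (k : ℕ) : Submodule ℂ B :=
  (S.fil PUnit k).comap (LinearMap.pi fun _ => LinearMap.id)

theorem mem_ideal {k : ℕ} {b : B} : b ∈ S.ideal k ↔ (fun _ : PUnit => b) ∈ S.fil PUnit k := Iff.rfl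

theorem const_mem_fil (X : Type u) [TopologicalSpace X] {k : ℕ} {b : B} (hb : b ∈ S.ideal k) :
    (fun _ : X => b) ∈ S.fil X k :=
  S.comp_mem (g := fun _ : X => PUnit.unit) (S.mem_ideal.1 hb) continuous_const

theorem apply_mem_ideal {X : Type u} [TopologicalSpace X] {k : ℕ} {F : X → B}
    (hF : F ∈ S.fil X k) (ξ : X) : F ξ ∈ S.ideal k :=
  S.comp_mem (g := fun _ : PUnit => ξ) hF continuous_const

theorem mem_ideal_zero (b : B) : b ∈ S.ideal 0 := S.const_mem _ _

theorem mul_mem_ideal {k l : ℕ} {x y : B} (hx : x ∈ S.ideal k) (hy : y ∈ S.ideal l) :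
    x * y ∈ S.ideal (k + l) := S.mul_mem PUnit hx hy

theorem mul_mem_ideal_left {l : ℕ} (x : B) {y : B} (hy : y ∈ S.ideal l) :
    x * y ∈ S.ideal l := by
  simpa using S.mul_mem_ideal (S.mem_ideal_zero x) hy

theorem trace_mul_comm {k l : ℕ} {x y : B} (hx : x ∈ S.ideal k) (hy : y ∈ S.ideal l)
    (h : S.N ≤ k + l) : S.τ (x * y) = S.τ (y * x) :=
  S.trace_comm PUnit hx hy h PUnit.unit

theorem continuous_trace_of_le {X : Type u} [TopologicalSpace X] {k : ℕ} {F : X → B}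
    (hF : F ∈ S.fil X k) (h : S.N ≤ k) : Continuous fun ξ => S.τ (F ξ) :=
  S.continuous_trace X (S.fil_anti X h hF)

variable {A : Type u} [Ring A] [Algebra ℂ A]

theorem wordMap_mem_fil [TopologicalSpace A] {n : ℕ} (L : Fin n → A →ₗ[ℂ] B) (k : Fin n → ℕ)
    (hL : ∀ i, (fun a => L i a) ∈ S.fil A (k i)) :
    (fun a => wordMap L a) ∈ S.fil (Fin n → A) (∑ i, k i) := by
  induction n with
  | zero =>
    simp only [wordMap_zero, Finset.univ_eq_empty, Finset.sum_empty]
    exact S.const_mem _ _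
  | succ n ih =>
    rw [Fin.sum_univ_succ]
    have h1 : (fun a : Fin (n + 1) → A => L 0 (a 0)) ∈ S.fil (Fin (n + 1) → A) (k 0) :=
      S.comp_mem (hL 0) (continuous_apply 0)
    have h2 : (fun a : Fin (n + 1) → A => wordMap (Fin.tail L) (Fin.tail a)) ∈
        S.fil (Fin (n + 1) → A) (∑ i : Fin n, k i.succ) :=
      S.comp_mem (ih (Fin.tail L) (fun i => k i.succ) fun i => hL i.succ)
        (continuous_pi fun i => continuous_apply i.succ)
    have := S.mul_mem _ h1 h2
    simp only [wordMap_succ]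
    exact this

end TraceSystem

/-- A pair of homomorphisms `π₁, π₂ : A → B`, not necessarily unital. -/
structure HomPair (A : Type u) [Ring A] [Algebra ℂ A] (B : Type w) [Ring B] [Algebra ℂ B] where
  π₁ : A →ₙₐ[ℂ] B
  π₂ : A →ₙₐ[ℂ] B

namespace HomPair

variable {A : Type u} [Ring A] [Algebra ℂ A] {B : Type w} [Ring B] [Algebra ℂ B]
  (Q : HomPair A B) (S : TraceSystem.{u} B)

/-- The first homomorphism as a linear map. -/
def lin₁ : A →ₗ[ℂ] B := Q.π₁
/-- The second homomorphism as a linear map. -/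
def lin₂ : A →ₗ[ℂ] B := Q.π₂

/-- The difference `δ = π₁ - π₂`. -/
def δ : A →ₗ[ℂ] B := Q.lin₁ - Q.lin₂

theorem lin₁_eq (x : A) : Q.lin₁ x = Q.lin₂ x + Q.δ x := by simp [δ]

theorem lin₁_mul (x y : A) : Q.lin₁ (x * y) = Q.lin₁ x * Q.lin₁ y := map_mul Q.π₁ x y
theorem lin₂_mul (x y : A) : Q.lin₂ (x * y) = Q.lin₂ x * Q.lin₂ y := map_mul Q.π₂ x y

theorem δ_mul (x y : A) : Q.δ (x * y) = Q.lin₂ x * Q.δ y + Q.δ x * Q.lin₁ y := by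
  simp only [δ, LinearMap.sub_apply, lin₁_mul, lin₂_mul]
  noncomm_ring

theorem δ_mul' (x y : A) : Q.δ (x * y) = Q.lin₁ x * Q.δ y + Q.δ x * Q.lin₂ y := by
  simp only [δ, LinearMap.sub_apply, lin₁_mul, lin₂_mul]
  noncomm_ring

/-- The pair is a quasihomomorphism: the difference of the two homomorphisms has filtration
degree `1`. -/
structure IsQuasi [TopologicalSpace A] : Prop where
  fst_mem : (fun a => Q.lin₁ a) ∈ S.fil A 0
  snd_mem : (fun a => Q.lin₂ a) ∈ S.fil A 0
  δ_mem : (fun a => Q.δ a) ∈ S.fil A 1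

/-- The cochain `(a⁰, …, aⁿ) ↦ τ(L(a⁰)δ(a¹) ⋯ δ(aⁿ))`. -/
def headCochain (L : A →ₗ[ℂ] B) (n : ℕ) : Cochain A n :=
  S.τ.compMultilinearMap (wordMap (Fin.cons L fun _ : Fin n => Q.δ))

theorem headCochain_apply (L : A →ₗ[ℂ] B) {n : ℕ} (a : Fin (n + 1) → A) :
    Q.headCochain S L n a = S.τ (L (a 0) * powWord Q.δ (Fin.tail a)) := by
  rw [headCochain, LinearMap.compMultilinearMap_apply, wordMap_succ]
  simp [Fin.tail_def]

/-- The character `(a⁰, …, aⁿ) ↦ τ(δ(a⁰) ⋯ δ(aⁿ))` of the pair. -/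
def character (n : ℕ) : Cochain A n := Q.headCochain S Q.δ n

theorem character_apply {n : ℕ} (a : Fin (n + 1) → A) :
    Q.character S n a = S.τ (powWord Q.δ a) := by
  rw [character, headCochain_apply, powWord_succ]

variable {Q S} [TopologicalSpace A]

theorem IsQuasi.powWord_mem (hQ : Q.IsQuasi S) {n : ℕ} (a : Fin n → A) :
    powWord Q.δ a ∈ S.ideal n := by
  have := S.apply_mem_ideal (S.wordMap_mem_fil (fun _ : Fin n => Q.δ) (fun _ => 1)
    fun _ => hQ.δ_mem) a
  simpa using this

theorem IsQuasi.δ_mem_ideal (hQ : Q.IsQuasi S) (a : A) : Q.δ a ∈ S.ideal 1 :=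
  S.apply_mem_ideal hQ.δ_mem a

theorem IsQuasi.continuous_headCochain (hQ : Q.IsQuasi S) {L : A →ₗ[ℂ] B} {k n : ℕ}
    (hL : (fun a => L a) ∈ S.fil A k) (h : S.N ≤ k + n) :
    Q.headCochain S L n ∈ continuousCochains A n := by
  have := S.wordMap_mem_fil (Fin.cons L fun _ : Fin n => Q.δ) (Fin.cons k fun _ => 1)
    (Fin.cases hL fun i => hQ.δ_mem)
  rw [Fin.sum_univ_succ] at this
  simp only [Fin.cons_zero, Fin.cons_succ, Finset.sum_const, Finset.card_univ, Fintype.card_fin,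
    smul_eq_mul, mul_one] at this
  exact S.continuous_trace_of_le this h

theorem IsQuasi.character_mem (hQ : Q.IsQuasi S) {n : ℕ} (h : S.N ≤ n + 1) :
    Q.character S n ∈ continuousCochains A n :=
  hQ.continuous_headCochain hQ.δ_mem (by omega)

theorem IsQuasi.character_cyclic (hQ : Q.IsQuasi S) {n : ℕ} (hn : Even n) (h : S.N ≤ n + 1) :
    cyclicT n (Q.character S n) = Q.character S n := by
  ext a
  rw [cyclicT_apply, hn.neg_one_pow, one_mul, character_apply, character_apply, rotate,
    powWord_cons, S.trace_mul_comm (hQ.δ_mem_ideal _) (hQ.powWord_mem _) (by omega),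
    powWord_succ' _ a]
  rfl

theorem hochschild_headCochain_sum (L : A →ₗ[ℂ] B) {n : ℕ} (a : Fin (n + 3) → A) :
    ∑ j : Fin (n + 1), (-1 : ℂ) ^ (j : ℕ) * Q.headCochain S L (n + 1) (face j.succ a) =
      S.τ (L (a 0) * (Q.lin₂ (a 1) * powWord Q.δ (Fin.tail (Fin.tail a)) +
        (-1 : ℂ) ^ n • (powWord Q.δ (Fin.init (Fin.tail a)) * Q.lin₂ (a (Fin.last (n + 2)))) +
        (if Even n then powWord Q.δ (Fin.tail a) else 0))) := by
  have := sum_face_powWord Q.lin₁ Q.lin₂ Q.δ Q.lin₁_eq Q.δ_mul (Fin.tail a)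
  have e5 : Fin.tail a 0 = a 1 := rfl
  have e6 : Fin.tail a (Fin.last (n + 1)) = a (Fin.last (n + 1 + 1)) := rfl
  rw [e5, e6] at this
  rw [← this, Finset.mul_sum, map_sum]
  refine Finset.sum_congr rfl fun j _ => ?_
  rw [headCochain_apply, face_succ]
  simp [Fin.tail_def]

/-- By the telescoping of the inner faces and the trace property, all terms of `bτ` cancel. -/
theorem IsQuasi.hochschild_character (hQ : Q.IsQuasi S) {n : ℕ} (hn : Even n) (h : S.N ≤ n + 1) :
    hochschild n (Q.character S n) = 0 := by
  ext a
  have h1 := sum_face_powWord Q.lin₁ Q.lin₂ Q.δ Q.lin₁_eq Q.δ_mul a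
  have h2 : ∑ j : Fin (n + 1), (-1 : ℂ) ^ (j : ℕ) * Q.character S n (face j a) =
      S.τ (∑ j : Fin (n + 1), (-1 : ℂ) ^ (j : ℕ) • powWord Q.δ (face j a)) := by
    rw [map_sum]
    refine Finset.sum_congr rfl fun j _ => ?_
    rw [character_apply, map_smul, smul_eq_mul]
  rw [hochschild_apply, h2, h1, if_pos hn, pow_succ, hn.neg_one_pow, character_apply, lastFace,
    powWord_cons, Q.δ_mul']
  set M : B := powWord Q.δ (fun i : Fin n => a i.succ.castSucc) with hM
  have hMm : M ∈ S.ideal n := hQ.powWord_mem _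
  have e1 : powWord Q.δ (Fin.tail a) = M * Q.δ (a (Fin.last (n + 1))) := powWord_succ' _ _
  have e2 : powWord Q.δ (Fin.init a) = Q.δ (a 0) * M := powWord_succ _ _
  have e3 : powWord Q.δ a = Q.δ (a 0) * M * Q.δ (a (Fin.last (n + 1))) := by
    rw [powWord_succ', e2]
  rw [e1, e2, e3]
  have hd := hQ.δ_mem_ideal
  have k1 : S.τ (Q.lin₁ (a (Fin.last (n + 1))) * Q.δ (a 0) * M) =
      S.τ (Q.δ (a 0) * M * Q.lin₁ (a (Fin.last (n + 1)))) := by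
    rw [mul_assoc]
    exact S.trace_mul_comm (S.mem_ideal_zero _) (S.mul_mem_ideal (hd _) hMm) (by omega)
  have k2 : S.τ (Q.δ (a (Fin.last (n + 1))) * Q.lin₂ (a 0) * M) =
      S.τ (Q.lin₂ (a 0) * (M * Q.δ (a (Fin.last (n + 1))))) := by
    rw [mul_assoc, S.trace_mul_comm (hd _) (S.mul_mem_ideal_left _ hMm) (by omega), mul_assoc]
  rw [add_mul]
  simp only [map_add, k1, k2]
  simp only [Q.lin₁_eq (a (Fin.last (n + 1))), mul_add, map_add, one_smul]
  simp
  ring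

/-- The cochain `(a⁰, …, aⁿ) ↦ τ((π₁ + π₂)(a⁰)δ(a¹) ⋯ δ(aⁿ))`, which relates the characters in
degrees `n - 1` and `n + 1`. -/
def transgression (Q : HomPair A B) (S : TraceSystem.{u} B) (n : ℕ) : Cochain A n :=
  Q.headCochain S (Q.lin₁ + Q.lin₂) n

/-- With `connesB_transgression`, the periodicity relation: the characters in degrees `n` and
`n + 2` are `B` and `b` of one cochain. -/
theorem IsQuasi.hochschild_transgression (hQ : Q.IsQuasi S) {n : ℕ} (hn : Even n)
    (h : S.N ≤ n + 1) :
    hochschild (n + 1) (Q.transgression S (n + 1)) = Q.character S (n + 2) := by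
  ext a
  rw [hochschild_apply, Fin.sum_univ_succ]
  have e : ∀ j : Fin (n + 1), (-1 : ℂ) ^ ((j.succ : Fin (n + 2)) : ℕ) *
      Q.transgression S (n + 1) (face j.succ a) = -((-1 : ℂ) ^ (j : ℕ) *
      Q.headCochain S (Q.lin₁ + Q.lin₂) (n + 1) (face j.succ a)) := by
    intro j
    rw [Fin.val_succ, pow_succ, transgression]
    ring
  rw [Finset.sum_congr rfl fun j _ => e j, Finset.sum_neg_distrib, hochschild_headCochain_sum,
    transgression, headCochain_apply, headCochain_apply, face_zero, lastFace, character_apply,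
    if_pos hn, pow_succ, pow_succ, hn.neg_one_pow]
  simp only [Fin.cons_zero, Fin.tail_cons]
  have e1 : (fun i : Fin (n + 1) => a i.succ.succ) = Fin.tail (Fin.tail a) := rfl
  have e2 : (fun i : Fin (n + 1) => a i.succ.castSucc) = Fin.init (Fin.tail a) := rfl
  rw [e1, e2]
  set M : B := powWord Q.δ (Fin.init (Fin.tail a)) with hM
  have hMm : M ∈ S.ideal (n + 1) := hQ.powWord_mem _
  set M' : B := powWord Q.δ (Fin.tail (Fin.tail a)) with hM'
  set z := a (Fin.last (n + 2))
  have e3 : powWord Q.δ (Fin.tail a) = M * Q.δ z := powWord_succ' _ _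
  have e4 : powWord Q.δ a = Q.δ (a 0) * (M * Q.δ z) := by rw [← e3, powWord_succ]
  have e5 : Q.δ (a 1) * M' = M * Q.δ z := by rw [← e3]; exact (powWord_succ Q.δ (Fin.tail a)).symm
  have k1 : ∀ x y : B, S.τ (x * (y * M)) = S.τ (y * (M * x)) := fun x y => by
    rw [← mul_assoc y]
    exact S.trace_mul_comm (S.mem_ideal_zero _) (S.mul_mem_ideal_left _ hMm) (by omega)
  rw [e3, e4]
  simp only [LinearMap.add_apply, lin₁_mul, lin₂_mul, add_mul, mul_add, map_add, k1, one_smul,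
    mul_assoc]
  simp only [Q.lin₁_eq z, Q.lin₁_eq (a 1), mul_add, add_mul, map_add, e5]
  simp only [Q.lin₁_eq (a 0), mul_add, add_mul, map_add]
  simp
  ring

theorem IsQuasi.connesB_transgression (hQ : Q.IsQuasi S) {n : ℕ} (hn : Even n)
    (h : S.N ≤ n + 1) :
    connesB n (Q.transgression S (n + 1)) = (2 * ((n : ℂ) + 1)) • Q.character S n := by
  have key : connesB₀ n (Q.transgression S (n + 1) - cyclicT (n + 1) (Q.transgression S (n + 1))) =
      (2 : ℂ) • Q.character S n := by
    ext a
    rw [map_sub, _root_.sub_apply, connesB₀_apply, connesB₀_apply, cyclicT_apply,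
      transgression, headCochain_apply, headCochain_apply, rotate]
    simp only [Fin.cons_zero, Fin.tail_cons]
    have e1 : (fun i : Fin (n + 1) => (Fin.cons 1 a : Fin (n + 2) → A) i.castSucc) =
        Fin.cons 1 (Fin.init a) := by
      ext i
      refine Fin.cases rfl (fun i => rfl) i
    have e2 : (Fin.cons 1 a : Fin (n + 2) → A) (Fin.last (n + 1)) = a (Fin.last n) := rfl
    rw [e1, e2, powWord_cons, powWord_succ', pow_succ, hn.neg_one_pow, _root_.smul_apply,
      character_apply, powWord_succ']
    set M : B := powWord Q.δ (Fin.init a) with hM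
    have hMm : M ∈ S.ideal n := hQ.powWord_mem _
    set z := a (Fin.last n)
    have hd := hQ.δ_mem_ideal
    have k1 : S.τ ((Q.lin₁ + Q.lin₂) 1 * (M * Q.δ z)) = S.τ (M * (Q.δ z * (Q.lin₁ + Q.lin₂) 1)) := by
      rw [S.trace_mul_comm (S.mem_ideal_zero _) (S.mul_mem_ideal hMm (hd _)) (by omega), mul_assoc]
    have k2 : S.τ ((Q.lin₁ + Q.lin₂) z * (Q.δ 1 * M)) = S.τ (M * ((Q.lin₁ + Q.lin₂) z * Q.δ 1)) := by
      rw [← mul_assoc, S.trace_mul_comm (S.mul_mem_ideal_left _ (hd _)) hMm (by omega)]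
    have k3 : Q.δ z * (Q.lin₁ + Q.lin₂) 1 + (Q.lin₁ + Q.lin₂) z * Q.δ 1 = (2 : ℂ) • Q.δ z := by
      have h1 : Q.lin₁ z * Q.lin₁ 1 = Q.lin₁ z := by rw [← lin₁_mul, mul_one]
      have h2 : Q.lin₂ z * Q.lin₂ 1 = Q.lin₂ z := by rw [← lin₂_mul, mul_one]
      simp only [δ, LinearMap.add_apply, LinearMap.sub_apply, mul_add, add_mul, mul_sub, sub_mul,
        h1, h2, two_smul]
      abel
    rw [k1, k2, ← map_smul, ← mul_smul_comm, ← k3, mul_add, map_add]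
    ring
  have : connesB n (Q.transgression S (n + 1)) = cyclicSum n (connesB₀ n
      (Q.transgression S (n + 1) - cyclicT (n + 1) (Q.transgression S (n + 1)))) := rfl
  rw [this, key, map_smul, cyclicSum_of_cyclic (hQ.character_cyclic hn h), smul_smul]

theorem IsQuasi.transgression_mem (hQ : Q.IsQuasi S) {n : ℕ} (h : S.N ≤ n) :
    Q.transgression S n ∈ continuousCochains A n :=
  hQ.continuous_headCochain (k := 0) (Submodule.add_mem _ hQ.fst_mem hQ.snd_mem) (by omega)

end HomPair

/-! ### Homotopy invariance of the character -/

section Polynomials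

variable {A : Type u} [Ring A] [Algebra ℂ A] {B : Type w} [Ring B] [Algebra ℂ B]

/-- The derivative of the word `δ(a₁) ⋯ δ(aₙ)` in the direction `η`, that is
`∑ᵢ δ(a₁) ⋯ η(aᵢ) ⋯ δ(aₙ)`. -/
def derivWord (δ η : A →ₗ[ℂ] B) {n : ℕ} (a : Fin n → A) : B :=
  ∑ i : Fin n, wordMap (Function.update (fun _ => δ) i η) a

theorem derivWord_succ (δ η : A →ₗ[ℂ] B) {n : ℕ} (a : Fin (n + 1) → A) :
    derivWord δ η a = η (a 0) * powWord δ (Fin.tail a) + δ (a 0) * derivWord δ η (Fin.tail a) := by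
  have h0 : Fin.tail (Function.update (fun _ : Fin (n + 1) => δ) 0 η) = fun _ => δ :=
    Fin.tail_update_zero _ _
  have h1 : ∀ i : Fin n, Fin.tail (Function.update (fun _ : Fin (n + 1) => δ) i.succ η) =
      Function.update (fun _ => δ) i η := fun i => Fin.tail_update_succ _ _ _
  rw [derivWord, Fin.sum_univ_succ, derivWord, Finset.mul_sum]
  simp only [wordMap_succ, h0, h1]
  simp [Fin.ext_iff]

theorem derivWord_neg (δ η : A →ₗ[ℂ] B) {n : ℕ} (a : Fin n → A) :
    derivWord δ (-η) a = -derivWord δ η a := by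
  induction n with
  | zero => simp [derivWord]
  | succ n ih =>
    rw [derivWord_succ, derivWord_succ, ih]
    simp [add_comm]

/-- Words in letters that are polynomials of degree `2` in `t` are polynomials in `t`; here tested
against a linear form, and with their derivative. -/
theorem exists_polynomial_powWord (u v w : A →ₗ[ℂ] B) {n : ℕ} (a : Fin n → A) (l : B →ₗ[ℂ] ℂ) :
    ∃ P : Polynomial ℂ, P.natDegree ≤ 2 * n ∧ ∀ t : ℂ,
      P.eval t = l (powWord (u + t • v + t ^ 2 • w) a) ∧
      P.derivative.eval t = l (derivWord (u + t • v + t ^ 2 • w) (v + (2 * t) • w) a) := by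
  induction n generalizing l with
  | zero =>
    refine ⟨Polynomial.C (l 1), by simp, fun t => ⟨?_, ?_⟩⟩
    · simp [powWord, wordMap_zero]
    · simp [derivWord]
  | succ n ih =>
    obtain ⟨P, hP, hP'⟩ := ih (Fin.tail a) (l ∘ₗ LinearMap.mulLeft ℂ (u (a 0)))
    obtain ⟨Q, hQ, hQ'⟩ := ih (Fin.tail a) (l ∘ₗ LinearMap.mulLeft ℂ (v (a 0)))
    obtain ⟨R, hR, hR'⟩ := ih (Fin.tail a) (l ∘ₗ LinearMap.mulLeft ℂ (w (a 0)))
    refine ⟨P + Polynomial.X * Q + Polynomial.X ^ 2 * R, ?_, fun t => ⟨?_, ?_⟩⟩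
    · refine (Polynomial.natDegree_add_le _ _).trans (max_le ((Polynomial.natDegree_add_le _ _).trans
        (max_le (by omega) ?_)) ?_)
      · refine Polynomial.natDegree_mul_le.trans ?_
        rw [Polynomial.natDegree_X]
        omega
      · refine Polynomial.natDegree_mul_le.trans ?_
        rw [Polynomial.natDegree_X_pow]
        omega
    · rw [powWord_succ]
      simp [(hP' t).1, (hQ' t).1, (hR' t).1, add_mul]
    · rw [derivWord_succ]
      simp [(hQ' t).1, (hR' t).1, (hP' t).2, (hQ' t).2, (hR' t).2, add_mul]
      ring

/-- A quadrature formula on `[0, 1]` with nodes `0, …, d`, exact in degree at most `d`. -/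
theorem exists_quadrature (d : ℕ) : ∃ c : Fin (d + 1) → ℂ, ∀ P : Polynomial ℂ, P.natDegree ≤ d + 1 →
    P.eval 1 - P.eval 0 = ∑ i : Fin (d + 1), c i * P.derivative.eval ((i : ℕ) : ℂ) := by
  set V : Matrix (Fin (d + 1)) (Fin (d + 1)) ℂ := Matrix.vandermonde fun i => ((i : ℕ) : ℂ)
  have hV : IsUnit V.det := by
    rw [isUnit_iff_ne_zero, Matrix.det_vandermonde_ne_zero_iff]
    intro i j h
    exact Fin.ext (Nat.cast_injective h)
  set r : Fin (d + 1) → ℂ := fun m => 1 / ((m : ℕ) + 1 : ℂ)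
  refine ⟨Matrix.vecMul r V⁻¹, fun P hP => ?_⟩
  set c := Matrix.vecMul r V⁻¹
  have hc : Matrix.vecMul c V = r := by
    rw [Matrix.vecMul_vecMul, Matrix.nonsing_inv_mul _ hV, Matrix.vecMul_one]
  have hc' : ∀ m : Fin (d + 1), ∑ i, c i * ((i : ℕ) : ℂ) ^ (m : ℕ) = 1 / ((m : ℕ) + 1 : ℂ) :=
    fun m => congrFun hc m
  -- exactness for the derivatives of monomials; `0 ^ 0 = 1` makes the case `k = 0` correct
  have key : ∀ k ≤ d + 1, (1 : ℂ) ^ k - 0 ^ k =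
      ∑ i : Fin (d + 1), c i * (k * ((i : ℕ) : ℂ) ^ (k - 1)) := by
    intro k hk
    rcases k with _ | k
    · simp
    · have h := hc' ⟨k, by omega⟩
      have hk : (k : ℂ) + 1 ≠ 0 := by exact_mod_cast Nat.succ_ne_zero k
      simp only [mul_left_comm (c _), ← Finset.mul_sum, Nat.add_sub_cancel, h]
      simp [hk]
  have hPs := P.as_sum_range' (d + 2) (by omega)
  have e1 : ∀ x, P.eval x = ∑ k ∈ Finset.range (d + 2), P.coeff k * x ^ k := fun x => by
    conv_lhs => rw [hPs]
    simp [Polynomial.eval_finsetSum]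
  have e2 : ∀ x, P.derivative.eval x = ∑ k ∈ Finset.range (d + 2), P.coeff k * (k * x ^ (k - 1)) :=
    fun x => by
      conv_lhs => rw [hPs]
      simp [Polynomial.eval_finsetSum, Polynomial.derivative_monomial, mul_assoc]
  rw [e1, e1, ← Finset.sum_sub_distrib]
  simp only [e2, Finset.mul_sum]
  rw [Finset.sum_comm]
  refine Finset.sum_congr rfl fun k hk => ?_
  rw [← mul_sub, key k (by simpa [Nat.lt_succ_iff] using hk), Finset.mul_sum]
  exact Finset.sum_congr rfl fun i _ => by ring

end Polynomials

theorem cyclicT_mem_continuousCochains {A : Type u} [Ring A] [Algebra ℂ A] [TopologicalSpace A]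
    {m : ℕ} {φ : Cochain A m} (h : φ ∈ continuousCochains A m) :
    cyclicT m φ ∈ continuousCochains A m := by
  have h1 : Continuous fun a : Fin (m + 1) → A => φ a := h
  have h2 : Continuous fun a : Fin (m + 1) → A => rotate a :=
    continuous_pi (Fin.cases (continuous_apply _) fun i => continuous_apply i.castSucc)
  exact Submodule.smul_mem _ _ (h1.comp h2)

theorem cyclicSum_mem_continuousCochains {A : Type u} [Ring A] [Algebra ℂ A] [TopologicalSpace A]
    {m : ℕ} {φ : Cochain A m} (h : φ ∈ continuousCochains A m) :
    cyclicSum m φ ∈ continuousCochains A m := by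
  have key : ∀ j, (cyclicT m ^ j) φ ∈ continuousCochains A m := fun j => by
    induction j with
    | zero => simpa using h
    | succ j ih => rw [pow_succ']; exact cyclicT_mem_continuousCochains ih
  rw [cyclicSum, LinearMap.sum_apply]
  exact Submodule.sum_mem _ fun j _ => key j

/-- The cochains `φ` and `φ'` differ by the Hochschild coboundary of a continuous cyclic cochain. -/
def CyclicallyCohomologous {A : Type u} [Ring A] [Algebra ℂ A] [TopologicalSpace A] {m : ℕ}
    (φ φ' : Cochain A (m + 1)) : Prop :=
  ∃ θ ∈ continuousCochains A m, cyclicT m θ = θ ∧ φ' - φ = hochschild m θ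

theorem CyclicallyCohomologous.trans {A : Type u} [Ring A] [Algebra ℂ A] [TopologicalSpace A]
    {m : ℕ} {φ φ' φ'' : Cochain A (m + 1)} (h : CyclicallyCohomologous φ φ')
    (h' : CyclicallyCohomologous φ' φ'') : CyclicallyCohomologous φ φ'' := by
  obtain ⟨θ, h1, h2, h3⟩ := h
  obtain ⟨θ', h1', h2', h3'⟩ := h'
  refine ⟨θ + θ', Submodule.add_mem _ h1 h1', by rw [map_add, h2, h2'], ?_⟩
  rw [map_add, ← h3, ← h3']
  abel

namespace HomPair

variable {A : Type u} [Ring A] [Algebra ℂ A] {B : Type w} [Ring B] [Algebra ℂ B]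
  {Q : HomPair A B} {S : TraceSystem.{u} B}

/-- The pair `(π₁, g π₂ g⁻¹)`, where `g'` is the inverse of `g`. -/
def conj (Q : HomPair A B) (g g' : B) (h : g' * g = 1) : HomPair A B where
  π₁ := Q.π₁
  π₂ :=
    { toFun := fun a => g * Q.π₂ a * g'
      map_smul' := fun c a => by simp
      map_zero' := by simp
      map_add' := fun a b => by simp [mul_add, add_mul]
      map_mul' := fun a b => by
        rw [map_mul, mul_assoc (g * Q.π₂ a) g', ← mul_assoc g', ← mul_assoc g', h, one_mul]
        noncomm_ring }

theorem conj_lin₂ (g g' : B) (h : g' * g = 1) (a : A) :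
    (Q.conj g g' h).lin₂ a = g * Q.lin₂ a * g' := rfl

theorem conj_δ (g g' : B) (h : g' * g = 1) (a : A) :
    (Q.conj g g' h).δ a = Q.lin₁ a - g * Q.lin₂ a * g' := rfl

theorem conj_conj (g g' : B) (h : g' * g = 1) (k k' : B) (hk : k' * k = 1) (hkg) :
    (Q.conj g g' h).conj k k' hk = Q.conj (k * g) (g' * k') hkg := by
  unfold conj
  simp only [NonUnitalAlgHom.coe_mk, mk.injEq, true_and]
  ext a
  change k * (g * Q.π₂ a * g') * k' = k * g * Q.π₂ a * (g' * k')
  noncomm_ring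

variable [TopologicalSpace A]

theorem IsQuasi.conj (hQ : Q.IsQuasi S) {g g' : B} (h : g' * g = 1) (hg : g - 1 ∈ S.ideal 1)
    (hg' : g' - 1 ∈ S.ideal 1) : (Q.conj g g' h).IsQuasi S where
  fst_mem := hQ.fst_mem
  snd_mem := S.mul_mem A (S.mul_mem A (S.const_mem A g) hQ.snd_mem) (S.const_mem A g')
  δ_mem := by
    have h1 := S.mul_mem A (S.const_mem_fil A hg) hQ.snd_mem
    have h2 := S.mul_mem A (S.mul_mem A (S.const_mem A g) hQ.snd_mem) (S.const_mem_fil A hg')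
    have := Submodule.sub_mem _ (Submodule.sub_mem _ hQ.δ_mem h1) h2
    convert this using 1
    ext a
    rw [conj_δ]
    simp only [Pi.sub_apply, Pi.mul_apply, δ, LinearMap.sub_apply]
    noncomm_ring

/-- The cyclic sum of a word with one distinguished letter is the derivative word. -/
theorem IsQuasi.cyclicSum_headCochain (hQ : Q.IsQuasi S) {κ : A →ₗ[ℂ] B}
    (hκ : (fun a => κ a) ∈ S.fil A 1) {n : ℕ} (hn : Even n) (h : S.N ≤ n + 1)
    (a : Fin (n + 1) → A) :
    cyclicSum n (Q.headCochain S κ n) a = S.τ (derivWord Q.δ κ a) := by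
  have mem : ∀ (i : Fin n) (b : Fin n → A),
      wordMap (Function.update (fun _ => Q.δ) i κ) b ∈ S.ideal n := fun i b => by
    have := S.wordMap_mem_fil (Function.update (fun _ => Q.δ) i κ) (fun _ => 1) (fun j => by
      rcases eq_or_ne j i with rfl | hj
      · simpa using hκ
      · simpa [hj] using hQ.δ_mem)
    simpa using S.apply_mem_ideal this b
  set M : ℕ → Cochain A n := fun i => S.τ.compMultilinearMap
    (wordMap (Function.update (fun _ => Q.δ) (Fin.ofNat (n + 1) i) κ)) with hM
  have hof : ∀ i : Fin (n + 1), Fin.ofNat (n + 1) (i : ℕ) = i := fun i => by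
    ext; simp
  have hT0 : cyclicT n (M 0) = M n := by
    ext b
    have e : Fin.ofNat (n + 1) n = Fin.last n := hof (Fin.last n)
    have e0 : Fin.ofNat (n + 1) 0 = 0 := hof 0
    have i0 : Fin.tail (Function.update (fun _ : Fin (n + 1) => Q.δ) 0 κ) = fun _ => Q.δ :=
      Fin.tail_update_zero _ _
    have i1 : Fin.init (Function.update (fun _ : Fin (n + 1) => Q.δ) (Fin.last n) κ) =
      fun _ => Q.δ := Fin.init_update_last _ _
    rw [cyclicT_apply, hn.neg_one_pow, one_mul]
    simp only [hM, e, e0, LinearMap.compMultilinearMap_apply]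
    rw [wordMap_succ, wordMap_succ', i0, i1]
    simp only [Function.update_self]
    exact S.trace_mul_comm (S.apply_mem_ideal hκ _) (hQ.powWord_mem _) (by omega)
  have hT : ∀ i < n, cyclicT n (M (i + 1)) = M i := by
    intro i hi
    ext b
    have e : Fin.ofNat (n + 1) (i + 1) = (⟨i, hi⟩ : Fin n).succ := hof (⟨i, hi⟩ : Fin n).succ
    have e0 : Fin.ofNat (n + 1) i = (⟨i, hi⟩ : Fin n).castSucc := hof (⟨i, hi⟩ : Fin n).castSucc
    have i0 : Fin.tail (Function.update (fun _ : Fin (n + 1) => Q.δ) (⟨i, hi⟩ : Fin n).succ κ) =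
      Function.update (fun _ => Q.δ) ⟨i, hi⟩ κ := Fin.tail_update_succ _ _ _
    have i1 : Fin.init (Function.update (fun _ : Fin (n + 1) => Q.δ) (⟨i, hi⟩ : Fin n).castSucc κ) =
      Function.update (fun _ => Q.δ) ⟨i, hi⟩ κ := Fin.init_update_castSucc _ _ _
    rw [cyclicT_apply, hn.neg_one_pow, one_mul]
    simp only [hM, e, e0, LinearMap.compMultilinearMap_apply]
    rw [wordMap_succ, wordMap_succ', i0, i1, Function.update_of_ne (Fin.succ_ne_zero _).symm,
      Function.update_of_ne (Fin.castSucc_lt_last _).ne']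
    exact S.trace_mul_comm (hQ.δ_mem_ideal _) (mem _ _) (by omega)
  have hpow : ∀ j ≤ n, (cyclicT n ^ j) (M n) = M (n - j) := by
    intro j hj
    induction j with
    | zero => simp
    | succ j ih =>
      rw [pow_succ', Module.End.mul_apply, ih (by omega), show n - j = (n - (j + 1)) + 1 by omega,
        hT _ (by omega)]
  have h0 : Q.headCochain S κ n = M 0 := by
    have e0 : Fin.ofNat (n + 1) 0 = 0 := hof 0
    simp only [hM, e0, headCochain]
    congr 2
    ext i
    refine Fin.cases ?_ (fun i => ?_) i <;> simp [Fin.ext_iff]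
  have h1 : cyclicSum n (M 0) = ∑ j ∈ Finset.range (n + 1), M j := by
    rw [← LinearMap.congr_fun (cyclicSum_comp_cyclicT n) (M 0), LinearMap.comp_apply, hT0,
      cyclicSum, LinearMap.sum_apply, ← Finset.sum_range_reflect]
    refine Finset.sum_congr rfl fun j hj => ?_
    have := Finset.mem_range.1 hj
    rw [hpow _ (by omega)]
    congr 1
    omega
  rw [h0, h1, Finset.sum_range, derivWord, map_sum, _root_.sum_apply]
  refine Finset.sum_congr rfl fun i _ => ?_
  simp only [hM, hof, LinearMap.compMultilinearMap_apply]

/-- The commutator `a ↦ [y, π₂(a)]`. -/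
def bracket (Q : HomPair A B) (y : B) : A →ₗ[ℂ] B :=
  (LinearMap.mulLeft ℂ y - LinearMap.mulRight ℂ y) ∘ₗ Q.lin₂

/-- The primitive of the infinitesimal variation of the character under conjugation of `π₂` in the
direction `y`. -/
def contraction (Q : HomPair A B) (S : TraceSystem.{u} B) (y : B) (m : ℕ) : Cochain A m :=
  cyclicSum m (Q.headCochain S (LinearMap.mulLeft ℂ y ∘ₗ Q.δ) m)

theorem IsQuasi.contraction_mem (hQ : Q.IsQuasi S) {y : B} (hy : y ∈ S.ideal 1) {m : ℕ}
    (h : S.N ≤ m + 2) : Q.contraction S y m ∈ continuousCochains A m :=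
  cyclicSum_mem_continuousCochains
    (hQ.continuous_headCochain (S.mul_mem A (S.const_mem_fil A hy) hQ.δ_mem) (by omega))

/-- The noncyclic faces of the word `yδ(a⁰) ⋯ δ(aᵐ)` telescope to `yπ₂(a⁰)δ(a¹) ⋯` and a cyclic
permutation of `π₂(a⁰)yδ(a¹) ⋯`, whose difference is the commutator with `y` up to the cyclic sum;
the relation `b N = N b'` does the rest. -/
theorem IsQuasi.hochschild_contraction (hQ : Q.IsQuasi S) {y : B} (hy : y ∈ S.ideal 1) {m : ℕ}
    (hm : Odd m) (h : S.N ≤ m + 2) (a : Fin (m + 2) → A) :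
    hochschild m (Q.contraction S y m) a = S.τ (derivWord Q.δ (Q.bracket y) a) := by
  have hn : Even (m + 1) := hm.add_one
  have hκ : (fun a => Q.bracket y a) ∈ S.fil A 1 :=
    Submodule.sub_mem _ (S.mul_mem A (S.const_mem_fil A hy) hQ.snd_mem)
      (S.mul_mem A (k := 0) hQ.snd_mem (S.const_mem_fil A hy))
  rw [← hQ.cyclicSum_headCochain hκ hn (by omega)]
  have h1 := LinearMap.congr_fun (hochschild_comp_cyclicSum (A := A) m)
    (Q.headCochain S (LinearMap.mulLeft ℂ y ∘ₗ Q.δ) m)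
  rw [LinearMap.comp_apply, LinearMap.comp_apply] at h1
  rw [contraction, h1]
  have h2 : (∑ l ∈ Finset.range (m + 1), signedFace m l)
      (Q.headCochain S (LinearMap.mulLeft ℂ y ∘ₗ Q.δ) m) =
      Q.headCochain S (LinearMap.mulLeft ℂ y ∘ₗ Q.lin₂) (m + 1) -
        cyclicT (m + 1) (Q.headCochain S (LinearMap.mulRight ℂ y ∘ₗ Q.lin₂) (m + 1)) := by
    ext b
    have e1 : ∀ l : Fin (m + 1), signedFace m l
        (Q.headCochain S (LinearMap.mulLeft ℂ y ∘ₗ Q.δ) m) b =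
        S.τ (y * ((-1 : ℂ) ^ (l : ℕ) • powWord Q.δ (face l b))) := by
      intro l
      rw [signedFace_of_lt l.2, mul_smul_comm, map_smul, powWord_succ, ← mul_assoc]
      have := headCochain_apply Q S (LinearMap.mulLeft ℂ y ∘ₗ Q.δ) (face l b)
      exact congrArg (fun z => (-1 : ℂ) ^ (l : ℕ) * z) this
    rw [LinearMap.sum_apply, Finset.sum_range, _root_.sum_apply, Finset.sum_congr rfl fun l _ => e1 l,
      ← map_sum, ← Finset.mul_sum, sum_face_powWord Q.lin₁ Q.lin₂ Q.δ Q.lin₁_eq Q.δ_mul,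
      if_neg (Nat.not_even_iff_odd.2 hm), hm.neg_one_pow, _root_.sub_apply, cyclicT_apply,
      hn.neg_one_pow, headCochain_apply, headCochain_apply, rotate, Fin.cons_zero, Fin.tail_cons]
    have e2 : powWord Q.δ (fun i : Fin (m + 1) => b i.castSucc) = powWord Q.δ (Fin.init b) := rfl
    rw [e2]
    have e3 := S.trace_mul_comm (S.mem_ideal_zero (Q.lin₂ (b (Fin.last (m + 1)))))
      (S.mul_mem_ideal hy (hQ.powWord_mem (Fin.init b))) (by omega)
    simp only [LinearMap.comp_apply, LinearMap.mulLeft_apply, LinearMap.mulRight_apply, mul_assoc,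
      e3]
    simp [mul_add, sub_eq_add_neg]
  rw [h2, map_sub, ← LinearMap.comp_apply (cyclicSum (m + 1)) (cyclicT (m + 1)),
    cyclicSum_comp_cyclicT, ← map_sub]
  congr 2
  ext b
  simp only [_root_.sub_apply, headCochain_apply, bracket, LinearMap.comp_apply,
    LinearMap.sub_apply, sub_mul, map_sub]

/-- Conjugating `π₂` by `1 + y`, with `y² = 0`, does not change the cyclic cohomology class of the
character: along the path `1 + ty` the derivative of the character is a coboundary. -/
theorem IsQuasi.character_conj_of_sq_zero (hQ : Q.IsQuasi S) {y : B} (hy : y ∈ S.ideal 1)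
    (hyy : y * y = 0) {m : ℕ} (hm : Odd m) (h : S.N ≤ m + 2) (h1) :
    CyclicallyCohomologous (Q.character S (m + 1))
      ((Q.conj (1 + y) (1 - y) h1).character S (m + 1)) := by
  have hinv : ∀ t : ℂ, (1 - t • y) * (1 + t • y) = 1 := fun t => by
    simp [mul_add, sub_mul, hyy]
  set P : ℂ → HomPair A B := fun t => Q.conj (1 + t • y) (1 - t • y) (hinv t) with hP
  have hPq : ∀ t, (P t).IsQuasi S := fun t => hQ.conj _
    (by simpa using Submodule.smul_mem _ t hy)
    (by simpa using Submodule.neg_mem _ (Submodule.smul_mem _ t hy))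
  have hP1 : P 1 = Q.conj (1 + y) (1 - y) h1 := by simp [hP]
  have hP0 : (P 0).character S (m + 1) = Q.character S (m + 1) := by
    ext a
    have : (P 0).δ = Q.δ := by
      ext a
      rw [hP, conj_δ]
      simp [δ]
    rw [character_apply, character_apply, this]
  set v : A →ₗ[ℂ] B := -Q.bracket y with hv
  set w : A →ₗ[ℂ] B := LinearMap.mulLeft ℂ y ∘ₗ LinearMap.mulRight ℂ y ∘ₗ Q.lin₂ with hw
  have hδ : ∀ t, Q.δ + t • v + t ^ 2 • w = (P t).δ := fun t => by
    ext a
    rw [hP, conj_δ]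
    simp only [hv, hw, bracket, δ, LinearMap.add_apply, LinearMap.sub_apply,
      LinearMap.smul_apply, LinearMap.neg_apply, LinearMap.comp_apply, LinearMap.mulLeft_apply,
      LinearMap.mulRight_apply, add_mul, mul_sub, smul_mul_assoc, mul_smul_comm,
      smul_sub, smul_neg, pow_two, one_mul, mul_one, mul_assoc]
    module
  have hδ' : ∀ t : ℂ, v + (2 * t) • w = -(P t).bracket y := fun t => by
    have e : ∀ x : B, y * (y * x) = 0 := fun x => by rw [← mul_assoc, hyy, zero_mul]
    ext a
    simp only [hP, conj_lin₂, hv, hw, bracket, LinearMap.add_apply, LinearMap.sub_apply,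
      LinearMap.smul_apply, LinearMap.neg_apply, LinearMap.comp_apply, LinearMap.mulLeft_apply,
      LinearMap.mulRight_apply, mul_add, add_mul, mul_sub, sub_mul, smul_mul_assoc, mul_smul_comm,
      one_mul, mul_one, mul_assoc, e, hyy, mul_zero, smul_zero, two_mul, add_smul]
    module
  obtain ⟨c, hc⟩ := exists_quadrature (2 * (m + 2))
  refine ⟨-∑ i : Fin (2 * (m + 2) + 1), c i • (P ((i : ℕ) : ℂ)).contraction S y m,
    Submodule.neg_mem _ (Submodule.sum_mem _ fun i _ => Submodule.smul_mem _ _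
      ((hPq _).contraction_mem hy h)), ?_, ?_⟩
  · have : ∀ t, cyclicT m ((P t).contraction S y m) = (P t).contraction S y m := fun t =>
      LinearMap.congr_fun (cyclicT_comp_cyclicSum m) _
    simp only [map_neg, map_sum, map_smul, this]
  · rw [← hP1, ← hP0]
    ext a
    obtain ⟨R, hR, hR'⟩ := exists_polynomial_powWord Q.δ v w a S.τ
    simp only [hδ, hδ'] at hR'
    have e1 : ∀ t, (P t).character S (m + 1) a = R.eval t := fun t => by
      rw [(hR' t).1, character_apply]
    have e2 : ∀ t, hochschild m ((P t).contraction S y m) a = -R.derivative.eval t := fun t => by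
      rw [(hPq t).hochschild_contraction hy hm h, (hR' t).2, derivWord_neg, map_neg, neg_neg]
    rw [_root_.sub_apply, e1, e1, hc R (by omega)]
    simp [e2]

end HomPair

/-! ### Conjugation by an arbitrary invertible perturbation of the identity -/

section MatrixTrick

variable {B : Type w} [Ring B] [Algebra ℂ B]

/-- The `2 × 2` matrices over a filtered algebra with trace, filtered entrywise. -/
def TraceSystem.matrix (S : TraceSystem.{u} B) : TraceSystem.{u} (Matrix (Fin 2) (Fin 2) B) where
  fil X _ k :=
    { carrier := {F | ∀ i j, (fun ξ => F ξ i j) ∈ S.fil X k}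
      zero_mem' := fun _ _ => Submodule.zero_mem _
      add_mem' := fun hF hG i j => Submodule.add_mem _ (hF i j) (hG i j)
      smul_mem' := fun c _ hF i j => Submodule.smul_mem _ c (hF i j) }
  const_mem X _ b i j := S.const_mem X (b i j)
  antitone X _ k _ hF i j := S.antitone X k (hF i j)
  mul_mem X _ k l F G hF hG i j := by
    have : (fun ξ => (F * G) ξ i j) =
        ∑ r : Fin 2, (fun ξ => F ξ i r) * (fun ξ => G ξ r j) := by
      ext ξ
      simp [Matrix.mul_apply]
    rw [this]
    exact Submodule.sum_mem _ fun r _ => S.mul_mem X (hF i r) (hG r j)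
  comp_mem hF hg i j := S.comp_mem (hF i j) hg
  τ := S.τ ∘ₗ Matrix.traceLinearMap (Fin 2) ℂ B
  N := S.N
  trace_comm X _ k l F G hF hG h ξ := by
    have e : ∀ i j, S.τ (F ξ i j * G ξ j i) = S.τ (G ξ j i * F ξ i j) := fun i j =>
      S.trace_comm X (hF i j) (hG j i) h ξ
    simp only [LinearMap.comp_apply, Matrix.traceLinearMap_apply, Matrix.trace, Matrix.diag_apply,
      Matrix.mul_apply, map_sum, e]
    exact Finset.sum_comm
  continuous_trace X _ F hF := by
    have : (fun ξ => (S.τ ∘ₗ Matrix.traceLinearMap (Fin 2) ℂ B) (F ξ)) =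
        fun ξ => S.τ (F ξ 0 0) + S.τ (F ξ 1 1) := by
      ext ξ
      simp [Matrix.trace]
    rw [this]
    exact (S.continuous_trace X (hF 0 0)).add (S.continuous_trace X (hF 1 1))

theorem TraceSystem.mem_matrix_ideal {S : TraceSystem.{u} B} {k : ℕ}
    {M : Matrix (Fin 2) (Fin 2) B} : M ∈ S.matrix.ideal k ↔ ∀ i j, M i j ∈ S.ideal k := Iff.rfl

theorem TraceSystem.matrix_τ (S : TraceSystem.{u} B) (a b c d : B) :
    S.matrix.τ !![a, b; c, d] = S.τ a + S.τ d := by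
  simp [TraceSystem.matrix, Matrix.trace]

variable {A : Type u} [Ring A] [Algebra ℂ A]

/-- The pair `(diag(π₁, 0), diag(π₂, 0))`. -/
def HomPair.corner (Q : HomPair A B) : HomPair A (Matrix (Fin 2) (Fin 2) B) where
  π₁ :=
    { toFun := fun a => !![Q.π₁ a, 0; 0, 0]
      map_smul' := fun c a => by ext i j; fin_cases i <;> fin_cases j <;> simp
      map_zero' := by ext i j; fin_cases i <;> fin_cases j <;> simp
      map_add' := fun a b => by ext i j; fin_cases i <;> fin_cases j <;> simp
      map_mul' := fun a b => by simp }
  π₂ :=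
    { toFun := fun a => !![Q.π₂ a, 0; 0, 0]
      map_smul' := fun c a => by ext i j; fin_cases i <;> fin_cases j <;> simp
      map_zero' := by ext i j; fin_cases i <;> fin_cases j <;> simp
      map_add' := fun a b => by ext i j; fin_cases i <;> fin_cases j <;> simp
      map_mul' := fun a b => by simp }

namespace HomPair

variable {Q : HomPair A B} {S : TraceSystem.{u} B}

theorem corner_lin₁ (a : A) : Q.corner.lin₁ a = !![Q.lin₁ a, 0; 0, 0] := rfl
theorem corner_lin₂ (a : A) : Q.corner.lin₂ a = !![Q.lin₂ a, 0; 0, 0] := rfl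

theorem corner_δ (a : A) : Q.corner.δ a = !![Q.δ a, 0; 0, 0] := by
  ext i j
  fin_cases i <;> fin_cases j <;> simp [δ, corner_lin₁, corner_lin₂]

/-- The nonzero entry of a word is in the corner, so the matrix trace does not see the rest. -/
theorem corner_character (n : ℕ) : Q.corner.character S.matrix n = Q.character S n := by
  ext a
  have : ∀ (n : ℕ) (a : Fin (n + 1) → A),
      powWord Q.corner.δ a = !![powWord Q.δ a, 0; 0, 0] := by
    intro n
    induction n with
    | zero =>
      intro a
      rw [powWord_succ, powWord_succ, corner_δ]
      simp [powWord, wordMap_zero]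
    | succ n ih =>
      intro a
      rw [powWord_succ Q.corner.δ, powWord_succ Q.δ, ih, corner_δ, Matrix.mul_fin_two]
      simp
  rw [character_apply, character_apply, this, S.matrix_τ, map_zero, add_zero]

variable [TopologicalSpace A]

theorem IsQuasi.corner (hQ : Q.IsQuasi S) : Q.corner.IsQuasi S.matrix where
  fst_mem i j := by
    simp only [corner_lin₁]
    fin_cases i <;> fin_cases j <;>
      first | exact hQ.fst_mem | exact Submodule.zero_mem (S.fil A 0)
  snd_mem i j := by
    simp only [corner_lin₂]
    fin_cases i <;> fin_cases j <;>
      first | exact hQ.snd_mem | exact Submodule.zero_mem (S.fil A 0)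
  δ_mem i j := by
    simp only [corner_δ]
    fin_cases i <;> fin_cases j <;>
      first | exact hQ.δ_mem | exact Submodule.zero_mem (S.fil A 1)

/-- Conjugating `π₂` by an invertible element `u` with `u - 1` of filtration degree `1` does not
change the class of the character. In `2 × 2` matrices, `diag(u, u⁻¹)` is a product of three factors
`1 + y` with `y² = 0` and `y` of filtration degree `1`. -/
theorem IsQuasi.character_conj (hQ : Q.IsQuasi S) {g g' : B} (h : g' * g = 1) (h' : g * g' = 1)
    (hg : g - 1 ∈ S.ideal 1) {m : ℕ} (hm : Odd m) (hN : S.N ≤ m + 2) :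
    CyclicallyCohomologous (Q.character S (m + 1)) ((Q.conj g g' h).character S (m + 1)) := by
  set x := g - 1 with hx
  set w := 1 - g' with hw
  have hwi : w ∈ S.ideal 1 := by
    have := S.mul_mem_ideal_left g' hg
    rwa [hx, mul_sub, h, mul_one] at this
  -- with `w = 1 - g⁻¹` one has `gw = wg = x`, whence `diag(g, g⁻¹) = (1 + y₁)(1 + y₂)(1 + y₃)`
  set y₁ : Matrix (Fin 2) (Fin 2) B := !![0, 0; w, 0]
  set y₂ : Matrix (Fin 2) (Fin 2) B := !![x, x; -x, -x]
  set y₃ : Matrix (Fin 2) (Fin 2) B := !![0, -w; 0, 0]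
  have z0 : (0 : B) ∈ S.ideal 1 := Submodule.zero_mem _
  have m₁ : y₁ ∈ S.matrix.ideal 1 := TraceSystem.mem_matrix_ideal.2 fun i j => by
    fin_cases i <;> fin_cases j <;> simp [y₁, hwi]
  have m₂ : y₂ ∈ S.matrix.ideal 1 := TraceSystem.mem_matrix_ideal.2 fun i j => by
    fin_cases i <;> fin_cases j <;> simp [y₂, hg]
  have m₃ : y₃ ∈ S.matrix.ideal 1 := TraceSystem.mem_matrix_ideal.2 fun i j => by
    fin_cases i <;> fin_cases j <;> simp [y₃, hwi]
  have s₁ : y₁ * y₁ = 0 := by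
    ext i j; fin_cases i <;> fin_cases j <;> simp [y₁]
  have s₂ : y₂ * y₂ = 0 := by
    ext i j; fin_cases i <;> fin_cases j <;> simp [y₂]
  have s₃ : y₃ * y₃ = 0 := by
    ext i j; fin_cases i <;> fin_cases j <;> simp [y₃]
  have inv : ∀ y : Matrix (Fin 2) (Fin 2) B, y * y = 0 → (1 - y) * (1 + y) = 1 := fun y hy => by
    simp [mul_add, sub_mul, hy]
  have quasi : ∀ (R : HomPair A (Matrix (Fin 2) (Fin 2) B)) (y : Matrix (Fin 2) (Fin 2) B)
      (hy : y * y = 0), R.IsQuasi S.matrix → y ∈ S.matrix.ideal 1 →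
      (R.conj (1 + y) (1 - y) (inv y hy)).IsQuasi S.matrix := fun R y hy hR hm =>
    hR.conj _ (by simpa using hm) (by simpa using Submodule.neg_mem _ hm)
  have hone : (1 : Matrix (Fin 2) (Fin 2) B) = !![1, 0; 0, 1] := Matrix.one_fin_two
  have gw : g * w = x := by rw [hw, hx, mul_sub, mul_one, h']
  have wg : w * g = x := by rw [hw, hx, sub_mul, one_mul, h]
  have xw : x * w = x - w := by rw [hx, sub_mul, gw, one_mul]
  have wx : w * x = x - w := by
    have : w * x = w * g - w := by rw [hx, mul_sub, mul_one]
    rw [this, wg]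
  have g₁ : (1 : B) + x = g := by rw [hx]; abel
  have g₂ : (1 : B) - w = g' := by rw [hw]; abel
  have p₁ : 1 + y₁ = !![1, 0; w, 1] := by
    rw [hone]; ext i j; fin_cases i <;> fin_cases j <;> simp [y₁]
  have p₂ : 1 + y₂ = !![g, x; -x, 1 - x] := by
    rw [hone]; ext i j; fin_cases i <;> fin_cases j <;> simp [y₂, g₁, sub_eq_add_neg]
  have p₃ : 1 + y₃ = !![1, -w; 0, 1] := by
    rw [hone]; ext i j; fin_cases i <;> fin_cases j <;> simp [y₃]
  have n₁ : 1 - y₁ = !![1, 0; -w, 1] := by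
    rw [hone]; ext i j; fin_cases i <;> fin_cases j <;> simp [y₁]
  have n₂ : 1 - y₂ = !![1 - x, -x; x, g] := by
    rw [hone]; ext i j; fin_cases i <;> fin_cases j <;> simp [y₂, g₁]
  have n₃ : 1 - y₃ = !![1, w; 0, 1] := by
    rw [hone]; ext i j; fin_cases i <;> fin_cases j <;> simp [y₃]
  have hG : (1 + y₁) * ((1 + y₂) * (1 + y₃)) = !![g, 0; 0, g'] := by
    have : (1 + y₂) * (1 + y₃) = !![g, 0; -x, g'] := by
      rw [p₂, p₃, Matrix.mul_fin_two]
      simp [gw, xw, ← g₂]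
    rw [this, p₁, Matrix.mul_fin_two]
    simp [wg]
  have hG' : ((1 - y₃) * (1 - y₂)) * (1 - y₁) = !![g', 0; 0, g] := by
    have : (1 - y₃) * (1 - y₂) = !![g', 0; x, g] := by
      rw [n₂, n₃, Matrix.mul_fin_two]
      simp [wg, wx, ← g₂]
    rw [this, n₁, Matrix.mul_fin_two]
    simp [gw]
  have hQ₀ := hQ.corner
  have hQ₁ := quasi _ y₃ s₃ hQ₀ m₃
  have hQ₂ := quasi _ y₂ s₂ hQ₁ m₂
  have c₁ := hQ₀.character_conj_of_sq_zero m₃ s₃ hm hN (inv y₃ s₃)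
  have c₂ := hQ₁.character_conj_of_sq_zero m₂ s₂ hm hN (inv y₂ s₂)
  have c₃ := hQ₂.character_conj_of_sq_zero m₁ s₁ hm hN (inv y₁ s₁)
  have key := (c₁.trans c₂).trans c₃
  have d : (!![g', 0; 0, g] : Matrix (Fin 2) (Fin 2) B) * !![g, 0; 0, g'] = 1 := by
    rw [Matrix.mul_fin_two, hone]
    simp [h, h']
  have i₂ : (1 - y₃) * (1 - y₂) * ((1 + y₂) * (1 + y₃)) = 1 := by
    rw [mul_assoc, ← mul_assoc (1 - y₂), inv y₂ s₂, one_mul, inv y₃ s₃]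
  have i₃ : (1 - y₃) * (1 - y₂) * (1 - y₁) * ((1 + y₁) * ((1 + y₂) * (1 + y₃))) = 1 := by
    rw [hG, hG', d]
  rw [conj_conj (hkg := i₂), conj_conj (hkg := i₃)] at key
  have e : Q.corner.conj ((1 + y₁) * ((1 + y₂) * (1 + y₃))) ((1 - y₃) * (1 - y₂) * (1 - y₁)) i₃ =
      (Q.conj g g' h).corner := by
    have : Q.corner.conj !![g, 0; 0, g'] !![g', 0; 0, g] d = (Q.conj g g' h).corner := by
      unfold HomPair.conj HomPair.corner
      simp only [NonUnitalAlgHom.coe_mk, mk.injEq, true_and]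
      ext a : 1
      change !![g, 0; 0, g'] * !![Q.π₂ a, 0; 0, 0] * !![g', 0; 0, g] = !![g * Q.π₂ a * g', 0; 0, 0]
      rw [Matrix.mul_fin_two, Matrix.mul_fin_two]
      simp
    rw [← this]
    congr 1
  rwa [e, corner_character, corner_character] at key

end HomPair

end MatrixTrick

/-! ### The class of the character in periodic cyclic cohomology -/

section Classes

variable {A : Type u} [Ring A] [Algebra ℂ A]

theorem periodicDifferential_single {n : ℕ} (φ : Cochain A (n + 1)) :
    periodicDifferential (Pi.single (n + 1) φ) =
      Pi.single (n + 2) (hochschild (n + 1) φ) + Pi.single n (connesB n φ) := by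
  funext m
  rcases m with _ | m
  · change connesB 0 ((Pi.single (n + 1) φ : ∀ m, Cochain A m) 1) = _
    rcases eq_or_ne n 0 with rfl | hn
    · simp
    · rw [Pi.add_apply, Pi.single_eq_of_ne (by omega), Pi.single_eq_of_ne (by omega),
        Pi.single_eq_of_ne (by omega), map_zero, add_zero]
  · change hochschild m ((Pi.single (n + 1) φ : ∀ m, Cochain A m) m) +
      connesB (m + 1) ((Pi.single (n + 1) φ : ∀ m, Cochain A m) (m + 2)) = _
    rw [Pi.add_apply]
    congr 1
    · rcases eq_or_ne m (n + 1) with rfl | hm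
      · rw [Pi.single_eq_same, Pi.single_eq_same]
      · rw [Pi.single_eq_of_ne hm, Pi.single_eq_of_ne (by omega), map_zero]
    · rcases eq_or_ne n (m + 1) with rfl | hm
      · rw [Pi.single_eq_same, Pi.single_eq_same]
      · rw [Pi.single_eq_of_ne (by omega), Pi.single_eq_of_ne hm.symm, map_zero]

theorem periodicDifferential_single_cocycle {n : ℕ} {φ : Cochain A n} (h : cyclicT n φ = φ)
    (h' : hochschild n φ = 0) : periodicDifferential (Pi.single n φ) = 0 := by
  rcases n with _ | n
  · funext m
    rcases m with _ | m
    · simp [periodicDifferential]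
    · change hochschild m ((Pi.single 0 φ : ∀ m, Cochain A m) m) +
        connesB (m + 1) ((Pi.single 0 φ : ∀ m, Cochain A m) (m + 2)) = 0
      rcases m with _ | m
      · rw [Pi.single_eq_same, h']
        simp
      · simp
  · rw [periodicDifferential_single, h', connesB_of_cyclic h]
    simp

variable {V : ∀ m, Submodule ℂ (Cochain A m)}

theorem single_mem_periodicCochains {n : ℕ} {φ : Cochain A n} (hV : φ ∈ V n) {i : ZMod 2}
    (hi : (n : ZMod 2) = i) : Pi.single n φ ∈ periodicCochains V i := by
  refine ⟨⟨n + 1, fun m hm => Pi.single_eq_of_ne (by omega) _⟩, fun m => ?_⟩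
  rcases eq_or_ne m n with rfl | h
  · rw [Pi.single_eq_same]
    exact ⟨hV, fun h => absurd hi h⟩
  · rw [Pi.single_eq_of_ne h]
    exact ⟨Submodule.zero_mem _, fun _ => rfl⟩

theorem exists_class {n : ℕ} {φ : Cochain A n} (hV : φ ∈ V n) {i : ZMod 2}
    (hi : (n : ZMod 2) = i) (h : cyclicT n φ = φ) (h' : hochschild n φ = 0) :
    ∃ c : HP V i, IsCyclicCocycleOfClass V i n φ c :=
  ⟨_, φ, fun _ => rfl, hV, h, h', ⟨Pi.single n φ, single_mem_periodicCochains hV hi,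
    periodicDifferential_single_cocycle h h'⟩, rfl, rfl⟩

/-- Two cyclic cocycles whose difference is a periodic coboundary have the same class. -/
theorem IsCyclicCocycleOfClass.congr {n n' : ℕ} {φ : Cochain A n} {φ' : Cochain A n'} {i : ZMod 2}
    {c : HP V i} (hc : IsCyclicCocycleOfClass V i n φ c) (hi : (n' : ZMod 2) = i)
    (hV : φ' ∈ V n') (h : cyclicT n' φ' = φ') (h' : hochschild n' φ' = 0)
    (hd : ∃ ψ ∈ periodicCochains V (i + 1),
      periodicDifferential ψ = Pi.single n' φ' - Pi.single n φ) :
    IsCyclicCocycleOfClass V i n' φ' c := by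
  obtain ⟨φ₁, h1, -, -, -, z, hz, rfl⟩ := hc
  obtain rfl : φ₁ = φ := MultilinearMap.ext h1
  refine ⟨φ', fun _ => rfl, hV, h, h', ⟨Pi.single n' φ', single_mem_periodicCochains hV hi,
    periodicDifferential_single_cocycle h h'⟩, rfl, ?_⟩
  rw [Submodule.Quotient.eq, Submodule.submoduleOf, Submodule.mem_comap]
  obtain ⟨ψ, hψ, hψ'⟩ := hd
  exact ⟨ψ, hψ, by rw [hψ', ← hz]; rfl⟩

theorem IsCyclicCocycleOfClass.unique {n : ℕ} {f : (Fin (n + 1) → A) → ℂ} {i : ZMod 2}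
    {c c' : HP V i} (h : IsCyclicCocycleOfClass V i n f c)
    (h' : IsCyclicCocycleOfClass V i n f c') : c = c' := by
  obtain ⟨φ, h1, -, -, -, z, hz, rfl⟩ := h
  obtain ⟨φ', h1', -, -, -, z', hz', rfl⟩ := h'
  obtain rfl : φ = φ' := MultilinearMap.ext fun a => (h1 a).trans (h1' a).symm
  rw [Subtype.ext (hz.trans hz'.symm)]

end Classes

namespace HomPair

variable {A : Type u} [Ring A] [Algebra ℂ A] [TopologicalSpace A] {B : Type w} [Ring B]
  [Algebra ℂ B] {Q : HomPair A B} {S : TraceSystem.{u} B}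

/-- The class `c` is the common class of the normalized characters of the pair `Q`. -/
def HasClass (Q : HomPair A B) (S : TraceSystem.{u} B) (c : HP (continuousCochains A) 0) : Prop :=
  ∀ q : ℕ, S.N ≤ 2 * q + 1 → IsCyclicCocycleOfClass (continuousCochains A) 0 (2 * q)
    (tauConst q • Q.character S (2 * q) : Cochain A (2 * q)) c

theorem two_mul_cast_zmod (q : ℕ) : ((2 * q : ℕ) : ZMod 2) = 0 := by
  rw [Nat.cast_mul]
  have : ((2 : ℕ) : ZMod 2) = 0 := by decide
  rw [this, zero_mul]

theorem tauConst_succ (q : ℕ) :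
    tauConst (q + 1) * (2 * (((2 * q : ℕ) : ℂ) + 1)) = -tauConst q := by
  have h1 : ((2 * q).factorial : ℂ) ≠ 0 := by exact_mod_cast (2 * q).factorial_ne_zero
  have h2 : (q : ℂ) + 1 ≠ 0 := by exact_mod_cast q.succ_ne_zero
  have h3 : 2 * (q : ℂ) + 1 ≠ 0 := by exact_mod_cast (2 * q).succ_ne_zero
  have h4 : 2 * (q : ℂ) + 1 + 1 ≠ 0 := by exact_mod_cast (2 * q + 1).succ_ne_zero
  rw [tauConst, tauConst, show 2 * (q + 1) = 2 * q + 1 + 1 by ring, Nat.factorial_succ,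
    Nat.factorial_succ, Nat.factorial_succ]
  push_cast
  field_simp
  ring

/-- The normalizing constants turn periodicity into `(b + B)(c_{q+1} ψ) = τ_{2q+2} - τ_{2q}`, so that
one class serves for all `q`. -/
theorem IsQuasi.exists_hasClass (hQ : Q.IsQuasi S) : ∃ c, Q.HasClass S c := by
  have hcyc : ∀ q : ℕ, S.N ≤ 2 * q + 1 → (tauConst q • Q.character S (2 * q) ∈
      continuousCochains A (2 * q)) ∧ cyclicT (2 * q) (tauConst q • Q.character S (2 * q)) =
      tauConst q • Q.character S (2 * q) ∧
      hochschild (2 * q) (tauConst q • Q.character S (2 * q)) = 0 := fun q hq =>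
    ⟨Submodule.smul_mem _ _ (hQ.character_mem hq), by
      rw [map_smul, hQ.character_cyclic (even_two_mul q) hq], by
      rw [map_smul, hQ.hochschild_character (even_two_mul q) hq, smul_zero]⟩
  have h0 : S.N ≤ 2 * (S.N / 2) + 1 := by omega
  obtain ⟨c, hc⟩ := exists_class (V := continuousCochains A) (i := 0) (hcyc _ h0).1
    (two_mul_cast_zmod _) (hcyc _ h0).2.1 (hcyc _ h0).2.2
  refine ⟨c, fun q hq => ?_⟩
  have hle : S.N / 2 ≤ q := by omega
  induction q, hle using Nat.le_induction with
  | base => exact hc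
  | succ q hle ih =>
    have hq' : S.N ≤ 2 * q + 1 := by omega
    refine (ih hq').congr (two_mul_cast_zmod _) (hcyc _ hq).1 (hcyc _ hq).2.1 (hcyc _ hq).2.2 ?_
    refine ⟨Pi.single (2 * q + 1) (tauConst (q + 1) • Q.transgression S (2 * q + 1)),
      single_mem_periodicCochains (Submodule.smul_mem _ _ (hQ.transgression_mem (by omega))) ?_, ?_⟩
    · push_cast
      have := two_mul_cast_zmod q
      push_cast at this
      rw [this]
    · rw [periodicDifferential_single, map_smul, map_smul,
        hQ.hochschild_transgression (even_two_mul q) hq',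
        hQ.connesB_transgression (even_two_mul q) hq', smul_smul, tauConst_succ, neg_smul,
        Pi.single_neg, sub_eq_add_neg]
      rfl

/-- A cyclic coboundary relation in a single degree suffices, by periodicity; `B` vanishes on
cyclic cochains, so `bθ` is also a coboundary for `b + B`. -/
theorem IsQuasi.hasClass_of_cohomologous {B' : Type*} [Ring B'] [Algebra ℂ B']
    {Q' : HomPair A B'} {S' : TraceSystem.{u} B'} {c : HP (continuousCochains A) 0}
    (hc : Q.HasClass S c) (hQ' : Q'.IsQuasi S')
    (h : ∃ q : ℕ, S.N ≤ 2 * q + 3 ∧ S'.N ≤ 2 * q + 3 ∧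
      CyclicallyCohomologous (Q.character S (2 * q + 2)) (Q'.character S' (2 * q + 2))) :
    Q'.HasClass S' c := by
  obtain ⟨q, hq, hq', θ, hθ, hθc, hθb⟩ := h
  obtain ⟨c', hc'⟩ := hQ'.exists_hasClass
  have h1 := hc (q + 1) (by omega)
  have h2 := hc' (q + 1) (by omega)
  have h3 := hQ'.character_mem (n := 2 * (q + 1)) (by omega)
  have h4 := hQ'.character_cyclic (even_two_mul (q + 1)) (by omega)
  have h5 := hQ'.hochschild_character (even_two_mul (q + 1)) (by omega)
  have h6 : IsCyclicCocycleOfClass (continuousCochains A) 0 (2 * (q + 1))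
      (tauConst (q + 1) • Q'.character S' (2 * (q + 1)) : Cochain A (2 * (q + 1))) c := by
    refine h1.congr (two_mul_cast_zmod _) (Submodule.smul_mem _ _ h3) (by rw [map_smul, h4])
      (by rw [map_smul, h5, smul_zero]) ?_
    refine ⟨Pi.single (2 * q + 1) (tauConst (q + 1) • θ),
      single_mem_periodicCochains (Submodule.smul_mem _ _ hθ) ?_, ?_⟩
    · push_cast
      have := two_mul_cast_zmod q
      push_cast at this
      rw [this]
    · rw [periodicDifferential_single, map_smul, map_smul, connesB_of_cyclic hθc, smul_zero,
        Pi.single_zero, add_zero, ← hθb, smul_sub, Pi.single_sub]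
      rfl
  rwa [h6.unique h2]

theorem IsQuasi.hasClass_conj (hQ : Q.IsQuasi S) {c : HP (continuousCochains A) 0}
    (hc : Q.HasClass S c) {g g' : B} (h : g' * g = 1) (h' : g * g' = 1)
    (hg : g - 1 ∈ S.ideal 1) : (Q.conj g g' h).HasClass S c := by
  have hg' : g' - 1 ∈ S.ideal 1 := by
    have := Submodule.neg_mem _ (S.mul_mem_ideal_left g' hg)
    rwa [mul_sub, h, mul_one, neg_sub] at this
  exact (hQ.conj h hg hg').hasClass_of_cohomologous hc
    ⟨S.N, by omega, by omega, hQ.character_conj h h' hg (m := 2 * S.N + 1) (by simp) (by omega)⟩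

end HomPair

/-! ### Approximation numbers -/

section ApproximationNumbers

variable {E F G : Type*} [NormedAddCommGroup E] [NormedSpace ℂ E] [NormedAddCommGroup F]
  [NormedSpace ℂ F] [NormedAddCommGroup G] [NormedSpace ℂ G]

/-- The operator `T` has rank at most `j`. -/
def RankLE (T : E →L[ℂ] F) (j : ℕ) : Prop := LinearMap.rank (T : E →ₗ[ℂ] F) ≤ j

theorem rankLE_zero (j : ℕ) : RankLE (0 : E →L[ℂ] F) j := by
  simp [RankLE, LinearMap.rank_zero]

theorem RankLE.mono {T : E →L[ℂ] F} {i j : ℕ} (h : RankLE T i) (hij : i ≤ j) : RankLE T j :=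
  le_trans h (by exact_mod_cast hij)

theorem RankLE.add {S T : E →L[ℂ] F} {i j : ℕ} (hS : RankLE S i) (hT : RankLE T j) :
    RankLE (S + T) (i + j) := by
  refine (LinearMap.rank_add_le (S : E →ₗ[ℂ] F) (T : E →ₗ[ℂ] F)).trans ?_
  push_cast
  exact add_le_add hS hT

theorem RankLE.neg {S : E →L[ℂ] F} {i : ℕ} (hS : RankLE S i) : RankLE (-S) i := by
  have : LinearMap.range ((-S : E →L[ℂ] F) : E →ₗ[ℂ] F) = LinearMap.range (S : E →ₗ[ℂ] F) := by
    rw [ContinuousLinearMap.toLinearMap_neg, LinearMap.range_neg]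
  unfold RankLE LinearMap.rank at *
  rwa [this]

theorem RankLE.sub {S T : E →L[ℂ] F} {i j : ℕ} (hS : RankLE S i) (hT : RankLE T j) :
    RankLE (S - T) (i + j) := by
  rw [sub_eq_add_neg]
  exact hS.add hT.neg

theorem RankLE.comp_left {T : E →L[ℂ] F} {j : ℕ} (h : RankLE T j) (S : F →L[ℂ] G) :
    RankLE (S ∘L T) j := by
  have := LinearMap.lift_rank_comp_le_right (T : E →ₗ[ℂ] F) (S : F →ₗ[ℂ] G)
  unfold RankLE at *
  have h2 := this.trans (Cardinal.lift_le.2 h)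
  rwa [Cardinal.lift_natCast, Cardinal.lift_le_nat_iff] at h2

theorem RankLE.comp_right {S : F →L[ℂ] G} {j : ℕ} (h : RankLE S j) (T : E →L[ℂ] F) :
    RankLE (S ∘L T) j :=
  (LinearMap.rank_comp_le_left (T : E →ₗ[ℂ] F) (S : F →ₗ[ℂ] G)).trans h

/-- The `j`-th approximation number of `T`: its distance to the operators of rank at most `j`. -/
def approxNumber (T : E →L[ℂ] F) (j : ℕ) : ℝ := ⨅ R : {R : E →L[ℂ] F // RankLE R j}, ‖T - R.1‖

instance (j : ℕ) : Nonempty {R : E →L[ℂ] F // RankLE R j} := ⟨⟨0, rankLE_zero j⟩⟩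

theorem approxNumber_le {T R : E →L[ℂ] F} {j : ℕ} (h : RankLE R j) : approxNumber T j ≤ ‖T - R‖ :=
  ciInf_le (f := fun R : {R : E →L[ℂ] F // RankLE R j} => ‖T - R.1‖)
    ⟨0, by rintro _ ⟨R, rfl⟩; exact norm_nonneg _⟩ ⟨R, h⟩

theorem approxNumber_nonneg (T : E →L[ℂ] F) (j : ℕ) : 0 ≤ approxNumber T j :=
  le_ciInf fun _ => norm_nonneg _

theorem exists_rankLE_lt {T : E →L[ℂ] F} {j : ℕ} {c : ℝ} (h : approxNumber T j < c) :
    ∃ R : E →L[ℂ] F, RankLE R j ∧ ‖T - R‖ < c := by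
  obtain ⟨⟨R, hR⟩, h⟩ := exists_lt_of_ciInf_lt h
  exact ⟨R, hR, h⟩

theorem approxNumber_le_of_forall {T : E →L[ℂ] F} {j : ℕ} {c : ℝ}
    (h : ∀ ε > 0, ∃ R : E →L[ℂ] F, RankLE R j ∧ ‖T - R‖ ≤ c + ε) : approxNumber T j ≤ c :=
  le_of_forall_pos_le_add fun ε hε => by
    obtain ⟨R, hR, h⟩ := h ε hε
    exact (approxNumber_le hR).trans h

theorem approxNumber_zero_right (T : E →L[ℂ] F) : approxNumber T 0 = ‖T‖ := by
  refine le_antisymm (by simpa using approxNumber_le (T := T) (rankLE_zero 0)) (le_ciInf ?_)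
  rintro ⟨R, hR⟩
  have h0 : LinearMap.rank (R : E →ₗ[ℂ] F) = 0 := by
    have : LinearMap.rank (R : E →ₗ[ℂ] F) ≤ 0 := by simpa [RankLE] using hR
    exact le_antisymm this (by simp)
  have : R = 0 := by
    unfold LinearMap.rank at h0
    rw [rank_zero_iff_forall_zero] at h0
    ext x
    have := h0 ⟨R x, x, rfl⟩
    simpa using congrArg Subtype.val this
  simp [this]

theorem approxNumber_antitone (T : E →L[ℂ] F) : Antitone (approxNumber T) := fun _ _ h =>
  le_ciInf fun R => approxNumber_le (R.2.mono h)

theorem approxNumber_le_norm (T : E →L[ℂ] F) (j : ℕ) : approxNumber T j ≤ ‖T‖ :=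
  (approxNumber_antitone T (Nat.zero_le j)).trans (approxNumber_zero_right T).le

theorem approxNumber_of_rankLE {T : E →L[ℂ] F} {j : ℕ} (h : RankLE T j) : approxNumber T j = 0 :=
  le_antisymm (by simpa using approxNumber_le (T := T) h) (approxNumber_nonneg _ _)

theorem approxNumber_add_le (S T : E →L[ℂ] F) (i j : ℕ) :
    approxNumber (S + T) (i + j) ≤ approxNumber S i + approxNumber T j := by
  refine approxNumber_le_of_forall fun ε hε => ?_
  obtain ⟨R, hR, h⟩ := exists_rankLE_lt (T := S) (lt_add_of_pos_right (approxNumber S i) (half_pos hε))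
  obtain ⟨R', hR', h'⟩ :=
    exists_rankLE_lt (T := T) (lt_add_of_pos_right (approxNumber T j) (half_pos hε))
  refine ⟨R + R', hR.add hR', ?_⟩
  have : S + T - (R + R') = (S - R) + (T - R') := by abel
  rw [this]
  refine (norm_add_le _ _).trans ?_
  linarith

theorem approxNumber_comp_le (S : F →L[ℂ] G) (T : E →L[ℂ] F) (i j : ℕ) :
    approxNumber (S ∘L T) (i + j) ≤ approxNumber S i * approxNumber T j := by
  have key : ∀ ε > 0, approxNumber (S ∘L T) (i + j) ≤
      (approxNumber S i + ε) * (approxNumber T j + ε) := by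
    intro ε hε
    obtain ⟨R, hR, h⟩ := exists_rankLE_lt (T := S) (lt_add_of_pos_right (approxNumber S i) hε)
    obtain ⟨R', hR', h'⟩ := exists_rankLE_lt (T := T) (lt_add_of_pos_right (approxNumber T j) hε)
    have e : S ∘L T - (R ∘L (T - R') + S ∘L R') = (S - R) ∘L (T - R') := by
      ext x
      simp
      abel
    have hr : RankLE (R ∘L (T - R') + S ∘L R') (i + j) :=
      (hR.comp_right (T - R')).add (hR'.comp_left S)
    refine (approxNumber_le hr).trans ?_
    rw [e]
    exact (ContinuousLinearMap.opNorm_comp_le _ _).trans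
      (mul_le_mul h.le h'.le (norm_nonneg _) ((norm_nonneg _).trans h.le))
  have hlim : Filter.Tendsto (fun ε : ℝ => (approxNumber S i + ε) * (approxNumber T j + ε))
      (nhdsWithin 0 (Set.Ioi 0)) (nhds ((approxNumber S i + 0) * (approxNumber T j + 0))) :=
    Filter.Tendsto.mono_left (Continuous.tendsto (by fun_prop) 0) nhdsWithin_le_nhds
  rw [add_zero, add_zero] at hlim
  exact ge_of_tendsto hlim (Filter.eventually_of_mem self_mem_nhdsWithin fun ε hε => key ε hε)

theorem approxNumber_comp_le_left (S : F →L[ℂ] G) (T : E →L[ℂ] F) (j : ℕ) :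
    approxNumber (S ∘L T) j ≤ ‖S‖ * approxNumber T j := by
  have := approxNumber_comp_le S T 0 j
  rwa [zero_add, approxNumber_zero_right] at this

theorem approxNumber_comp_le_right (S : F →L[ℂ] G) (T : E →L[ℂ] F) (j : ℕ) :
    approxNumber (S ∘L T) j ≤ approxNumber S j * ‖T‖ := by
  have := approxNumber_comp_le S T j 0
  rwa [add_zero, approxNumber_zero_right] at this

theorem approxNumber_half_add_le (S T : E →L[ℂ] F) (j : ℕ) :
    approxNumber (S + T) j ≤ approxNumber S (j / 2) + approxNumber T (j / 2) :=
  (approxNumber_antitone _ (by omega)).trans (approxNumber_add_le S T (j / 2) (j / 2))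

theorem approxNumber_half_comp_le (S : F →L[ℂ] G) (T : E →L[ℂ] F) (j : ℕ) :
    approxNumber (S ∘L T) j ≤ approxNumber S (j / 2) * approxNumber T (j / 2) :=
  (approxNumber_antitone _ (by omega)).trans (approxNumber_comp_le S T (j / 2) (j / 2))

theorem approxNumber_smul_le (c : ℂ) (T : E →L[ℂ] F) (j : ℕ) :
    approxNumber (c • T) j ≤ ‖c‖ * approxNumber T j := by
  have := approxNumber_comp_le_left (c • ContinuousLinearMap.id ℂ F) T j
  refine le_trans (le_of_eq ?_) (this.trans (mul_le_mul_of_nonneg_right ?_ (approxNumber_nonneg _ _)))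
  · congr 1
  · refine ContinuousLinearMap.opNorm_le_bound _ (norm_nonneg _) fun x => ?_
    simp [norm_smul]

theorem approxNumber_neg (T : E →L[ℂ] F) (j : ℕ) : approxNumber (-T) j = approxNumber T j := by
  have key : ∀ T : E →L[ℂ] F, approxNumber (-T) j ≤ approxNumber T j := fun T => by
    simpa using approxNumber_smul_le (-1) T j
  exact le_antisymm (key T) (by simpa using key (-T))

end ApproximationNumbers

/-! ### Schatten classes -/

section Schatten

theorem summable_comp_div {a : ℕ → ℝ} (ha : ∀ j, 0 ≤ a j) (hs : Summable a) (k : ℕ) [NeZero k] :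
    Summable fun j => a (j / k) := by
  rw [← (Nat.divModEquiv k).symm.summable_iff]
  have : ((fun j => a (j / k)) ∘ (Nat.divModEquiv k).symm) = fun p : ℕ × Fin k => a p.1 := by
    ext ⟨q, r⟩
    simp only [Function.comp_apply, Nat.divModEquiv_symm_apply]
    congr 1
    rw [Nat.mul_comm, Nat.mul_add_div (Nat.pos_of_ne_zero (NeZero.ne k)), Nat.div_eq_of_lt r.2,
      add_zero]
  rw [this, summable_prod_of_nonneg fun p => ha p.1]
  refine ⟨fun q => Summable.of_finite, ?_⟩
  simpa using hs.mul_left (k : ℝ)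

variable {E F G : Type*} [NormedAddCommGroup E] [NormedSpace ℂ E] [NormedAddCommGroup F]
  [NormedSpace ℂ F] [NormedAddCommGroup G] [NormedSpace ℂ G]

/-- The Schatten class of exponent `p`: the approximation numbers are `p`-summable. -/
def IsSchatten (p : ℝ) (T : E →L[ℂ] F) : Prop := Summable fun j => approxNumber T j ^ p

theorem add_rpow_le {p x y : ℝ} (hp : 0 < p) (hx : 0 ≤ x) (hy : 0 ≤ y) :
    (x + y) ^ p ≤ 2 ^ p * (x ^ p + y ^ p) := by
  have h1 : x + y ≤ 2 * max x y := by
    have := le_max_left x y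
    have := le_max_right x y
    linarith
  have h2 : (max x y) ^ p ≤ x ^ p + y ^ p := by
    rcases max_cases x y with ⟨h, -⟩ | ⟨h, -⟩ <;> rw [h]
    · exact le_add_of_nonneg_right (Real.rpow_nonneg hy p)
    · exact le_add_of_nonneg_left (Real.rpow_nonneg hx p)
  calc (x + y) ^ p ≤ (2 * max x y) ^ p := Real.rpow_le_rpow (by positivity) h1 hp.le
    _ = 2 ^ p * (max x y) ^ p := Real.mul_rpow (by norm_num) (le_max_of_le_left hx)
    _ ≤ _ := mul_le_mul_of_nonneg_left h2 (by positivity)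

theorem IsSchatten.of_le {p c : ℝ} (hp : 0 < p) (hc : 0 ≤ c) {S : E →L[ℂ] F}
    {E' F' : Type*} [NormedAddCommGroup E'] [NormedSpace ℂ E'] [NormedAddCommGroup F']
    [NormedSpace ℂ F'] {T : E' →L[ℂ] F'} (hT : IsSchatten p T)
    (h : ∀ j, approxNumber S j ≤ c * approxNumber T j) : IsSchatten p S := by
  refine Summable.of_nonneg_of_le (fun j => Real.rpow_nonneg (approxNumber_nonneg _ _) _)
    (fun j => ?_) (hT.mul_left (c ^ p))
  rw [← Real.mul_rpow hc (approxNumber_nonneg _ _)]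
  exact Real.rpow_le_rpow (approxNumber_nonneg _ _) (h j) hp.le

theorem IsSchatten.add {p : ℝ} (hp : 0 < p) {S T : E →L[ℂ] F} (hS : IsSchatten p S)
    (hT : IsSchatten p T) : IsSchatten p (S + T) := by
  have h1 := summable_comp_div (fun j => Real.rpow_nonneg (approxNumber_nonneg _ _) _) hS 2
  have h2 := summable_comp_div (fun j => Real.rpow_nonneg (approxNumber_nonneg _ _) _) hT 2
  refine Summable.of_nonneg_of_le (fun j => Real.rpow_nonneg (approxNumber_nonneg _ _) _)
    (fun j => ?_) ((h1.add h2).mul_left (2 ^ p))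
  exact (Real.rpow_le_rpow (approxNumber_nonneg _ _) (approxNumber_half_add_le S T j) hp.le).trans
    (add_rpow_le hp (approxNumber_nonneg _ _) (approxNumber_nonneg _ _))

theorem IsSchatten.comp_left {p : ℝ} (hp : 0 < p) {T : E →L[ℂ] F} (hT : IsSchatten p T)
    (S : F →L[ℂ] G) : IsSchatten p (S ∘L T) :=
  hT.of_le hp (norm_nonneg S) (approxNumber_comp_le_left S T)

theorem IsSchatten.comp_right {p : ℝ} (hp : 0 < p) {S : F →L[ℂ] G} (hS : IsSchatten p S)
    (T : E →L[ℂ] F) : IsSchatten p (S ∘L T) :=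
  hS.of_le hp (norm_nonneg T) fun j => (approxNumber_comp_le_right S T j).trans_eq (mul_comm _ _)

theorem IsSchatten.smul {p : ℝ} (hp : 0 < p) {T : E →L[ℂ] F} (hT : IsSchatten p T) (c : ℂ) :
    IsSchatten p (c • T) :=
  hT.of_le hp (norm_nonneg c) (approxNumber_smul_le c T)

theorem IsSchatten.neg {p : ℝ} {T : E →L[ℂ] F} (hT : IsSchatten p T) : IsSchatten p (-T) := by
  simpa only [IsSchatten, approxNumber_neg] using hT

theorem IsSchatten.sub {p : ℝ} (hp : 0 < p) {S T : E →L[ℂ] F} (hS : IsSchatten p S)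
    (hT : IsSchatten p T) : IsSchatten p (S - T) := by
  rw [sub_eq_add_neg]
  exact hS.add hp hT.neg

theorem IsSchatten.of_rankLE {p : ℝ} (hp : 0 < p) {T : E →L[ℂ] F} {k : ℕ} (h : RankLE T k) :
    IsSchatten p T := by
  refine summable_of_ne_finset_zero (s := Finset.range k) fun j hj => ?_
  have hj : k ≤ j := by simpa using hj
  rw [approxNumber_of_rankLE (h.mono hj), Real.zero_rpow hp.ne']

theorem IsSchatten.tendsto_zero {p : ℝ} (hp : 0 < p) {T : E →L[ℂ] F} (hT : IsSchatten p T) :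
    Filter.Tendsto (approxNumber T) Filter.atTop (nhds 0) := by
  have := hT.tendsto_atTop_zero.rpow_const (p := p⁻¹) (Or.inr (by positivity))
  rw [Real.zero_rpow (by positivity)] at this
  refine this.congr fun j => ?_
  rw [← Real.rpow_mul (approxNumber_nonneg _ _), mul_inv_cancel₀ hp.ne', Real.rpow_one]

theorem IsSchatten.summable_pow {p : ℝ} (hp : 0 < p) {T : E →L[ℂ] F} (hT : IsSchatten p T) {n : ℕ}
    (hn : p ≤ n) : Summable fun j => approxNumber T j ^ n := by
  have h1 : ∀ᶠ j in Filter.atTop, approxNumber T j < 1 :=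
    (hT.tendsto_zero hp).eventually_lt_const one_pos
  refine summable_of_isBigO_nat hT (Filter.Eventually.isBigO ?_)
  filter_upwards [h1] with j hj
  have h0 := approxNumber_nonneg T j
  rw [Real.norm_of_nonneg (pow_nonneg h0 n), ← Real.rpow_natCast]
  rcases h0.eq_or_lt with h0 | h0
  · rw [← h0, Real.zero_rpow hp.ne', Real.zero_rpow (by linarith)]
  · exact Real.rpow_le_rpow_of_exponent_ge h0 hj.le hn

end Schatten

/-! ### Nuclear operators and the trace -/

section Nuclear

variable {E F G : Type*} [NormedAddCommGroup E] [InnerProductSpace ℂ E] [CompleteSpace E]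
  [NormedAddCommGroup F] [InnerProductSpace ℂ F] [CompleteSpace F]
  [NormedAddCommGroup G] [InnerProductSpace ℂ G] [CompleteSpace G]

/-- `T = ∑ₖ ⟪yₖ, ·⟫ xₖ` pointwise, with `∑ₖ ‖xₖ‖‖yₖ‖ < ∞`. -/
structure IsNuclearExpansion {ι : Type} (x : ι → F) (y : ι → E) (T : E →L[ℂ] F) : Prop where
  summable : Summable fun k => ‖x k‖ * ‖y k‖
  hasSum : ∀ v, HasSum (fun k => inner ℂ (y k) v • x k) (T v)

theorem IsNuclearExpansion.comp_left {ι : Type} {x : ι → F} {y : ι → E} {T : E →L[ℂ] F}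
    (h : IsNuclearExpansion x y T) (S : F →L[ℂ] G) :
    IsNuclearExpansion (fun k => S (x k)) y (S ∘L T) where
  summable := by
    refine Summable.of_nonneg_of_le (fun k => by positivity) (fun k => ?_) (h.summable.mul_left ‖S‖)
    rw [← mul_assoc]
    exact mul_le_mul_of_nonneg_right (S.le_opNorm _) (norm_nonneg _)
  hasSum v := by
    simpa only [map_smul, ContinuousLinearMap.comp_apply] using (h.hasSum v).mapL S

theorem IsNuclearExpansion.comp_right {ι : Type} {x : ι → F} {y : ι → E} {T : E →L[ℂ] F}
    (h : IsNuclearExpansion x y T) (S : G →L[ℂ] E) :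
    IsNuclearExpansion x (fun k => ContinuousLinearMap.adjoint S (y k)) (T ∘L S) where
  summable := by
    refine Summable.of_nonneg_of_le (fun k => by positivity) (fun k => ?_)
      (h.summable.mul_left ‖ContinuousLinearMap.adjoint S‖)
    rw [mul_left_comm]
    exact mul_le_mul_of_nonneg_left (ContinuousLinearMap.le_opNorm _ _) (norm_nonneg _)
  hasSum v := by
    simpa only [ContinuousLinearMap.adjoint_inner_left, ContinuousLinearMap.comp_apply] using
      h.hasSum (S v)

theorem summable_inner_mul_inner {κ : Type*} (b : HilbertBasis κ ℂ E) (x y : E) :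
    (Summable fun i => ‖inner ℂ y (b i) * inner ℂ (b i) x‖) ∧
      ∑' i, ‖inner ℂ y (b i) * inner ℂ (b i) x‖ ≤ ‖x‖ * ‖y‖ := by
  have hx := b.orthonormal.tsum_inner_products_le x
  have hy := b.orthonormal.tsum_inner_products_le y
  have sx := b.orthonormal.inner_products_summable x
  have sy := b.orthonormal.inner_products_summable y
  have h := Real.summable_and_inner_le_Lp_mul_Lq_tsum_of_nonneg (f := fun i => ‖inner ℂ (b i) x‖)
    (g := fun i => ‖inner ℂ (b i) y‖) (p := 2) (q := 2) (by constructor <;> norm_num)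
    (fun _ => norm_nonneg _) (fun _ => norm_nonneg _) (by simpa using sx) (by simpa using sy)
  have e : ∀ i, ‖inner ℂ y (b i) * inner ℂ (b i) x‖ = ‖inner ℂ (b i) x‖ * ‖inner ℂ (b i) y‖ :=
    fun i => by rw [norm_mul, norm_inner_symm, mul_comm]
  simp only [e]
  refine ⟨h.1, h.2.trans ?_⟩
  simp only [Real.rpow_two, ← Real.sqrt_eq_rpow]
  gcongr
  · exact Real.sqrt_le_iff.2 ⟨norm_nonneg _, hx⟩
  · exact Real.sqrt_le_iff.2 ⟨norm_nonneg _, hy⟩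

/-- The trace of a nuclear operator in any Hilbert basis is `∑ₖ ⟪yₖ, xₖ⟫`, by Fubini. -/
theorem IsNuclearExpansion.hasSum_diagonal {ι : Type} {x y : ι → E} {T : E →L[ℂ] E}
    (h : IsNuclearExpansion x y T) {κ : Type*} (b : HilbertBasis κ ℂ E) :
    HasSum (fun i => inner ℂ (b i) (T (b i))) (∑' k, inner ℂ (y k) (x k)) := by
  have hs : Summable fun p : ι × κ => inner ℂ (y p.1) (b p.2) * inner ℂ (b p.2) (x p.1) := by
    refine Summable.of_norm ?_
    rw [summable_prod_of_nonneg fun p => norm_nonneg _]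
    refine ⟨fun k => (summable_inner_mul_inner b (x k) (y k)).1, ?_⟩
    exact Summable.of_nonneg_of_le (fun k => tsum_nonneg fun i => norm_nonneg _)
      (fun k => (summable_inner_mul_inner b (x k) (y k)).2) h.summable
  have h1 : HasSum (fun p : κ × ι => inner ℂ (y p.2) (b p.1) * inner ℂ (b p.1) (x p.2))
      (∑' k, inner ℂ (y k) (x k)) := by
    have h2 := hs.hasSum
    rw [hs.tsum_prod] at h2
    simp only [(b.hasSum_inner_mul_inner _ _).tsum_eq] at h2
    exact (Equiv.prodComm κ ι).hasSum_iff.2 h2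
  refine h1.prod_fiberwise fun i => ?_
  have := (h.hasSum (b i)).mapL (innerSL ℂ (b i))
  simpa only [innerSL_apply_apply, inner_smul_right] using this

theorem IsNuclearExpansion.hasSum_trace {ι : Type} {x y : ι → E} {T : E →L[ℂ] E}
    (h : IsNuclearExpansion x y T) :
    HasSum (fun i => inner ℂ (basis E i) (T (basis E i))) (trace T) :=
  (h.hasSum_diagonal (basis E)).summable.hasSum

theorem IsNuclearExpansion.trace_eq {ι : Type} {x y : ι → E} {T : E →L[ℂ] E}
    (h : IsNuclearExpansion x y T) : trace T = ∑' k, inner ℂ (y k) (x k) :=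
  (h.hasSum_diagonal (basis E)).tsum_eq

theorem IsNuclearExpansion.norm_trace_le {ι : Type} {x y : ι → E} {T : E →L[ℂ] E}
    (h : IsNuclearExpansion x y T) : ‖trace T‖ ≤ ∑' k, ‖x k‖ * ‖y k‖ := by
  rw [h.trace_eq]
  have hle : ∀ k, ‖inner ℂ (y k) (x k)‖ ≤ ‖x k‖ * ‖y k‖ := fun k =>
    (norm_inner_le_norm _ _).trans_eq (mul_comm _ _)
  have hs : Summable fun k => ‖inner ℂ (y k) (x k)‖ :=
    Summable.of_nonneg_of_le (fun k => norm_nonneg _) hle h.summable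
  exact (norm_tsum_le_tsum_norm hs).trans (hs.tsum_le_tsum hle h.summable)

theorem IsNuclearExpansion.trace_comm {ι : Type} {x : ι → F} {y : ι → E} {T : E →L[ℂ] F}
    (h : IsNuclearExpansion x y T) (S : F →L[ℂ] E) : trace (S ∘L T) = trace (T ∘L S) := by
  rw [(h.comp_left S).trace_eq, (h.comp_right S).trace_eq]
  simp only [ContinuousLinearMap.adjoint_inner_left]

/-- An expansion in an orthonormal basis of the range. -/
theorem RankLE.exists_expansion {T : E →L[ℂ] F} {r : ℕ} (h : RankLE T r) :
    ∃ (n : ℕ) (x : Fin n → F) (y : Fin n → E), (∀ v, T v = ∑ k, inner ℂ (y k) v • x k) ∧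
      ∑ k, ‖x k‖ * ‖y k‖ ≤ r * ‖T‖ := by
  set V := LinearMap.range (T : E →ₗ[ℂ] F) with hV
  have hfin : FiniteDimensional ℂ V := by
    have : Module.rank ℂ V < Cardinal.aleph0 := lt_of_le_of_lt h Cardinal.natCast_lt_aleph0
    exact Module.rank_lt_aleph0_iff.1 this
  have hr : Module.finrank ℂ V ≤ r := Module.finrank_le_of_rank_le h
  set b := stdOrthonormalBasis ℂ V
  refine ⟨Module.finrank ℂ V, fun k => (b k : F),
    fun k => ContinuousLinearMap.adjoint T (b k : F), fun v => ?_, ?_⟩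
  · have h1 := b.sum_repr ⟨T v, v, rfl⟩
    have h2 := congrArg Subtype.val h1
    simp only [OrthonormalBasis.repr_apply_apply] at h2
    simp only [ContinuousLinearMap.adjoint_inner_left]
    refine h2.symm.trans ?_
    simp only [Submodule.coe_sum, Submodule.coe_smul, Submodule.coe_inner]
  · have h1 : ∀ k, ‖(b k : F)‖ = 1 := fun k => b.orthonormal.1 k
    have h2 : ∀ k, ‖(b k : F)‖ * ‖ContinuousLinearMap.adjoint T (b k : F)‖ ≤ ‖T‖ := fun k => by
      have := (ContinuousLinearMap.adjoint T).le_opNorm (b k : F)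
      rw [h1, mul_one, LinearIsometryEquiv.norm_map] at this
      rw [h1, one_mul]
      exact this
    refine (Finset.sum_le_sum fun k _ => h2 k).trans ?_
    simp only [Finset.sum_const, Finset.card_univ, Fintype.card_fin, nsmul_eq_mul]
    exact mul_le_mul_of_nonneg_right (by exact_mod_cast hr) (norm_nonneg _)

/-- The bound in Cauchy's condensation test. -/
theorem sum_two_pow_mul_le {s : ℕ → ℝ} (h0 : ∀ j, 0 ≤ s j) (ha : Antitone s) (hs : Summable s) :
    (Summable fun n => 2 ^ n * s (2 ^ n)) ∧ ∑' n, 2 ^ n * s (2 ^ n) ≤ 3 * ∑' j, s j := by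
  have key : ∀ n, ∑ k ∈ Finset.range n, 2 ^ k * s (2 ^ k) ≤ 3 * ∑' j, s j := fun n => by
    rcases n with - | n
    · simpa using tsum_nonneg h0
    have h1 := Finset.sum_condensed_le (f := s) (fun _ _ _ h => ha h) n
    simp only [nsmul_eq_mul, Nat.cast_pow, Nat.cast_ofNat] at h1
    refine h1.trans ?_
    have h2 : s 1 ≤ ∑' j, s j := hs.le_tsum 1 fun j _ => h0 j
    have h3 := hs.sum_le_tsum (Finset.Ico 2 (2 ^ n + 1)) fun j _ => h0 j
    linarith
  have hsum : Summable fun n => 2 ^ n * s (2 ^ n) :=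
    summable_of_sum_range_le (fun n => mul_nonneg (by positivity) (h0 _)) key
  exact ⟨hsum, hsum.tsum_le_of_sum_range_le key⟩

/-- An operator whose approximation numbers are dominated by a decreasing summable sequence is
nuclear: it is the sum of the differences of best approximations of ranks `2ⁿ`. -/
theorem exists_nuclearExpansion {T : E →L[ℂ] F} {s : ℕ → ℝ} (ha : Antitone s) (hs : Summable s)
    (h : ∀ j, approxNumber T j < s j) :
    ∃ (ι : Type) (x : ι → F) (y : ι → E), IsNuclearExpansion x y T ∧
      ∑' k, ‖x k‖ * ‖y k‖ ≤ 26 * ∑' j, s j := by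
  have h0 : ∀ j, 0 ≤ s j := fun j => (approxNumber_nonneg T j).trans (h j).le
  choose R hR hRn using fun n : ℕ => exists_rankLE_lt (h (2 ^ n))
  -- the telescoping differences have rank at most `3 · 2ⁿ` and norm at most `2 s(2ⁿ)`
  let A : ℕ → E →L[ℂ] F := fun n => Nat.casesOn n (R 0) fun n => R (n + 1) - R n
  let c : ℕ → ℝ := fun n => Nat.casesOn n (2 * s 0) fun n => 8 * (2 ^ n * s (2 ^ n))
  have hsum : ∀ n, ∑ i ∈ Finset.range (n + 1), A i = R n := fun n => by
    induction n with
    | zero => simp [A]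
    | succ n ih => rw [Finset.sum_range_succ, ih]; simp [A]
  have hexp : ∀ n, ∃ (m : ℕ) (x : Fin m → F) (y : Fin m → E),
      (∀ v, A n v = ∑ k, inner ℂ (y k) v • x k) ∧ ∑ k, ‖x k‖ * ‖y k‖ ≤ c n := by
    intro n
    rcases n with - | n
    · obtain ⟨m, x, y, h1, h2⟩ := (hR 0).exists_expansion
      refine ⟨m, x, y, h1, h2.trans ?_⟩
      have e1 : ‖R 0‖ ≤ ‖T‖ + ‖T - R 0‖ := by
        have : R 0 = T - (T - R 0) := by abel
        calc ‖R 0‖ = ‖T - (T - R 0)‖ := by rw [← this]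
          _ ≤ _ := norm_sub_le _ _
      have e2 := h 0
      rw [approxNumber_zero_right] at e2
      have e3 := hRn 0
      have e4 := ha (Nat.zero_le (2 ^ 0))
      simp only [c]
      norm_num at *
      linarith
    · obtain ⟨m, x, y, h1, h2⟩ := ((hR (n + 1)).sub (hR n)).exists_expansion
      refine ⟨m, x, y, h1, h2.trans ?_⟩
      have e1 : ‖R (n + 1) - R n‖ ≤ 2 * s (2 ^ n) := by
        have : R (n + 1) - R n = (T - R n) - (T - R (n + 1)) := by abel
        rw [this]
        refine (norm_sub_le _ _).trans ?_
        have e3 := hRn n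
        have e4 := hRn (n + 1)
        have e5 := ha (Nat.pow_le_pow_right two_pos n.le_succ)
        simp only [Nat.succ_eq_add_one] at e5
        linarith
      have e2 : (((2 ^ (n + 1) + 2 ^ n : ℕ) : ℝ)) ≤ 4 * 2 ^ n := by
        push_cast
        rw [pow_succ]
        linarith [pow_pos (two_pos : (0 : ℝ) < 2) n]
      calc _ ≤ (4 * 2 ^ n) * (2 * s (2 ^ n)) := mul_le_mul e2 e1 (norm_nonneg _) (by positivity)
        _ = c (n + 1) := by simp only [c]; ring
  choose m x y hAv hAn using hexp
  obtain ⟨hc1, hc2⟩ := sum_two_pow_mul_le h0 ha hs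
  have hcs : Summable c := (summable_nat_add_iff 1).1 (hc1.mul_left 8)
  have hct : ∑' n, c n ≤ 26 * ∑' j, s j := by
    rw [hcs.tsum_eq_zero_add]
    have e1 : c 0 = 2 * s 0 := rfl
    have e2 : ∑' n, c (n + 1) = 8 * ∑' n, 2 ^ n * s (2 ^ n) := tsum_mul_left
    have e3 : s 0 ≤ ∑' j, s j := hs.le_tsum 0 fun j _ => h0 j
    rw [e1, e2]
    linarith
  have hxs : Summable fun k : Σ n, Fin (m n) => ‖x k.1 k.2‖ * ‖y k.1 k.2‖ := by
    rw [summable_sigma_of_nonneg fun k => by positivity]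
    refine ⟨fun n => Summable.of_finite, ?_⟩
    refine Summable.of_nonneg_of_le (fun n => tsum_nonneg fun k => by positivity) (fun n => ?_) hcs
    rw [tsum_fintype]
    exact hAn n
  refine ⟨Σ n, Fin (m n), fun k => x k.1 k.2, fun k => y k.1 k.2, ⟨hxs, fun v => ?_⟩, ?_⟩
  · have hsv : Summable fun k : Σ n, Fin (m n) => inner ℂ (y k.1 k.2) v • x k.1 k.2 := by
      refine Summable.of_norm (Summable.of_nonneg_of_le (fun k => norm_nonneg _) (fun k => ?_)
        (hxs.mul_right ‖v‖))
      rw [norm_smul]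
      calc _ ≤ (‖y k.1 k.2‖ * ‖v‖) * ‖x k.1 k.2‖ :=
            mul_le_mul_of_nonneg_right (norm_inner_le_norm _ _) (norm_nonneg _)
        _ = _ := by ring
    have h1 := hsv.hasSum.sigma fun n => (hasSum_fintype _)
    simp only [← hAv] at h1
    have h2 := h1.tendsto_sum_nat
    have h3 : Filter.Tendsto (fun n => R n v) Filter.atTop (nhds (T v)) := by
      rw [tendsto_iff_norm_sub_tendsto_zero]
      have h4 : Filter.Tendsto (fun n : ℕ => s (2 ^ n) * ‖v‖) Filter.atTop (nhds (0 * ‖v‖)) :=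
        (hs.tendsto_atTop_zero.comp
          (tendsto_pow_atTop_atTop_of_one_lt one_lt_two)).mul_const _
      rw [zero_mul] at h4
      refine squeeze_zero (fun n => norm_nonneg _) (fun n => ?_) h4
      rw [norm_sub_rev, ← sub_apply]
      exact (ContinuousLinearMap.le_opNorm _ _).trans
        (mul_le_mul_of_nonneg_right (hRn n).le (norm_nonneg _))
    have h5 := h2.comp (Filter.tendsto_add_atTop_nat 1)
    have h6 : (fun n => ∑ i ∈ Finset.range n, A i v) ∘ (fun n => n + 1) = fun n => R n v := by
      ext n
      rw [Function.comp_apply, ← hsum n, sum_apply]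
    rw [h6] at h5
    rw [tendsto_nhds_unique h3 h5]
    exact hsv.hasSum
  · rw [hxs.tsum_sigma]
    refine le_trans ?_ hct
    have hle : ∀ n, ∑' k : Fin (m n), ‖x n k‖ * ‖y n k‖ ≤ c n := fun n => by
      rw [tsum_fintype]; exact hAn n
    exact (Summable.of_nonneg_of_le (fun n => tsum_nonneg fun k => by positivity) hle
      hcs).tsum_le_tsum hle hcs

theorem exists_nuclearExpansion_of_le {T : E →L[ℂ] F} {s : ℕ → ℝ} (ha : Antitone s)
    (hs : Summable s) (h : ∀ j, approxNumber T j ≤ s j) {ε : ℝ} (hε : 0 < ε) :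
    ∃ (ι : Type) (x : ι → F) (y : ι → E), IsNuclearExpansion x y T ∧
      ∑' k, ‖x k‖ * ‖y k‖ ≤ 26 * (∑' j, s j + ε) := by
  have h2 : Summable fun j : ℕ => ε / 2 / 2 ^ j := summable_geometric_two' ε
  have h3 : ∑' j : ℕ, ε / 2 / 2 ^ j = ε := tsum_geometric_two' ε
  have := exists_nuclearExpansion (T := T) (s := fun j => s j + ε / 2 / 2 ^ j) (fun i j hij => by
    have e1 : ε / 2 / 2 ^ j ≤ ε / 2 / 2 ^ i :=
      div_le_div_of_nonneg_left (by positivity) (by positivity)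
        (pow_le_pow_right₀ one_le_two hij)
    exact add_le_add (ha hij) e1) (hs.add h2) fun j =>
      lt_of_le_of_lt (h j) (lt_add_of_pos_right _ (by positivity))
  rwa [hs.tsum_add h2, h3] at this

theorem exists_nuclearExpansion_of_summable {T : E →L[ℂ] F} (h : Summable (approxNumber T)) :
    ∃ (ι : Type) (x : ι → F) (y : ι → E), IsNuclearExpansion x y T := by
  obtain ⟨ι, x, y, h, -⟩ :=
    exists_nuclearExpansion_of_le (approxNumber_antitone T) h (fun _ => le_rfl) one_pos
  exact ⟨ι, x, y, h⟩

theorem norm_trace_le {T : E →L[ℂ] E} {s : ℕ → ℝ} (ha : Antitone s) (hs : Summable s)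
    (h : ∀ j, approxNumber T j ≤ s j) : ‖trace T‖ ≤ 26 * ∑' j, s j := by
  refine le_of_forall_pos_le_add fun ε hε => ?_
  obtain ⟨ι, x, y, h1, h2⟩ := exists_nuclearExpansion_of_le ha hs h (ε := ε / 26) (by positivity)
  refine (h1.norm_trace_le.trans h2).trans_eq ?_
  ring

theorem hasSum_trace {T : E →L[ℂ] E} (h : Summable (approxNumber T)) :
    HasSum (fun i => inner ℂ (basis E i) (T (basis E i))) (trace T) := by
  obtain ⟨ι, x, y, h⟩ := exists_nuclearExpansion_of_summable h
  exact h.hasSum_trace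

theorem trace_add {S T : E →L[ℂ] E} (hS : Summable (approxNumber S))
    (hT : Summable (approxNumber T)) : trace (S + T) = trace S + trace T := by
  have := (hasSum_trace hS).add (hasSum_trace hT)
  simp only [← inner_add_right] at this
  exact this.tsum_eq

theorem trace_smul (c : ℂ) {T : E →L[ℂ] E} (hT : Summable (approxNumber T)) :
    trace (c • T) = c * trace T := by
  have := (hasSum_trace hT).mul_left c
  simp only [← inner_smul_right] at this
  exact this.tsum_eq

theorem trace_comp_comm_of_summable {T : E →L[ℂ] F} (h : Summable (approxNumber T))
    (S : F →L[ℂ] E) : trace (S ∘L T) = trace (T ∘L S) := by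
  obtain ⟨ι, x, y, h⟩ := exists_nuclearExpansion_of_summable h
  exact h.trace_comm S

theorem summable_approxNumber_add {S T : E →L[ℂ] F} (hS : Summable (approxNumber S))
    (hT : Summable (approxNumber T)) : Summable (approxNumber (S + T)) :=
  Summable.of_nonneg_of_le (fun _ => approxNumber_nonneg _ _) (approxNumber_half_add_le S T)
    ((summable_comp_div (approxNumber_nonneg _) hS 2).add
      (summable_comp_div (approxNumber_nonneg _) hT 2))

theorem summable_approxNumber_comp_left (S : F →L[ℂ] G) {T : E →L[ℂ] F}
    (hT : Summable (approxNumber T)) : Summable (approxNumber (S ∘L T)) :=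
  Summable.of_nonneg_of_le (fun _ => approxNumber_nonneg _ _) (approxNumber_comp_le_left S T)
    (hT.mul_left _)

theorem summable_approxNumber_comp_right {S : F →L[ℂ] G} (hS : Summable (approxNumber S))
    (T : E →L[ℂ] F) : Summable (approxNumber (S ∘L T)) :=
  Summable.of_nonneg_of_le (fun _ => approxNumber_nonneg _ _) (approxNumber_comp_le_right S T)
    (hS.mul_right _)

theorem summable_approxNumber_smul (c : ℂ) {T : E →L[ℂ] F}
    (hT : Summable (approxNumber T)) : Summable (approxNumber (c • T)) :=
  Summable.of_nonneg_of_le (fun _ => approxNumber_nonneg _ _) (approxNumber_smul_le c T)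
    (hT.mul_left _)

theorem summable_approxNumber_of_rankLE {T : E →L[ℂ] F} {k : ℕ} (h : RankLE T k) :
    Summable (approxNumber T) := by
  refine summable_of_ne_finset_zero (s := Finset.range k) fun j hj => ?_
  exact approxNumber_of_rankLE (h.mono (by simpa using hj))

theorem summable_approxNumber_comp {S : F →L[ℂ] G} {T : E →L[ℂ] F}
    (h : Summable fun j => approxNumber S j * approxNumber T j) :
    Summable (approxNumber (S ∘L T)) :=
  Summable.of_nonneg_of_le (fun _ => approxNumber_nonneg _ _) (approxNumber_half_comp_le S T)
    (summable_comp_div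
      (fun j => mul_nonneg (approxNumber_nonneg S j) (approxNumber_nonneg T j)) h 2)

/-- Nearly optimal approximations of finite rank, with a common majorant for the approximation
numbers of the errors. -/
theorem exists_rankLE_dominated (T : E →L[ℂ] F) :
    ∃ R : ℕ → E →L[ℂ] F, (∀ m, RankLE (R m) m) ∧
      (∀ m, ‖T - R m‖ ≤ approxNumber T m + (1 / 2) ^ (2 * m)) ∧
      ∀ m j, approxNumber (T - R m) j ≤ approxNumber T (j / 2) + (1 / 2) ^ j := by
  choose R hR hRn using fun m : ℕ =>
    exists_rankLE_lt (T := T) (lt_add_of_pos_right (approxNumber T m)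
      (show (0 : ℝ) < (1 / 2) ^ (2 * m) by positivity))
  refine ⟨R, hR, fun m => (hRn m).le, fun m j => ?_⟩
  rcases le_total (2 * m) j with h | h
  · have h1 : approxNumber (T - R m) ((j - m) + m) ≤
        approxNumber T (j - m) + approxNumber (-R m) m := by
      rw [sub_eq_add_neg]
      exact approxNumber_add_le _ _ _ _
    rw [approxNumber_of_rankLE (hR m).neg, Nat.sub_add_cancel (by omega), add_zero] at h1
    have h2 := approxNumber_antitone T (show j / 2 ≤ j - m by omega)
    have h3 : (0 : ℝ) ≤ (1 / 2) ^ j := by positivity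
    linarith
  · have h1 := approxNumber_le_norm (T - R m) j
    have h2 := approxNumber_antitone T (show j / 2 ≤ m by omega)
    have h3 : ((1 : ℝ) / 2) ^ (2 * m) ≤ (1 / 2) ^ j :=
      pow_le_pow_of_le_one (by norm_num) (by norm_num) h
    linarith [hRn m]

/-- If `T` is compact and `∑ⱼ sⱼ(S)sⱼ(T) < ∞` then `Tr(ST) = Tr(TS)`: this is known when `T` has
finite rank, and the general case follows by dominated convergence. -/
theorem trace_comp_comm {T : E →L[ℂ] F} {S : F →L[ℂ] E}
    (h0 : Filter.Tendsto (approxNumber T) Filter.atTop (nhds 0))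
    (h : Summable fun j => approxNumber S j * approxNumber T j) :
    trace (S ∘L T) = trace (T ∘L S) := by
  obtain ⟨R, hR, hRn, hRa⟩ := exists_rankLE_dominated T
  have hn : Filter.Tendsto (fun m => ‖T - R m‖) Filter.atTop (nhds 0) := by
    refine squeeze_zero (fun m => norm_nonneg _) hRn ?_
    have h1 : Filter.Tendsto (fun m : ℕ => ((1 : ℝ) / 2) ^ (2 * m)) Filter.atTop (nhds 0) := by
      simp only [pow_mul]
      exact tendsto_pow_atTop_nhds_zero_of_lt_one (by norm_num) (by norm_num)
    simpa using h0.add h1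
  -- the common majorant of the products of approximation numbers
  set M : ℕ → ℝ := fun j => (approxNumber T (j / 2) + (1 / 2) ^ j) * approxNumber S (j / 2) with hM
  have hp0 : ∀ j, 0 ≤ approxNumber S j * approxNumber T j := fun j =>
    mul_nonneg (approxNumber_nonneg S j) (approxNumber_nonneg T j)
  have hMs : Summable M := by
    have h1 := summable_comp_div hp0 h 2
    have h2 : Summable fun j : ℕ => ((1 : ℝ) / 2) ^ j := summable_geometric_two
    refine Summable.of_nonneg_of_le (fun j => mul_nonneg (add_nonneg (approxNumber_nonneg _ _)
      (by positivity)) (approxNumber_nonneg _ _)) (fun j => ?_) (h1.add (h2.mul_right ‖S‖))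
    simp only [hM, add_mul]
    refine add_le_add (mul_comm _ _).le ?_
    exact mul_le_mul_of_nonneg_left (approxNumber_le_norm _ _) (by positivity)
  have hdom : ∀ m j, approxNumber (T - R m) j * approxNumber S j ≤ M j := fun m j =>
    mul_le_mul (hRa m j) (approxNumber_antitone S (Nat.div_le_self j 2)) (approxNumber_nonneg _ _)
      (add_nonneg (approxNumber_nonneg _ _) (by positivity))
  have hs1 : ∀ m, Summable fun j => approxNumber (T - R m) j * approxNumber S j := fun m =>
    Summable.of_nonneg_of_le (fun j => mul_nonneg (approxNumber_nonneg _ _)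
      (approxNumber_nonneg _ _)) (hdom m) hMs
  set a : ℕ → ℕ → ℝ := fun m j => approxNumber (T - R m) (j / 2) * approxNumber S (j / 2)
  have ha : ∀ m, Antitone (a m) := fun m i j hij =>
    mul_le_mul (approxNumber_antitone _ (Nat.div_le_div_right hij))
      (approxNumber_antitone _ (Nat.div_le_div_right hij)) (approxNumber_nonneg _ _)
      (approxNumber_nonneg _ _)
  have has : ∀ m, Summable (a m) := fun m =>
    summable_comp_div (a := fun j => approxNumber (T - R m) j * approxNumber S j)
      (fun j => mul_nonneg (approxNumber_nonneg _ _) (approxNumber_nonneg _ _)) (hs1 m) 2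
  have hlim : Filter.Tendsto (fun m => ∑' j, a m j) Filter.atTop (nhds 0) := by
    have hM0 : ∀ j, 0 ≤ M j := fun j => mul_nonneg (add_nonneg (approxNumber_nonneg _ _)
      (by positivity)) (approxNumber_nonneg _ _)
    have := tendsto_tsum_of_dominated_convergence (𝓕 := Filter.atTop) (f := a) (g := fun _ => 0)
      (bound := fun j => M (j / 2)) (summable_comp_div hM0 hMs 2) (fun j => ?_)
      (Filter.Eventually.of_forall fun m j => ?_)
    · simpa using this
    · refine squeeze_zero (fun m => mul_nonneg (approxNumber_nonneg _ _) (approxNumber_nonneg _ _))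
        (fun m => mul_le_mul (approxNumber_le_norm _ _) (approxNumber_le_norm _ _)
          (approxNumber_nonneg _ _) (norm_nonneg _)) ?_
      simpa using hn.mul_const ‖S‖
    · rw [Real.norm_of_nonneg (mul_nonneg (approxNumber_nonneg _ _) (approxNumber_nonneg _ _))]
      exact hdom m (j / 2)
  have hbound : ∀ m, ‖trace (S ∘L T) - trace (T ∘L S)‖ ≤ 2 * (26 * ∑' j, a m j) := by
    intro m
    have e1 : S ∘L T = S ∘L (T - R m) + S ∘L R m := by
      rw [← ContinuousLinearMap.comp_add, sub_add_cancel]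
    have e2 : T ∘L S = (T - R m) ∘L S + R m ∘L S := by
      rw [← ContinuousLinearMap.add_comp, sub_add_cancel]
    have f1 := summable_approxNumber_of_rankLE (hR m)
    have b1 : ∀ j, approxNumber (S ∘L (T - R m)) j ≤ a m j := fun j =>
      (approxNumber_half_comp_le _ _ j).trans_eq (mul_comm _ _)
    have b2 : ∀ j, approxNumber ((T - R m) ∘L S) j ≤ a m j := fun j =>
      approxNumber_half_comp_le _ _ j
    rw [e1, e2, trace_add (Summable.of_nonneg_of_le (fun j => approxNumber_nonneg _ _) b1 (has m))
        (summable_approxNumber_comp_left S f1),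
      trace_add (Summable.of_nonneg_of_le (fun j => approxNumber_nonneg _ _) b2 (has m))
        (summable_approxNumber_comp_right f1 S), trace_comp_comm_of_summable f1 S,
      add_sub_add_right_eq_sub]
    refine (norm_sub_le _ _).trans ?_
    have n1 := norm_trace_le (ha m) (has m) b1
    have n2 := norm_trace_le (ha m) (has m) b2
    linarith
  have hz : ‖trace (S ∘L T) - trace (T ∘L S)‖ ≤ 2 * (26 * 0) :=
    ge_of_tendsto ((hlim.const_mul 26).const_mul 2) (Filter.Eventually.of_forall hbound)
  rw [mul_zero, mul_zero, norm_le_zero_iff, sub_eq_zero] at hz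
  exact hz

end Nuclear

/-! ### Families of operators of Schatten type -/

section Dominated

variable {K : Type*} [NormedAddCommGroup K] [InnerProductSpace ℂ K]

/-- The approximation numbers of `T` are at most `C rⱼᵏ`. -/
def IsDominated (r : ℕ → ℝ) (k : ℕ) (C : ℝ) (T : K →L[ℂ] K) : Prop :=
  ∀ j, approxNumber T j ≤ C * r j ^ k

/-- The scale of a filtration: a decreasing nonnegative sequence in `ℓᴺ`. -/
structure IsScale (N : ℕ) (r : ℕ → ℝ) : Prop where
  anti : Antitone r
  nonneg : ∀ j, 0 ≤ r j
  summable : Summable fun j => r j ^ N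

variable {N : ℕ} {r s : ℕ → ℝ}

theorem IsScale.half (h : IsScale N r) : IsScale N fun j => r (j / 2) where
  anti _ _ hij := h.anti (Nat.div_le_div_right hij)
  nonneg _ := h.nonneg _
  summable := summable_comp_div (fun j => pow_nonneg (h.nonneg j) N) h.summable 2

theorem IsScale.le_half (h : IsScale N r) (j : ℕ) : r j ≤ r (j / 2) := h.anti (Nat.div_le_self j 2)

theorem IsScale.add (hr : IsScale N r) (hs : IsScale N s) :
    IsScale N fun j => r j + s j where
  anti _ _ hij := add_le_add (hr.anti hij) (hs.anti hij)
  nonneg _ := add_nonneg (hr.nonneg _) (hs.nonneg _)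
  summable := by
    refine Summable.of_nonneg_of_le (fun j => pow_nonneg (add_nonneg (hr.nonneg j) (hs.nonneg j)) N)
      (fun j => ?_) ((hr.summable.add hs.summable).mul_left (2 ^ (N - 1)))
    exact add_pow_le (hr.nonneg j) (hs.nonneg j) N

theorem isScale_zero (hN : N ≠ 0) : IsScale N fun _ => 0 where
  anti _ _ _ := le_rfl
  nonneg _ := le_rfl
  summable := by simp [zero_pow hN]

theorem IsScale.tendsto_zero (h : IsScale N r) :
    Filter.Tendsto r Filter.atTop (nhds 0) := by
  have h1 := h.summable.tendsto_atTop_zero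
  rw [Metric.tendsto_atTop] at h1 ⊢
  intro ε hε
  obtain ⟨n, hn⟩ := h1 (ε ^ N) (pow_pos hε N)
  refine ⟨n, fun m hm => ?_⟩
  have := hn m hm
  rw [Real.dist_0_eq_abs, abs_of_nonneg (pow_nonneg (h.nonneg m) N)] at this
  rw [Real.dist_0_eq_abs, abs_of_nonneg (h.nonneg m)]
  exact lt_of_pow_lt_pow_left₀ N hε.le this

variable {k l : ℕ} {C C' : ℝ} {S T : K →L[ℂ] K}

theorem IsDominated.mono (h : IsDominated r k C T) (hC : C ≤ C') (hC' : 0 ≤ C')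
    (hr : ∀ j, 0 ≤ r j) (hrs : ∀ j, r j ≤ s j) : IsDominated s k C' T := fun j =>
  (h j).trans (mul_le_mul hC (pow_le_pow_left₀ (hr j) (hrs j) k) (pow_nonneg (hr j) k) hC')

theorem IsDominated.add (hS : IsDominated r k C S) (hT : IsDominated r k C' T) :
    IsDominated (fun j => r (j / 2)) k (C + C') (S + T) := fun j =>
  (approxNumber_half_add_le S T j).trans ((add_le_add (hS _) (hT _)).trans_eq (by ring))

theorem IsDominated.mul (hS : IsDominated r k C S) (hT : IsDominated r l C' T)
    (hC : 0 ≤ C) (hr : ∀ j, 0 ≤ r j) :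
    IsDominated (fun j => r (j / 2)) (k + l) (C * C') (S * T) := fun j =>
  (approxNumber_half_comp_le S T j).trans
    ((mul_le_mul (hS _) (hT _) (approxNumber_nonneg _ _)
      (mul_nonneg hC (pow_nonneg (hr _) _))).trans_eq (by ring))

theorem IsDominated.const_mul (hT : IsDominated r k C T) (S : K →L[ℂ] K) :
    IsDominated r k (‖S‖ * C) (S * T) := fun j =>
  (approxNumber_comp_le_left S T j).trans
    ((mul_le_mul_of_nonneg_left (hT j) (norm_nonneg S)).trans_eq (by ring))

theorem IsDominated.of_succ (hT : IsDominated r (k + 1) C T) (hC : 0 ≤ C) (hr : IsScale N r) :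
    IsDominated r k (C * r 0) T := fun j => by
  refine (hT j).trans ?_
  rw [pow_succ', ← mul_assoc]
  have h1 := hr.anti (Nat.zero_le j)
  exact mul_le_mul_of_nonneg_right (mul_le_mul_of_nonneg_left h1 hC) (pow_nonneg (hr.nonneg j) k)

theorem IsDominated.summable (hT : IsDominated r k C T) (hC : 0 ≤ C) (hr : IsScale N r)
    (hk : N ≤ k) : Summable (approxNumber T) := by
  refine Summable.of_nonneg_of_le (fun j => approxNumber_nonneg _ _) (fun j => ?_)
    ((hr.summable.mul_left (C * r 0 ^ (k - N))))
  refine (hT j).trans ?_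
  rw [← Nat.sub_add_cancel hk, pow_add, ← mul_assoc, Nat.add_sub_cancel]
  exact mul_le_mul_of_nonneg_right (mul_le_mul_of_nonneg_left
    (pow_le_pow_left₀ (hr.nonneg j) (hr.anti (Nat.zero_le j)) _) hC) (pow_nonneg (hr.nonneg j) _)

variable {X : Type*} [TopologicalSpace X]

/-- The family of operators `Φ` is controlled at `ξ₀`, in degree `k`, by the scale `r`: its
approximation numbers at `ξ₀` are `O(rᵏ)`, and those of `Φ ξ - Φ ξ₀` are uniformly `o(rᵏ)`. -/
structure IsControlledAt (r : ℕ → ℝ) (k : ℕ) (Φ : X → K →L[ℂ] K) (ξ₀ : X) : Prop where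
  bound : ∃ C, 0 ≤ C ∧ IsDominated r k C (Φ ξ₀)
  cont : ∀ ε > 0, ∀ᶠ ξ in nhds ξ₀, IsDominated r k ε (Φ ξ - Φ ξ₀)

variable {Φ Ψ : X → K →L[ℂ] K} {ξ₀ : X}

theorem IsControlledAt.mono (h : IsControlledAt r k Φ ξ₀) (hr : ∀ j, 0 ≤ r j)
    (hrs : ∀ j, r j ≤ s j) : IsControlledAt s k Φ ξ₀ where
  bound := by
    obtain ⟨C, hC, h⟩ := h.bound
    exact ⟨C, hC, h.mono le_rfl hC hr hrs⟩
  cont ε hε := (h.cont ε hε).mono fun ξ h => h.mono le_rfl hε.le hr hrs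

theorem IsControlledAt.add (hΦ : IsControlledAt r k Φ ξ₀) (hΨ : IsControlledAt r k Ψ ξ₀) :
    IsControlledAt (fun j => r (j / 2)) k (Φ + Ψ) ξ₀ where
  bound := by
    obtain ⟨C, hC, h⟩ := hΦ.bound
    obtain ⟨C', hC', h'⟩ := hΨ.bound
    exact ⟨C + C', add_nonneg hC hC', h.add h'⟩
  cont ε hε := by
    filter_upwards [hΦ.cont (ε / 2) (half_pos hε), hΨ.cont (ε / 2) (half_pos hε)] with ξ h h'
    have := h.add h'
    rw [add_halves] at this
    rwa [Pi.add_apply, Pi.add_apply, add_sub_add_comm]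

theorem IsControlledAt.const_mul (hΦ : IsControlledAt r k Φ ξ₀) (S : K →L[ℂ] K)
    (hr : ∀ j, 0 ≤ r j) : IsControlledAt r k (fun ξ => S * Φ ξ) ξ₀ where
  bound := by
    obtain ⟨C, hC, h⟩ := hΦ.bound
    exact ⟨_, mul_nonneg (norm_nonneg S) hC, h.const_mul S⟩
  cont ε hε := by
    filter_upwards [hΦ.cont (ε / (‖S‖ + 1)) (by positivity)] with ξ h
    rw [← mul_sub]
    refine (h.const_mul S).mono ?_ hε.le hr fun _ => le_rfl
    rw [mul_div_assoc', div_le_iff₀ (by positivity)]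
    nlinarith [norm_nonneg S]

theorem IsControlledAt.const_smul (hΦ : IsControlledAt r k Φ ξ₀) (c : ℂ)
    (hr : ∀ j, 0 ≤ r j) : IsControlledAt r k (c • Φ) ξ₀ := by
  have := hΦ.const_mul (c • 1) hr
  simp only [smul_mul_assoc, one_mul] at this
  exact this

theorem IsControlledAt.of_succ (h : IsControlledAt r (k + 1) Φ ξ₀) (hr : IsScale N r) :
    IsControlledAt r k Φ ξ₀ where
  bound := by
    obtain ⟨C, hC, h⟩ := h.bound
    exact ⟨C * r 0, mul_nonneg hC (hr.nonneg 0), h.of_succ hC hr⟩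
  cont ε hε := by
    have h0 := hr.nonneg 0
    filter_upwards [h.cont (ε / (r 0 + 1)) (by positivity)] with ξ h
    refine (h.of_succ (by positivity) hr).mono ?_ hε.le hr.nonneg fun _ => le_rfl
    rw [div_mul_eq_mul_div, div_le_iff₀ (by positivity)]
    nlinarith

/-- Approximation numbers of a product are estimated at half the index, and so are those of a sum;
this accounts for the shifts of the scale. -/
theorem IsControlledAt.mul (hr : IsScale N r) (hΦ : IsControlledAt r k Φ ξ₀)
    (hΨ : IsControlledAt r l Ψ ξ₀) :
    IsControlledAt (fun j => r (j / 2 / 2 / 2)) (k + l) (fun ξ => Φ ξ * Ψ ξ) ξ₀ := by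
  obtain ⟨C, hC, h⟩ := hΦ.bound
  obtain ⟨C', hC', h'⟩ := hΨ.bound
  have hle : ∀ j, r (j / 2) ≤ r (j / 2 / 2 / 2) := fun j =>
    (hr.half.half.le_half j).trans' (hr.half.le_half j)
  refine ⟨⟨C * C', mul_nonneg hC hC', (h.mul h' hC hr.nonneg).mono le_rfl (mul_nonneg hC hC')
    (fun _ => hr.nonneg _) hle⟩, fun ε hε => ?_⟩
  have hD : 0 < 1 + C + C' := by linarith
  -- `δ² + δ C' + C δ ≤ ε`
  set δ := min 1 (ε / (1 + C + C')) with hδ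
  have hδ0 : 0 < δ := lt_min one_pos (div_pos hε hD)
  have hδ1 : δ ≤ 1 := min_le_left _ _
  have hδ2 : δ * (1 + C + C') ≤ ε := (le_div_iff₀ hD).1 (min_le_right _ _)
  filter_upwards [hΦ.cont δ hδ0, hΨ.cont δ hδ0] with ξ hx hy
  have e : Φ ξ * Ψ ξ - Φ ξ₀ * Ψ ξ₀ = ((Φ ξ - Φ ξ₀) * (Ψ ξ - Ψ ξ₀) + (Φ ξ - Φ ξ₀) * Ψ ξ₀) +
      Φ ξ₀ * (Ψ ξ - Ψ ξ₀) := by noncomm_ring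
  rw [e]
  have h1 := (hx.mul hy hδ0.le hr.nonneg).add (hx.mul h' hδ0.le hr.nonneg)
  have h2 := (h.mul hy hC hr.nonneg).mono (s := fun j => r (j / 2 / 2)) le_rfl
    (mul_nonneg hC hδ0.le) (fun _ => hr.nonneg _) hr.half.le_half
  refine (h1.add h2).mono ?_ hε.le (fun _ => hr.nonneg _) fun _ => le_rfl
  nlinarith

/-- In degree `0` only the operator norm, which is the first approximation number, matters. -/
theorem isControlledAt_zero_iff :
    IsControlledAt r 0 Φ ξ₀ ↔ ContinuousAt Φ ξ₀ := by
  have key : ∀ (T : K →L[ℂ] K) c, IsDominated r 0 c T ↔ ‖T‖ ≤ c := fun T c => by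
    refine ⟨fun h => ?_, fun h j => ?_⟩
    · simpa [approxNumber_zero_right] using h 0
    · simpa using (approxNumber_le_norm T j).trans h
  constructor
  · intro h
    rw [Metric.continuousAt_iff']
    intro ε hε
    filter_upwards [h.cont (ε / 2) (half_pos hε)] with ξ hξ
    rw [dist_eq_norm]
    linarith [(key _ _).1 hξ]
  · intro h
    refine ⟨⟨‖Φ ξ₀‖, norm_nonneg _, (key _ _).2 le_rfl⟩, fun ε hε => ?_⟩
    rw [Metric.continuousAt_iff'] at h
    filter_upwards [h ε hε] with ξ hξ
    rw [dist_eq_norm] at hξ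
    exact (key _ _).2 hξ.le

end Dominated

section OperatorTrace

variable {K : Type v} [NormedAddCommGroup K] [InnerProductSpace ℂ K] [CompleteSpace K]

/-- The algebra of even operators for the grading `γ`. -/
abbrev EvenOperators (γ : K →L[ℂ] K) : Subalgebra ℂ (K →L[ℂ] K) := Subalgebra.centralizer ℂ {γ}

theorem mem_evenOperators {γ T : K →L[ℂ] K} : T ∈ EvenOperators γ ↔ γ * T = T * γ := by
  simp [EvenOperators, Subalgebra.mem_centralizer_iff]

/-- The even operators with summable approximation numbers. -/
def evenNuclear (γ : K →L[ℂ] K) : Submodule ℂ (EvenOperators γ) where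
  carrier := {T | Summable (approxNumber (T : K →L[ℂ] K))}
  zero_mem' := summable_approxNumber_of_rankLE (rankLE_zero 0)
  add_mem' := summable_approxNumber_add
  smul_mem' c _ h := summable_approxNumber_smul c h

/-- The supertrace on the even nuclear operators. -/
def nuclearSupertrace (γ : K →L[ℂ] K) : evenNuclear γ →ₗ[ℂ] ℂ where
  toFun T := supertrace γ (T : EvenOperators γ)
  map_add' S T := by
    have := trace_add (summable_approxNumber_comp_left γ S.2)
      (summable_approxNumber_comp_left γ T.2)
    rw [← ContinuousLinearMap.comp_add] at this
    exact this
  map_smul' c T := by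
    have := trace_smul c (summable_approxNumber_comp_left γ T.2)
    rw [← ContinuousLinearMap.comp_smul] at this
    exact this

/-- A linear extension of the supertrace to all even operators; its values outside the nuclear
operators are irrelevant. -/
def extendedSupertrace (γ : K →L[ℂ] K) : EvenOperators γ →ₗ[ℂ] ℂ :=
  (LinearMap.exists_extend (nuclearSupertrace γ)).choose

theorem extendedSupertrace_apply (γ : K →L[ℂ] K) {T : EvenOperators γ}
    (h : Summable (approxNumber (T : K →L[ℂ] K))) :
    extendedSupertrace γ T = supertrace γ (T : K →L[ℂ] K) :=
  LinearMap.congr_fun (LinearMap.exists_extend (nuclearSupertrace γ)).choose_spec ⟨T, h⟩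

theorem supertrace_mul_comm {γ S T : K →L[ℂ] K} (hT : γ * T = T * γ)
    (h0 : Filter.Tendsto (approxNumber T) Filter.atTop (nhds 0))
    (h : Summable fun j => approxNumber S j * approxNumber T j) :
    supertrace γ (S * T) = supertrace γ (T * S) := by
  have h1 : Summable fun j => approxNumber (γ * S) j * approxNumber T j := by
    refine Summable.of_nonneg_of_le (fun j => mul_nonneg (approxNumber_nonneg _ _)
      (approxNumber_nonneg _ _)) (fun j => ?_) (h.mul_left ‖γ‖)
    rw [← mul_assoc]
    exact mul_le_mul_of_nonneg_right (approxNumber_comp_le_left _ _ _) (approxNumber_nonneg _ _)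
  have := trace_comp_comm h0 h1
  unfold supertrace
  rw [← mul_assoc, ← mul_assoc, hT, mul_assoc]
  exact this

theorem supertrace_mul_comm_of_summable {γ S T : K →L[ℂ] K} (hT : γ * T = T * γ)
    (h : Summable (approxNumber T)) :
    supertrace γ (S * T) = supertrace γ (T * S) := by
  have := trace_comp_comm_of_summable h (γ * S)
  unfold supertrace
  rw [← mul_assoc, ← mul_assoc, hT, mul_assoc]
  exact this

theorem IsDominated.supertrace_mul_comm {γ S T : K →L[ℂ] K} {N k l : ℕ} {r s : ℕ → ℝ} {C C' : ℝ}
    (hS : γ * S = S * γ) (hT : γ * T = T * γ) (hr : IsScale N r) (hs : IsScale N s) (hC : 0 ≤ C) (hC' : 0 ≤ C')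
    (h : IsDominated r k C S) (h' : IsDominated s l C' T) (hkl : N ≤ k + l) :
    supertrace γ (S * T) = supertrace γ (T * S) := by
  rcases Nat.eq_zero_or_pos l with rfl | hl
  · exact (supertrace_mul_comm_of_summable hS (h.summable hC hr hkl)).symm
  · set t : ℕ → ℝ := fun j => r j + s j
    have ht : IsScale N t := hr.add hs
    have h2 := h.mono (s := t) le_rfl hC hr.nonneg fun j => le_add_of_nonneg_right (hs.nonneg j)
    have h2' := h'.mono (s := t) le_rfl hC' hs.nonneg fun j => le_add_of_nonneg_left (hr.nonneg j)
    refine TwistedST.supertrace_mul_comm hT ?_ ?_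
    · refine squeeze_zero (fun j => approxNumber_nonneg _ _) h2' ?_
      have := (ht.tendsto_zero.pow l).const_mul C'
      simpa [zero_pow hl.ne'] using this
    · refine Summable.of_nonneg_of_le (fun j => mul_nonneg (approxNumber_nonneg _ _)
        (approxNumber_nonneg _ _)) (fun j => ?_) (ht.summable.mul_left (C * C' * t 0 ^ (k + l - N)))
      calc _ ≤ (C * t j ^ k) * (C' * t j ^ l) := mul_le_mul (h2 j) (h2' j) (approxNumber_nonneg _ _)
            (mul_nonneg hC (pow_nonneg (ht.nonneg j) k))
        _ = C * C' * t j ^ (k + l - N) * t j ^ N := by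
            rw [mul_assoc (C * C'), ← pow_add, Nat.sub_add_cancel hkl, pow_add]; ring
        _ ≤ _ := mul_le_mul_of_nonneg_right (mul_le_mul_of_nonneg_left
            (pow_le_pow_left₀ (ht.nonneg j) (ht.anti (Nat.zero_le j)) _) (mul_nonneg hC hC'))
            (pow_nonneg (ht.nonneg j) _)

/-- The even operators for the grading `γ`, with their supertrace, filtered by the decay of
approximation numbers on the scale of sequences in `ℓᴺ`. -/
def operatorTraceSystem (γ : K →L[ℂ] K) (N : ℕ) (hN : N ≠ 0) :
    TraceSystem.{u} (EvenOperators γ) where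
  fil X _ k :=
    { carrier := {Φ | ∀ ξ₀, ∃ r, IsScale N r ∧
        IsControlledAt r k (fun ξ => (Φ ξ : K →L[ℂ] K)) ξ₀}
      zero_mem' := fun ξ₀ => ⟨fun _ => 0, isScale_zero hN, ⟨0, le_rfl, fun j => by
        simp [approxNumber_of_rankLE (rankLE_zero j)]⟩, fun ε hε => Filter.Eventually.of_forall
          fun ξ j => by simpa [approxNumber_of_rankLE (rankLE_zero j)] using by positivity⟩
      add_mem' := fun {Φ Ψ} hΦ hΨ ξ₀ => by
        obtain ⟨r, hr, h⟩ := hΦ ξ₀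
        obtain ⟨s, hs, h'⟩ := hΨ ξ₀
        exact ⟨_, (hr.add hs).half,
          (h.mono hr.nonneg fun j => le_add_of_nonneg_right (hs.nonneg j)).add
            (h'.mono hs.nonneg fun j => le_add_of_nonneg_left (hr.nonneg j))⟩
      smul_mem' := fun c Φ hΦ ξ₀ => by
        obtain ⟨r, hr, h⟩ := hΦ ξ₀
        exact ⟨r, hr, h.const_smul c hr.nonneg⟩ }
  const_mem X _ b ξ₀ := ⟨fun _ => 0, isScale_zero hN,
    isControlledAt_zero_iff.2 continuousAt_const⟩
  antitone X _ k Φ hΦ ξ₀ := by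
    obtain ⟨r, hr, h⟩ := hΦ ξ₀
    exact ⟨r, hr, h.of_succ hr⟩
  mul_mem X _ k l Φ Ψ hΦ hΨ ξ₀ := by
    obtain ⟨r, hr, h⟩ := hΦ ξ₀
    obtain ⟨s, hs, h'⟩ := hΨ ξ₀
    exact ⟨_, (hr.add hs).half.half.half, IsControlledAt.mul (hr.add hs)
      (h.mono hr.nonneg fun j => le_add_of_nonneg_right (hs.nonneg j))
        (h'.mono hs.nonneg fun j => le_add_of_nonneg_left (hr.nonneg j))⟩
  comp_mem hΦ hg ξ₀ := by
    obtain ⟨r, hr, h⟩ := hΦ _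
    exact ⟨r, hr, h.bound, fun ε hε => hg.continuousAt.eventually (h.cont ε hε)⟩
  τ := extendedSupertrace γ
  N := N
  trace_comm X _ k l Φ Ψ hΦ hΨ hkl ξ := by
    obtain ⟨r, hr, ⟨C, hC, h⟩, -⟩ := hΦ ξ
    obtain ⟨s, hs, ⟨C', hC', h'⟩, -⟩ := hΨ ξ
    set t : ℕ → ℝ := fun j => r j + s j
    have ht : IsScale N t := hr.add hs
    have h2 := h.mono (s := t) le_rfl hC hr.nonneg fun j => le_add_of_nonneg_right (hs.nonneg j)
    have h2' := h'.mono (s := t) le_rfl hC' hs.nonneg fun j => le_add_of_nonneg_left (hr.nonneg j)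
    have s1 := (h2.mul h2' hC ht.nonneg).summable (mul_nonneg hC hC') ht.half hkl
    have s2 := (h2'.mul h2 hC' ht.nonneg).summable (mul_nonneg hC' hC) ht.half
      (hkl.trans_eq (add_comm _ _))
    rw [extendedSupertrace_apply γ (T := Φ ξ * Ψ ξ) s1,
      extendedSupertrace_apply γ (T := Ψ ξ * Φ ξ) s2]
    exact h.supertrace_mul_comm (mem_evenOperators.1 (Φ ξ).2) (mem_evenOperators.1 (Ψ ξ).2)
      hr hs hC hC' h' hkl
  continuous_trace X _ Φ hΦ := by
    have hsum : ∀ ξ, Summable (approxNumber (Φ ξ : K →L[ℂ] K)) := fun ξ => by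
      obtain ⟨r, hr, ⟨C, hC, h⟩, -⟩ := hΦ ξ
      exact h.summable hC hr le_rfl
    refine continuous_iff_continuousAt.2 fun ξ₀ => ?_
    obtain ⟨r, hr, -, h⟩ := hΦ ξ₀
    rw [Metric.continuousAt_iff']
    intro ε hε
    set M := ∑' j, r j ^ N
    have hM : 0 ≤ M := tsum_nonneg fun j => pow_nonneg (hr.nonneg j) N
    set η := ε / (2 * (‖γ‖ + 1) * 26 * (M + 1)) with hη
    have hη0 : 0 < η := by positivity
    filter_upwards [h η hη0] with ξ hξ
    have hξ' := hξ.const_mul γ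
    have hs : Summable fun j => ‖γ‖ * η * r j ^ N := hr.summable.mul_left _
    have h1 := norm_trace_le (s := fun j => ‖γ‖ * η * r j ^ N)
      (fun i j hij => mul_le_mul_of_nonneg_left (pow_le_pow_left₀ (hr.nonneg j) (hr.anti hij) N)
        (by positivity)) hs hξ'
    rw [tsum_mul_left] at h1
    rw [dist_eq_norm, ← map_sub, extendedSupertrace_apply γ (T := Φ ξ - Φ ξ₀)
      (hξ.summable hη0.le hr le_rfl)]
    refine lt_of_le_of_lt h1 ?_
    have h2 : 26 * (‖γ‖ * η * M) ≤ 26 * ((‖γ‖ + 1) * η * (M + 1)) := by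
      gcongr <;> linarith
    refine lt_of_le_of_lt h2 ?_
    have h3 : 26 * ((‖γ‖ + 1) * η * (M + 1)) = ε / 2 := by
      rw [hη]
      field_simp
    linarith

end OperatorTrace

/-! ### Approximation numbers and the functional calculus -/

section NormComparison

variable {E F G : Type*} [NormedAddCommGroup E] [InnerProductSpace ℂ E] [CompleteSpace E]
  [NormedAddCommGroup F] [InnerProductSpace ℂ F] [CompleteSpace F]
  [NormedAddCommGroup G] [InnerProductSpace ℂ G] [CompleteSpace G]

theorem rankLE_adjoint {T : E →L[ℂ] F} {j : ℕ} (h : RankLE T j) :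
    RankLE (ContinuousLinearMap.adjoint T) j := by
  set V := LinearMap.range (T : E →ₗ[ℂ] F) with hV
  have hfin : FiniteDimensional ℂ V := by
    have : Module.rank ℂ V < Cardinal.aleph0 := lt_of_le_of_lt h Cardinal.natCast_lt_aleph0
    exact Module.rank_lt_aleph0_iff.1 this
  -- `T = P T` for the projection `P` onto the range of `T`, so `T† = T† P`
  have e : V.starProjection ∘L T = T := by
    ext x
    exact Submodule.starProjection_eq_self_iff.2 ⟨x, rfl⟩
  have e2 : ContinuousLinearMap.adjoint T = ContinuousLinearMap.adjoint T ∘L V.starProjection := by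
    conv_lhs => rw [← e, ContinuousLinearMap.adjoint_comp]
    congr 1
    exact (isSelfAdjoint_starProjection V).star_eq
  rw [e2]
  refine RankLE.comp_left ?_ _
  have hle : LinearMap.range (V.starProjection : F →ₗ[ℂ] F) ≤ V := by
    rintro _ ⟨x, rfl⟩
    exact Submodule.starProjection_apply_mem V x
  exact (Submodule.rank_mono hle).trans h

/-- If `‖S v‖ ≤ ‖T v‖` for all `v`, then the approximation numbers of `S` are at most those of
`T`: where `R` of finite rank approximates `T`, approximate `S` by `S P` for the projection `P`
onto `(ker R)ᗮ`. -/
theorem approxNumber_le_of_norm_apply_le {S : E →L[ℂ] F} {T : E →L[ℂ] G}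
    (h : ∀ v, ‖S v‖ ≤ ‖T v‖) (j : ℕ) : approxNumber S j ≤ approxNumber T j := by
  refine approxNumber_le_of_forall fun ε hε => ?_
  obtain ⟨R, hR, hTR⟩ := exists_rankLE_lt (T := T) (lt_add_of_pos_right (approxNumber T j) hε)
  have hR' := rankLE_adjoint hR
  set V := LinearMap.range (ContinuousLinearMap.adjoint R : G →ₗ[ℂ] E) with hV
  have hfin : FiniteDimensional ℂ V := by
    have : Module.rank ℂ V < Cardinal.aleph0 := lt_of_le_of_lt hR' Cardinal.natCast_lt_aleph0
    exact Module.rank_lt_aleph0_iff.1 this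
  refine ⟨S ∘L V.starProjection, ?_, ?_⟩
  · refine RankLE.comp_left ?_ _
    have hle : LinearMap.range (V.starProjection : E →ₗ[ℂ] E) ≤ V := by
      rintro _ ⟨x, rfl⟩
      exact Submodule.starProjection_apply_mem V x
    exact (Submodule.rank_mono hle).trans hR'
  · refine ContinuousLinearMap.opNorm_le_bound _ (add_nonneg (approxNumber_nonneg _ _) hε.le)
      fun v => ?_
    set w := v - V.starProjection v with hw
    have e1 : (S - S ∘L V.starProjection) v = S w := by simp [hw]
    have hwV : w ∈ Vᗮ := Submodule.sub_starProjection_mem_orthogonal v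
    have hRw : R w = 0 := by
      rw [← inner_self_eq_zero (𝕜 := ℂ), ← ContinuousLinearMap.adjoint_inner_left]
      exact (Submodule.mem_orthogonal _ _).1 hwV _ ⟨R w, rfl⟩
    have hwv : ‖w‖ ≤ ‖v‖ := by
      have h1 : w = Vᗮ.starProjection v := by
        rw [Submodule.starProjection_orthogonal', sub_apply,
          one_apply_eq_self]
      rw [h1]
      exact Submodule.norm_starProjection_apply_le _ _
    rw [e1]
    calc ‖S w‖ ≤ ‖T w‖ := h w
      _ = ‖(T - R) w‖ := by rw [sub_apply, hRw, sub_zero]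
      _ ≤ ‖T - R‖ * ‖w‖ := ContinuousLinearMap.le_opNorm _ _
      _ ≤ _ := mul_le_mul hTR.le hwv (norm_nonneg _) (add_nonneg (approxNumber_nonneg _ _) hε.le)

/-- The approximation numbers of a Hilbert-Schmidt operator are square summable. -/
theorem sum_sq_approxNumber_le {κ : Type*} (b : HilbertBasis κ ℂ E) (n : ℕ) (T : E →L[ℂ] F)
    (h : Summable fun k => ‖T (b k)‖ ^ 2) :
    ∑ i ∈ Finset.range n, approxNumber T i ^ 2 ≤ 4 * ∑' k, ‖T (b k)‖ ^ 2 := by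
  induction n generalizing T with
  | zero => simpa using tsum_nonneg fun k => by positivity
  | succ n ih =>
    by_cases hT : T = 0
    · subst hT
      simp [approxNumber_of_rankLE (rankLE_zero _)]
    have hT0 : 0 < ‖T‖ := norm_pos_iff.2 hT
    obtain ⟨v, hv1, hv⟩ : ∃ v : F, ‖v‖ = 1 ∧ ‖T‖ / 2 ≤ ‖ContinuousLinearMap.adjoint T v‖ := by
      by_contra! hcon
      have : ‖ContinuousLinearMap.adjoint T‖ ≤ ‖T‖ / 2 := by
        refine ContinuousLinearMap.opNorm_le_bound _ (by positivity) fun w => ?_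
        by_cases hw : w = 0
        · simp [hw]
        have hw0 : ‖w‖ ≠ 0 := norm_ne_zero_iff.2 hw
        have := (hcon (((‖w‖ : ℂ)⁻¹) • w) (by
          rw [norm_smul, norm_inv, Complex.norm_real, norm_norm, inv_mul_cancel₀ hw0])).le
        rw [map_smul, norm_smul, norm_inv, Complex.norm_real, norm_norm,
          inv_mul_le_iff₀ (by positivity)] at this
        linarith
      rw [LinearIsometryEquiv.norm_map] at this
      linarith
    -- split off the component of the range of `T` along `v`
    set T' : E →L[ℂ] F := T - InnerProductSpace.rankOne ℂ v v ∘L T with hT'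
    have hT'a : ∀ x, T' x = T x - inner ℂ v (T x) • v := fun x => by simp [hT']
    have hr1 : RankLE (InnerProductSpace.rankOne ℂ v v ∘L T) 1 := by
      refine RankLE.comp_right ?_ T
      have hle : LinearMap.range ((InnerProductSpace.rankOne ℂ v v : F →L[ℂ] F) : F →ₗ[ℂ] F) ≤
          Submodule.span ℂ {v} := by
        rintro _ ⟨x, rfl⟩
        exact Submodule.mem_span_singleton.2 ⟨inner ℂ v x, by simp⟩
      refine (Submodule.rank_mono hle).trans ?_
      simpa using rank_span_le (R := ℂ) ({v} : Set F)
    have hs : ∀ i, approxNumber T (i + 1) ≤ approxNumber T' i := fun i => by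
      have e : T = T' + InnerProductSpace.rankOne ℂ v v ∘L T := by rw [hT', sub_add_cancel]
      have := approxNumber_add_le T' (InnerProductSpace.rankOne ℂ v v ∘L T) i 1
      rwa [← e, approxNumber_of_rankLE hr1, add_zero] at this
    have hsq : ∀ x, ‖T' x‖ ^ 2 = ‖T x‖ ^ 2 - ‖inner ℂ (ContinuousLinearMap.adjoint T v) x‖ ^ 2 := by
      intro x
      have hx : T x = T' x + inner ℂ v (T x) • v := by rw [hT'a, sub_add_cancel]
      have horth : inner ℂ (T' x) (inner ℂ v (T x) • v) = (0 : ℂ) := by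
        rw [inner_smul_right, hT'a, inner_sub_left, inner_smul_left, inner_self_eq_norm_sq_to_K,
          hv1, inner_conj_symm]
        simp
      have := norm_add_sq_eq_norm_sq_add_norm_sq_of_inner_eq_zero _ _ horth
      rw [← hx, norm_smul, hv1, mul_one] at this
      rw [ContinuousLinearMap.adjoint_inner_left]
      nlinarith
    have hpars := b.orthonormal.inner_products_summable (ContinuousLinearMap.adjoint T v)
    have hpar : ∑' k, ‖inner ℂ (ContinuousLinearMap.adjoint T v) (b k)‖ ^ 2 =
        ‖ContinuousLinearMap.adjoint T v‖ ^ 2 := by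
      have h1 := b.tsum_inner_mul_inner (ContinuousLinearMap.adjoint T v)
        (ContinuousLinearMap.adjoint T v)
      rw [inner_self_eq_norm_sq_to_K] at h1
      have h2 : ∀ k, inner ℂ (ContinuousLinearMap.adjoint T v) (b k) *
          inner ℂ (b k) (ContinuousLinearMap.adjoint T v) =
          ((‖inner ℂ (ContinuousLinearMap.adjoint T v) (b k)‖ ^ 2 : ℝ) : ℂ) := fun k => by
        rw [← inner_conj_symm (b k), Complex.mul_conj, Complex.normSq_eq_norm_sq]
      simp only [h2] at h1
      rw [← Complex.ofReal_tsum] at h1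
      exact Complex.ofReal_injective (h1.trans (Complex.ofReal_pow _ 2).symm)
    have hpars' : Summable fun k => ‖inner ℂ (ContinuousLinearMap.adjoint T v) (b k)‖ ^ 2 := by
      simpa only [norm_inner_symm] using hpars
    have hsum' : Summable fun k => ‖T' (b k)‖ ^ 2 := by
      simp only [hsq]
      exact h.sub hpars'
    have h1 := ih T' hsum'
    simp only [hsq] at h1
    rw [h.tsum_sub hpars', hpar] at h1
    rw [Finset.sum_range_succ', approxNumber_zero_right]
    have h2 : ∑ i ∈ Finset.range n, approxNumber T (i + 1) ^ 2 ≤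
        ∑ i ∈ Finset.range n, approxNumber T' i ^ 2 :=
      Finset.sum_le_sum fun i _ => pow_le_pow_left₀ (approxNumber_nonneg _ _) (hs i) 2
    have h3 : (‖T‖ / 2) ^ 2 ≤ ‖ContinuousLinearMap.adjoint T v‖ ^ 2 :=
      pow_le_pow_left₀ (by positivity) hv 2
    linarith

end NormComparison

section TraceClass

variable {H : Type v} [NormedAddCommGroup H] [InnerProductSpace ℂ H] [CompleteSpace H]

theorem norm_abs_apply (T : H →L[ℂ] H) (v : H) : ‖CFC.abs T v‖ = ‖T v‖ := by
  have h1 : IsSelfAdjoint (CFC.abs T) := (CFC.abs_nonneg T).isSelfAdjoint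
  have h2 : inner ℂ (CFC.abs T v) (CFC.abs T v) = inner ℂ (T v) (T v) := by
    rw [← ContinuousLinearMap.adjoint_inner_right (CFC.abs T), ← ContinuousLinearMap.star_eq_adjoint,
      h1.star_eq, ← mul_apply_eq_comp, CFC.abs_mul_abs, mul_apply_eq_comp,
      ContinuousLinearMap.star_eq_adjoint, ContinuousLinearMap.adjoint_inner_right]
  rw [inner_self_eq_norm_sq_to_K, inner_self_eq_norm_sq_to_K] at h2
  have h3 : ‖CFC.abs T v‖ ^ 2 = ‖T v‖ ^ 2 := by exact_mod_cast h2
  exact (pow_left_inj₀ (norm_nonneg _) (norm_nonneg _) two_ne_zero).1 h3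

theorem approxNumber_abs (T : H →L[ℂ] H) (j : ℕ) :
    approxNumber (CFC.abs T) j = approxNumber T j :=
  le_antisymm (approxNumber_le_of_norm_apply_le (fun v => (norm_abs_apply T v).le) j)
    (approxNumber_le_of_norm_apply_le (fun v => (norm_abs_apply T v).ge) j)

/-- If `|T|` has a convergent trace in one basis then its square root is Hilbert-Schmidt, hence has
square summable approximation numbers. -/
theorem isTraceClass_iff {T : H →L[ℂ] H} : IsTraceClass T ↔ Summable (approxNumber T) := by
  have habs : approxNumber (CFC.abs T) = approxNumber T := funext (approxNumber_abs T)
  constructor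
  · intro h
    set Q := CFC.sqrt (CFC.abs T) with hQ
    have hQs : IsSelfAdjoint Q := (CFC.sqrt_nonneg _).isSelfAdjoint
    have hQQ : Q * Q = CFC.abs T := CFC.sqrt_mul_sqrt_self _ (CFC.abs_nonneg T)
    have h1 : ∀ i, (inner ℂ (basis H i) (CFC.abs T (basis H i))).re = ‖Q (basis H i)‖ ^ 2 := by
      intro i
      rw [← hQQ, mul_apply_eq_comp, ← ContinuousLinearMap.adjoint_inner_left,
        ← ContinuousLinearMap.star_eq_adjoint, hQs.star_eq, inner_self_eq_norm_sq_to_K]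
      norm_cast
    unfold IsTraceClass at h
    simp only [h1] at h
    have h2 : Summable fun j => approxNumber Q j ^ 2 :=
      summable_of_sum_range_le (fun j => sq_nonneg _) fun n => sum_sq_approxNumber_le (basis H) n Q h
    simp only [sq] at h2
    have h3 := summable_approxNumber_comp h2
    rw [← habs, ← hQQ]
    exact h3
  · intro h
    rw [← habs] at h
    exact Complex.reCLM.summable (hasSum_trace h).summable

/-- For `c > sⱼ(T)`, the operator `|T|ᵖ` differs from `min(|T|, c)ᵖ`, of norm at most `cᵖ`, by an
operator with range in the spectral subspace where `|T| ≥ c`. A rank `j` operator at distance less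
than `c` from `T` is injective on that range, whose dimension is therefore at most `j`. -/
theorem approxNumber_cfc_rpow_le {T : H →L[ℂ] H} (hT : IsSelfAdjoint T) {p : ℝ} (hp : 0 < p)
    (j : ℕ) : approxNumber (cfc (fun t : ℝ => |t| ^ p) T) j ≤ approxNumber T j ^ p := by
  have key : ∀ c, approxNumber T j < c → approxNumber (cfc (fun t : ℝ => |t| ^ p) T) j ≤ c ^ p := by
    intro c hc
    have hc0 : 0 < c := lt_of_le_of_lt (approxNumber_nonneg _ _) hc
    obtain ⟨F, hF, hTF⟩ := exists_rankLE_lt hc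
    set f : ℝ → ℝ := fun t => |t| ^ p with hf
    set m : ℝ → ℝ := fun t => min |t| c ^ p with hm
    -- `g` vanishes on `[-c, c]`, and `g(t) = h(t) t g(t)` with `|h| ≤ 1 / c`
    set g : ℝ → ℝ := fun t => |t| ^ p - min |t| c ^ p with hg
    set h : ℝ → ℝ := fun t => t / max |t| c ^ 2 with hh
    have cf : Continuous f := continuous_abs.rpow_const fun _ => Or.inr hp.le
    have cm : Continuous m := (continuous_abs.min continuous_const).rpow_const fun _ => Or.inr hp.le
    have cg : Continuous g := cf.sub cm
    have ch : Continuous h := continuous_id.div₀ ((continuous_abs.max continuous_const).pow 2)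
      fun t => (pow_pos (lt_max_of_lt_right hc0) 2).ne'
    have hgt : ∀ t, g t = h t * (t * g t) := by
      intro t
      rcases le_total |t| c with ht | ht
      · simp [hg, min_eq_left ht]
      · have ht0 : t ≠ 0 := abs_pos.1 (hc0.trans_le ht)
        simp only [hh, max_eq_left ht, sq_abs]
        field_simp
    have hhc : ∀ t, ‖h t‖ ≤ 1 / c := by
      intro t
      have h1 : 0 < max |t| c := lt_max_of_lt_right hc0
      rw [hh, Real.norm_eq_abs, abs_div, abs_of_nonneg (sq_nonneg (max |t| c)),
        div_le_div_iff₀ (pow_pos h1 2) hc0, one_mul, sq]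
      exact mul_le_mul (le_max_left _ _) (le_max_right _ _) hc0.le h1.le
    have eg : cfc g T = cfc h T * (T * cfc g T) := by
      conv_lhs => rw [show g = fun t => h t * (t * g t) from funext hgt]
      rw [cfc_mul h (fun t => t * g t) T ch.continuousOn (by fun_prop),
        cfc_mul (fun t => t) g T (by fun_prop) cg.continuousOn, cfc_id' ℝ T]
    have hlow : ∀ w, c * ‖cfc g T w‖ ≤ ‖T (cfc g T w)‖ := by
      intro w
      have h1 : ‖cfc g T w‖ ≤ 1 / c * ‖T (cfc g T w)‖ := by
        conv_lhs => rw [eg]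
        rw [mul_apply_eq_comp, mul_apply_eq_comp]
        exact ContinuousLinearMap.le_of_opNorm_le _ (norm_cfc_le (by positivity) fun t _ => hhc t) _
      rw [one_div, ← div_eq_inv_mul, le_div_iff₀ hc0] at h1
      linarith
    have hrank : RankLE (cfc g T) j := by
      set V := LinearMap.range ((cfc g T : H →L[ℂ] H) : H →ₗ[ℂ] H)
      have hinj : Function.Injective ((F : H →ₗ[ℂ] H).domRestrict V) := by
        rw [← LinearMap.ker_eq_bot, LinearMap.ker_eq_bot']
        rintro ⟨_, w, rfl⟩ hw
        have hw : F (cfc g T w) = 0 := hw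
        have h1 : ‖T (cfc g T w)‖ ≤ ‖T - F‖ * ‖cfc g T w‖ := by
          have := (T - F).le_opNorm (cfc g T w)
          rwa [sub_apply, hw, sub_zero] at this
        have h2 : ‖cfc g T w‖ = 0 := by
          by_contra hne
          have hpos := lt_of_le_of_ne (norm_nonneg _) (Ne.symm hne)
          have := mul_lt_mul_of_pos_right hTF hpos
          linarith [hlow w]
        exact Subtype.ext (norm_eq_zero.1 h2)
      have h2 : LinearMap.range ((F : H →ₗ[ℂ] H).domRestrict V) ≤ LinearMap.range (F : H →ₗ[ℂ] H) := by
        rintro _ ⟨x, rfl⟩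
        exact ⟨x, rfl⟩
      have h3 : Module.rank ℂ V ≤ LinearMap.rank ((F : H →ₗ[ℂ] H).domRestrict V) :=
        (rank_range_of_injective _ hinj).ge
      exact h3.trans ((Submodule.rank_mono h2).trans hF)
    refine (approxNumber_le hrank).trans ?_
    have e : cfc f T - cfc g T = cfc m T := by
      rw [← cfc_sub f g T cf.continuousOn cg.continuousOn]
      congr 1
      ext t
      simp [hf, hg, hm]
    rw [e]
    refine norm_cfc_le (by positivity) fun t _ => ?_
    have h0 : 0 ≤ min |t| c := le_min (abs_nonneg t) hc0.le
    rw [hm, Real.norm_of_nonneg (Real.rpow_nonneg h0 p)]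
    exact Real.rpow_le_rpow h0 (min_le_right _ _) hp.le
  have hlim : Filter.Tendsto (fun c : ℝ => c ^ p) (nhdsWithin (approxNumber T j)
      (Set.Ioi (approxNumber T j))) (nhds (approxNumber T j ^ p)) :=
    ((Real.continuous_rpow_const hp.le).tendsto _).mono_left nhdsWithin_le_nhds
  exact ge_of_tendsto hlim (Filter.eventually_of_mem self_mem_nhdsWithin key)

/-- One direction applies `approxNumber_cfc_rpow_le` to `T` with exponent `p`, the other to `|T|ᵖ`
with exponent `1 / p`. -/
theorem isTraceClass_cfc_rpow_iff {T : H →L[ℂ] H} (hT : IsSelfAdjoint T) {p : ℝ} (hp : 0 < p) :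
    IsTraceClass (cfc (fun t : ℝ => |t| ^ p) T) ↔ IsSchatten p T := by
  rw [isTraceClass_iff]
  constructor
  · intro h
    set P := cfc (fun t : ℝ => |t| ^ p) T with hP
    have cf : Continuous fun t : ℝ => |t| ^ p := continuous_abs.rpow_const fun _ => Or.inr hp.le
    have cf' : Continuous fun t : ℝ => |t| ^ p⁻¹ :=
      continuous_abs.rpow_const fun _ => Or.inr (inv_nonneg.2 hp.le)
    have hPs : IsSelfAdjoint P := cfc_predicate _ T
    have e : cfc (fun t : ℝ => |t| ^ p⁻¹) P = CFC.abs T := by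
      rw [hP, ← cfc_comp' (fun t : ℝ => |t| ^ p⁻¹) (fun t : ℝ => |t| ^ p) T cf'.continuousOn
        cf.continuousOn, CFC.abs_eq_cfc_norm T hT]
      congr 1
      ext t
      rw [abs_of_nonneg (Real.rpow_nonneg (abs_nonneg t) p), ← Real.rpow_mul (abs_nonneg t),
        mul_inv_cancel₀ hp.ne', Real.rpow_one, Real.norm_eq_abs]
    refine Summable.of_nonneg_of_le (fun j => Real.rpow_nonneg (approxNumber_nonneg _ _) _)
      (fun j => ?_) h
    have h1 := approxNumber_cfc_rpow_le hPs (inv_pos.2 hp) j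
    rw [e, approxNumber_abs] at h1
    have h2 := Real.rpow_le_rpow (approxNumber_nonneg _ _) h1 hp.le
    rwa [← Real.rpow_mul (approxNumber_nonneg _ _), inv_mul_cancel₀ hp.ne', Real.rpow_one] at h2
  · intro h
    exact Summable.of_nonneg_of_le (fun j => approxNumber_nonneg _ _)
      (fun j => approxNumber_cfc_rpow_le hT hp j) h

end TraceClass

/-! ### Unbounded operators and their graphs -/

section Graph

variable {H : Type v} [NormedAddCommGroup H] [InnerProductSpace ℂ H] [CompleteSpace H]
  {D : H →ₗ.[ℂ] H}

theorem mk_mem_graph_iff {x y : H} : (x, y) ∈ D.graph ↔ ∃ h : x ∈ D.domain, D ⟨x, h⟩ = y := by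
  rw [LinearPMap.mem_graph_iff]
  constructor
  · rintro ⟨⟨z, hz⟩, rfl, h⟩
    exact ⟨hz, h⟩
  · rintro ⟨h, h'⟩
    exact ⟨⟨x, h⟩, rfl, h'⟩

theorem graph_add {x y x' y' : H} (h : (x, y) ∈ D.graph) (h' : (x', y') ∈ D.graph) :
    (x + x', y + y') ∈ D.graph := D.graph.add_mem h h'

theorem graph_sub {x y x' y' : H} (h : (x, y) ∈ D.graph) (h' : (x', y') ∈ D.graph) :
    (x - x', y - y') ∈ D.graph := D.graph.sub_mem h h'

theorem graph_smul (c : ℂ) {x y : H} (h : (x, y) ∈ D.graph) : (c • x, c • y) ∈ D.graph :=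
  D.graph.smul_mem c h

theorem graph_unique {x y y' : H} (h : (x, y) ∈ D.graph) (h' : (x, y') ∈ D.graph) : y = y' :=
  LinearPMap.mem_graph_snd_inj D h h' rfl

theorem graph_of_mem {x : H} (h : x ∈ D.domain) : (x, D ⟨x, h⟩) ∈ D.graph :=
  mk_mem_graph_iff.2 ⟨h, rfl⟩

theorem mem_domain_of_graph {x y : H} (h : (x, y) ∈ D.graph) : x ∈ D.domain :=
  (mk_mem_graph_iff.1 h).1

theorem isBoundedInverse_iff {R : H →L[ℂ] H} : IsBoundedInverse D R ↔
    (∀ x, (R x, x) ∈ D.graph) ∧ ∀ x y, (x, y) ∈ D.graph → R y = x := by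
  constructor
  · rintro ⟨h1, h2⟩
    refine ⟨fun x => mk_mem_graph_iff.2 (h1 x), fun x y h => ?_⟩
    obtain ⟨hx, rfl⟩ := mk_mem_graph_iff.1 h
    exact h2 ⟨x, hx⟩
  · rintro ⟨h1, h2⟩
    exact ⟨fun x => mk_mem_graph_iff.1 (h1 x), fun x => h2 x _ (graph_of_mem x.2)⟩

theorem isTwistedCommutator_iff {S S' C : H →L[ℂ] H} : IsTwistedCommutator D S S' C ↔
    ∀ x y, (x, y) ∈ D.graph → (S x, C x + S' y) ∈ D.graph := by
  constructor
  · intro h1 x y h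
    obtain ⟨hx, rfl⟩ := mk_mem_graph_iff.1 h
    obtain ⟨h2, h3⟩ := h1 ⟨x, hx⟩
    exact mk_mem_graph_iff.2 ⟨h2, by rw [h3, sub_add_cancel]⟩
  · intro h1 x
    obtain ⟨h2, h3⟩ := mk_mem_graph_iff.1 (h1 x _ (graph_of_mem x.2))
    exact ⟨h2, by rw [h3, add_sub_cancel_right]⟩

theorem inverse_eq {R : H →L[ℂ] H} (h : IsBoundedInverse D R) : inverse D = R := by
  have h1 : IsInvertible D := ⟨R, h⟩
  rw [inverse, dif_pos h1]
  have h2 := isBoundedInverse_iff.1 h1.choose_spec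
  ext x
  exact h2.2 _ _ ((isBoundedInverse_iff.1 h).1 x)

theorem twistedCommutator_eq (hD : Dense (D.domain : Set H)) {S S' C : H →L[ℂ] H}
    (h : IsTwistedCommutator D S S' C) : twistedCommutator D S S' = C := by
  have h1 : ∃ C, IsTwistedCommutator D S S' C := ⟨C, h⟩
  rw [twistedCommutator, dif_pos h1]
  refine ContinuousLinearMap.ext_on (s := (D.domain : Set H)) ?_ fun x hx => ?_
  · rw [Submodule.span_eq]
    exact hD
  · obtain ⟨h2, h3⟩ := h1.choose_spec ⟨x, hx⟩
    obtain ⟨h4, h5⟩ := h ⟨x, hx⟩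
    exact h3.trans h5.symm

theorem isTwistedCommutator_twistedCommutator {S S' : H →L[ℂ] H}
    (h : ∃ C, IsTwistedCommutator D S S' C) :
    IsTwistedCommutator D S S' (twistedCommutator D S S') := by
  rw [twistedCommutator, dif_pos h]
  exact h.choose_spec

/-- `R` is a bounded two-sided inverse of `D + V`, where `V` is bounded. -/
structure IsPerturbedInverse (D : H →ₗ.[ℂ] H) (V R : H →L[ℂ] H) : Prop where
  right : ∀ y, (R y, y - V (R y)) ∈ D.graph
  left : ∀ x y, (x, y) ∈ D.graph → R (y + V x) = x

theorem IsPerturbedInverse.left' {V R : H →L[ℂ] H} (h : IsPerturbedInverse D V R) {x y z : H}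
    (hxy : (x, y) ∈ D.graph) (hz : y + V x = z) : R z = x := by
  rw [← hz]
  exact h.left x y hxy

theorem isPerturbedInverse_zero_iff {R : H →L[ℂ] H} :
    IsPerturbedInverse D 0 R ↔ IsBoundedInverse D R := by
  rw [isBoundedInverse_iff]
  refine ⟨fun h => ⟨fun x => by simpa using h.right x, fun x y hxy => by simpa using h.left x y hxy⟩,
    fun h => ⟨fun x => by simpa using h.1 x, fun x y hxy => by simpa using h.2 x y hxy⟩⟩

theorem hasCompactResolvent_iff : HasCompactResolvent D ↔
    ∃ R : H →L[ℂ] H, IsCompactOperator R ∧ IsPerturbedInverse D (Complex.I • 1) R := by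
  constructor
  · rintro ⟨R, hR, h1, h2⟩
    refine ⟨R, hR, fun y => ?_, fun x y h => ?_⟩
    · obtain ⟨h, h3⟩ := h1 y
      exact mk_mem_graph_iff.2 ⟨h, eq_sub_of_add_eq h3⟩
    · obtain ⟨hx, rfl⟩ := mk_mem_graph_iff.1 h
      exact h2 ⟨x, hx⟩
  · rintro ⟨R, hR, h⟩
    refine ⟨R, hR, fun y => ?_, fun x => ?_⟩
    · obtain ⟨h1, h2⟩ := mk_mem_graph_iff.1 (h.right y)
      exact ⟨h1, add_eq_of_eq_sub h2⟩
    · exact h.left x _ (graph_of_mem x.2)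

/-- If `D + V` has a compact inverse and `D + W` is injective then `D + W` is invertible, by the
Fredholm alternative for `(W - V)(D + V)⁻¹`. -/
theorem IsPerturbedInverse.exists_of_injective {V W R : H →L[ℂ] H} (h : IsPerturbedInverse D V R)
    (hR : IsCompactOperator R) (hW : ∀ x y, (x, y) ∈ D.graph → y + W x = 0 → x = 0) :
    ∃ U : H →L[ℂ] H, IsPerturbedInverse D W (R * U) := by
  set Ξ : H →L[ℂ] H := (W - V) * R with hΞ
  have hcpt : IsCompactOperator Ξ := hR.clm_comp (W - V)
  have hmem : (-1 : ℂ) ∈ resolventSet ℂ Ξ := by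
    refine (IsCompactOperator.hasEigenvalue_or_mem_resolventSet hcpt
      (neg_ne_zero.2 one_ne_zero)).resolve_left fun hev => ?_
    obtain ⟨w, hw⟩ := hev.exists_hasEigenvector
    have h1 : W (R w) - V (R w) = -w := by simpa [hΞ] using hw.apply_eq_smul
    have h2 : R w = 0 := by
      refine hW _ _ (h.right w) ?_
      have : w - V (R w) + W (R w) = w + (W (R w) - V (R w)) := by abel
      rw [this, h1, add_neg_cancel]
    refine hw.2 ?_
    rw [h2] at h1
    simpa using h1
  have hunit : IsUnit (1 + Ξ) := by
    have := spectrum.mem_resolventSet_iff.1 hmem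
    rw [map_neg, map_one] at this
    have h2 := this.neg
    rwa [neg_sub, sub_neg_eq_add, add_comm] at h2
  obtain ⟨u, hu⟩ := hunit
  refine ⟨(↑u⁻¹ : H →L[ℂ] H), ?_⟩
  have hinv : ∀ y, (↑u⁻¹ : H →L[ℂ] H) y + (W (R ((↑u⁻¹ : H →L[ℂ] H) y)) -
      V (R ((↑u⁻¹ : H →L[ℂ] H) y))) = y := fun y => by
    have : (1 + Ξ) * (↑u⁻¹ : H →L[ℂ] H) = 1 := by rw [← hu, Units.mul_inv]
    exact DFunLike.congr_fun this y
  have hright : ∀ y, ((R * (↑u⁻¹ : H →L[ℂ] H)) y, y - W ((R * (↑u⁻¹ : H →L[ℂ] H)) y)) ∈ D.graph := by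
    intro y
    have h1 := h.right ((↑u⁻¹ : H →L[ℂ] H) y)
    rw [mul_apply_eq_comp]
    convert h1 using 2
    nth_rw 1 [← hinv y]
    abel
  refine ⟨hright, fun x y hxy => ?_⟩
  have h1 := graph_sub (hright (y + W x)) hxy
  rw [← sub_eq_zero]
  refine hW _ _ h1 ?_
  rw [map_sub]
  abel

theorem IsPerturbedInverse.dense_range {V R : H →L[ℂ] H} (h : IsPerturbedInverse D V R)
    (hD : Dense (D.domain : Set H)) : DenseRange R := by
  refine hD.mono fun x hx => ?_
  exact ⟨_, h.left x _ (graph_of_mem hx)⟩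

theorem graph_inner_eq (hD : IsSelfAdjoint D) {x y x' y' : H}
    (h : (x, y) ∈ D.graph) (h' : (x', y') ∈ D.graph) : inner ℂ y x' = inner ℂ x y' := by
  have h1 := LinearPMap.adjoint_isFormalAdjoint (T := D) hD.dense_domain
  rw [LinearPMap.isSelfAdjoint_def.1 hD] at h1
  obtain ⟨hx, rfl⟩ := mk_mem_graph_iff.1 h
  obtain ⟨hx', rfl⟩ := mk_mem_graph_iff.1 h'
  exact h1 ⟨x, hx⟩ ⟨x', hx'⟩

theorem mem_graph_of_forall_inner (hD : IsSelfAdjoint D) {z w : H}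
    (h : ∀ x y, (x, y) ∈ D.graph → inner ℂ w x = inner ℂ z y) : (z, w) ∈ D.graph := by
  have h1 : z ∈ D.adjoint.domain :=
    LinearPMap.mem_adjoint_domain_of_exists z ⟨w, fun x => h x _ (graph_of_mem x.2)⟩
  have h2 := LinearPMap.adjoint_apply_eq hD.dense_domain ⟨z, h1⟩
    (x₀ := w) fun x => h x _ (graph_of_mem x.2)
  have h3 : (z, w) ∈ D.adjoint.graph := mk_mem_graph_iff.2 ⟨h1, h2⟩
  rwa [LinearPMap.isSelfAdjoint_def.1 hD] at h3

/-- Selfadjointness in terms of the graph: `D` is symmetric, and `z` is in the domain as soon as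
`x ↦ ⟪z, Dx⟫` is represented by a vector. -/
theorem isSelfAdjoint_of_graph (hd : Dense (D.domain : Set H))
    (hs : ∀ x y x' y', (x, y) ∈ D.graph → (x', y') ∈ D.graph → inner ℂ y x' = inner ℂ x y')
    (hm : ∀ z w, (∀ x y, (x, y) ∈ D.graph → inner ℂ w x = inner ℂ z y) → z ∈ D.domain) :
    IsSelfAdjoint D := by
  rw [LinearPMap.isSelfAdjoint_def]
  have hsym : D.IsFormalAdjoint D := fun x y =>
    hs _ _ _ _ (graph_of_mem x.2) (graph_of_mem y.2)
  refine le_antisymm ?_ (LinearPMap.IsFormalAdjoint.le_adjoint hd hsym)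
  have hdom : ∀ z (h : z ∈ D.adjoint.domain), z ∈ D.domain := fun z h =>
    hm z (D.adjoint ⟨z, h⟩) fun x y hxy => by
      obtain ⟨hx, rfl⟩ := mk_mem_graph_iff.1 hxy
      exact LinearPMap.adjoint_isFormalAdjoint hd ⟨z, h⟩ ⟨x, hx⟩
  refine ⟨fun z h => hdom z h, ?_⟩
  rintro ⟨z, hz⟩ ⟨z', hz'⟩ rfl
  exact LinearPMap.adjoint_apply_eq hd ⟨z, hz⟩ fun x => hsym ⟨z, hz'⟩ x

theorem IsPerturbedInverse.isSelfAdjoint (hD : IsSelfAdjoint D) {V R : H →L[ℂ] H}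
    (hV : IsSelfAdjoint V) (h : IsPerturbedInverse D V R) : IsSelfAdjoint R := by
  rw [ContinuousLinearMap.isSelfAdjoint_iff_isSymmetric]
  intro x y
  have h1 := graph_inner_eq hD (h.right x) (h.right y)
  have h2 : inner ℂ (V (R x)) (R y) = inner ℂ (R x) (V (R y)) :=
    (ContinuousLinearMap.isSelfAdjoint_iff_isSymmetric.1 hV) (R x) (R y)
  rw [inner_sub_left, inner_sub_right, h2] at h1
  exact (sub_left_injective h1).symm

/-- Perturbations of a symmetric operator by `iV` with `V` strictly positive are injective. -/
theorem eq_zero_of_graph_add_I (hD : IsSelfAdjoint D) {S : H →L[ℂ] H} (hS : ∀ x, S x = 0 → x = 0)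
    {x y : H} (h : (x, y) ∈ D.graph)
    (hxy : y + Complex.I • ContinuousLinearMap.adjoint S (S x) = 0) : x = 0 := by
  have h1 := graph_inner_eq hD h h
  have hy : y = -(Complex.I • ContinuousLinearMap.adjoint S (S x)) := eq_neg_of_add_eq_zero_left hxy
  rw [hy, inner_neg_left, inner_neg_right, inner_smul_left, inner_smul_right,
    ContinuousLinearMap.adjoint_inner_left, ContinuousLinearMap.adjoint_inner_right,
    inner_self_eq_norm_sq_to_K, Complex.conj_I] at h1
  have h2 : 2 * Complex.I * ((‖S x‖ : ℂ) ^ 2) = 0 := by linear_combination h1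
  refine hS x (norm_eq_zero.1 ?_)
  simpa using h2

/-- The kernel of `D`, as an eigenspace of the resolvent. -/
def resolventKernel (R : H →L[ℂ] H) : Submodule ℂ H :=
  Module.End.eigenspace (R : H →ₗ[ℂ] H) (-Complex.I)

theorem mem_resolventKernel {R : H →L[ℂ] H} (h : IsPerturbedInverse D (Complex.I • 1) R) {x : H} :
    x ∈ resolventKernel R ↔ (x, 0) ∈ D.graph := by
  rw [resolventKernel, Module.End.mem_eigenspace_iff]
  constructor
  · intro hx
    have hx : R x = -Complex.I • x := hx
    have h1 := graph_smul Complex.I (h.right x)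
    rw [hx] at h1
    simpa [smul_smul] using h1
  · intro hx
    have h1 := h.left _ _ hx
    simp only [zero_add, smul_apply, one_apply_eq_self,
      map_smul] at h1
    change R x = -Complex.I • x
    nth_rw 2 [← h1]
    rw [smul_smul]
    simp

theorem finiteDimensional_resolventKernel {R : H →L[ℂ] H} (hR : IsCompactOperator R) :
    FiniteDimensional ℂ (resolventKernel R) :=
  ContinuousLinearMap.finite_dimensional_eigenspace hR _ (neg_ne_zero.2 Complex.I_ne_zero)

theorem exists_rankLE_starProjection (N : Submodule ℂ H) [FiniteDimensional ℂ N] :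
    ∃ j, RankLE N.starProjection j := by
  refine ⟨Module.finrank ℂ N, ?_⟩
  have hle : LinearMap.range (N.starProjection : H →ₗ[ℂ] H) ≤ N := by
    rintro _ ⟨x, rfl⟩
    exact Submodule.starProjection_apply_mem N x
  exact (Submodule.rank_mono hle).trans_eq (Module.finrank_eq_rank ℂ N).symm

/-- The resolvent is a multiple of the partial inverse, up to the finite rank projection onto the
kernel. -/
theorem IsPartialInverse.isSchatten_resolvent {R P : H →L[ℂ] H} {p : ℝ} (hp : 0 < p)
    (hP : IsPartialInverse D P) (hPp : IsSchatten p P)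
    (h : IsPerturbedInverse D (Complex.I • 1) R) (hR : IsCompactOperator R) : IsSchatten p R := by
  have hfin := finiteDimensional_resolventKernel hR
  set N := resolventKernel R with hN
  -- on the range of `R`, the operator `P D` is the projection onto the complement of the kernel
  have e : R = N.starProjection ∘L R + P ∘L (1 - Complex.I • R) := by
    ext y
    have h1 := h.right y
    have h2 : (N.starProjection (R y), 0) ∈ D.graph :=
      (mem_resolventKernel h).1 (Submodule.starProjection_apply_mem N _)
    have h3 := graph_sub h1 h2
    rw [sub_zero] at h3
    obtain ⟨h4, h5⟩ := mk_mem_graph_iff.1 h3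
    have h6 := hP.2.2 ⟨_, h4⟩ fun z hz => by
      have hzN : (z : H) ∈ N := (mem_resolventKernel h).2 (mk_mem_graph_iff.2 ⟨z.2, hz⟩)
      exact (Submodule.mem_orthogonal _ _).1 (Submodule.sub_starProjection_mem_orthogonal _) _ hzN
    rw [h5] at h6
    have h7 : P (y - Complex.I • R y) = R y - N.starProjection (R y) := h6
    simp only [add_apply, ContinuousLinearMap.comp_apply,
      sub_apply, one_apply_eq_self, smul_apply]
    rw [h7]
    abel
  rw [e]
  obtain ⟨j, hj⟩ := exists_rankLE_starProjection N
  exact ((IsSchatten.of_rankLE hp hj).comp_right hp R).add hp (hPp.comp_right hp _)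

/-- With `P` the projection onto the kernel of `D`, the partial inverse of `D` is
`(D + P)⁻¹ - P`. -/
theorem exists_isPartialInverse (hD : IsSelfAdjoint D) {R : H →L[ℂ] H} {p : ℝ} (hp : 0 < p)
    (h : IsPerturbedInverse D (Complex.I • 1) R) (hR : IsCompactOperator R)
    (hRp : IsSchatten p R) : ∃ P, IsPartialInverse D P ∧ IsSchatten p P := by
  have hfin := finiteDimensional_resolventKernel hR
  set N := resolventKernel R with hN
  set P := N.starProjection with hP
  have hPN : ∀ x, (P x, 0) ∈ D.graph := fun x =>
    (mem_resolventKernel h).1 (Submodule.starProjection_apply_mem N _)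
  have hPD : ∀ x y, (x, y) ∈ D.graph → P y = 0 := fun x y hxy => by
    have h1 : y ∈ Nᗮ := by
      rw [Submodule.mem_orthogonal]
      intro z hz
      have h2 := graph_inner_eq hD ((mem_resolventKernel h).1 hz) hxy
      rw [← h2, inner_zero_left]
    exact (Submodule.starProjection_apply_eq_zero_iff N).2 h1
  have hPeq : ∀ x, (x, 0) ∈ D.graph → P x = x := fun x hx =>
    Submodule.starProjection_eq_self_iff.2 ((mem_resolventKernel h).2 hx)
  have hPP : ∀ x, P (P x) = P x := fun x => hPeq _ (hPN x)
  obtain ⟨U, hU⟩ := h.exists_of_injective (W := P) hR fun x y hxy h0 => by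
    have h1 := congrArg P h0
    rw [map_add, hPD x y hxy, zero_add, hPP, map_zero] at h1
    rw [h1, add_zero] at h0
    rw [h0] at hxy
    rw [← hPeq x hxy, h1]
  have hPs : IsSelfAdjoint P := isSelfAdjoint_starProjection N
  have hGs := hU.isSelfAdjoint hD hPs
  obtain ⟨j, hj⟩ := exists_rankLE_starProjection N
  refine ⟨R * U - P, ⟨hGs.sub hPs, fun x hx => ?_, fun x hx => ?_⟩,
    (hRp.comp_right hp U).sub hp (IsSchatten.of_rankLE hp hj)⟩
  · have hx : ((x : H), 0) ∈ D.graph := mk_mem_graph_iff.2 ⟨x.2, hx⟩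
    have h1 := hU.left _ _ hx
    rw [zero_add, hPeq _ hx] at h1
    rw [sub_apply, h1, hPeq _ hx, sub_self]
  · have h0 : P x = 0 := by
      refine (Submodule.starProjection_apply_eq_zero_iff N).2 ?_
      rw [Submodule.mem_orthogonal]
      intro z hz
      obtain ⟨h1, h2⟩ := mk_mem_graph_iff.1 ((mem_resolventKernel h).1 hz)
      exact hx ⟨z, h1⟩ h2
    have h1 := hU.left _ _ (graph_of_mem x.2)
    rw [h0, add_zero] at h1
    rw [sub_apply, hPD _ _ (graph_of_mem x.2), sub_zero]
    exact h1

theorem IsPerturbedInverse.isSchatten_of_isSchatten {V W R T : H →L[ℂ] H} {p : ℝ} (hp : 0 < p)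
    (hR : IsPerturbedInverse D V R) (hT : IsPerturbedInverse D W T) (h : IsSchatten p R) :
    IsSchatten p T := by
  have e : T = R ∘L (1 + (V - W) ∘L T) := by
    ext y
    refine (hR.left' (hT.right y) ?_).symm
    change y - W (T y) + V (T y) = y + (V (T y) - W (T y))
    abel
  rw [e]
  exact h.comp_right hp _

end Graph

/-! ### The quasihomomorphism of an invertible twisted operator -/

section OddInverse

variable {A : Type u} [Ring A] [Algebra ℂ A]
  {K : Type v} [NormedAddCommGroup K] [InnerProductSpace ℂ K] [CompleteSpace K]

/-- The bounded form of an invertible odd unbounded operator `D`, twisting an even action `ρ` of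
`A` into `ρ'`: the bounded inverse `R = D⁻¹` and the twisted commutators `c(a) = Dρ(a) - ρ'(a)D`.
The relation `(ρ(a) - R c(a)) R = R ρ'(a)` expresses that `ρ(a) - R c(a) = D⁻¹ρ'(a)D`. -/
structure OddInverse (γ : K →L[ℂ] K) (ρ : A →ₙₐ[ℂ] (K →L[ℂ] K)) where
  R : K →L[ℂ] K
  ρ' : A →ₙₐ[ℂ] (K →L[ℂ] K)
  c : A → K →L[ℂ] K
  sq : γ * γ = 1
  odd : γ * R = -(R * γ)
  dense : DenseRange R
  even : ∀ a, γ * ρ a = ρ a * γ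
  even' : ∀ a, γ * ρ' a = ρ' a * γ
  rel : ∀ a, (ρ a - R * c a) * R = R * ρ' a

theorem eq_of_mul_eq_of_denseRange {R S T : K →L[ℂ] K} (hR : DenseRange R) (h : S * R = T * R) :
    S = T := by
  refine DFunLike.coe_injective (hR.equalizer S.continuous T.continuous ?_)
  ext x
  exact DFunLike.congr_fun h x

theorem commute_of_mul_odd {γ R S v m : K →L[ℂ] K} (hR : DenseRange R)
    (odd : γ * R = -(R * γ)) (odd' : γ * S = -(S * γ)) (hm : γ * m = m * γ) (h : v * R = S * m) :
    γ * v = v * γ := by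
  refine eq_of_mul_eq_of_denseRange hR ?_
  rw [mul_assoc, h, mul_assoc, odd, ← mul_assoc, odd', mul_neg, ← mul_assoc, h, neg_mul, mul_assoc,
    hm, mul_assoc]

namespace OddInverse

variable {γ : K →L[ℂ] K} {ρ : A →ₙₐ[ℂ] (K →L[ℂ] K)} (I : OddInverse γ ρ)

/-- The homomorphism `a ↦ D⁻¹ρ'(a)D`. -/
def θ (a : A) : K →L[ℂ] K := ρ a - I.R * I.c a

theorem θ_mul_R (a : A) : I.θ a * I.R = I.R * I.ρ' a := I.rel a

theorem θ_mem (a : A) : I.θ a ∈ EvenOperators γ :=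
  mem_evenOperators.2 (commute_of_mul_odd I.dense I.odd I.odd (I.even' a) (I.θ_mul_R a))

/-- The pair formed by `ρ` and `D⁻¹ρ'D`. -/
def pair : HomPair A (EvenOperators γ) where
  π₁ :=
    { toFun := fun a => ⟨ρ a, mem_evenOperators.2 (I.even a)⟩
      map_smul' := fun c a => Subtype.ext (map_smul ρ c a)
      map_zero' := Subtype.ext (map_zero ρ)
      map_add' := fun a b => Subtype.ext (map_add ρ a b)
      map_mul' := fun a b => Subtype.ext (map_mul ρ a b) }
  π₂ :=
    { toFun := fun a => ⟨I.θ a, I.θ_mem a⟩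
      map_smul' := fun c a => Subtype.ext <| eq_of_mul_eq_of_denseRange I.dense <| by
        change I.θ (c • a) * I.R = c • I.θ a * I.R
        rw [smul_mul_assoc, θ_mul_R, θ_mul_R, map_smul, mul_smul_comm]
      map_zero' := Subtype.ext <| eq_of_mul_eq_of_denseRange I.dense <| by
        change I.θ 0 * I.R = 0 * I.R
        rw [θ_mul_R, map_zero, mul_zero, zero_mul]
      map_add' := fun a b => Subtype.ext <| eq_of_mul_eq_of_denseRange I.dense <| by
        change I.θ (a + b) * I.R = (I.θ a + I.θ b) * I.R
        rw [add_mul, θ_mul_R, θ_mul_R, θ_mul_R, map_add, mul_add]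
      map_mul' := fun a b => Subtype.ext <| eq_of_mul_eq_of_denseRange I.dense <| by
        change I.θ (a * b) * I.R = I.θ a * I.θ b * I.R
        rw [mul_assoc, θ_mul_R, θ_mul_R, ← mul_assoc, θ_mul_R, map_mul, mul_assoc] }

theorem coe_δ (a : A) : ((I.pair.δ a : EvenOperators γ) : K →L[ℂ] K) = I.R * I.c a := by
  change ρ a - I.θ a = _
  rw [θ, sub_sub_cancel]

theorem coe_powWord {n : ℕ} (a : Fin n → A) : ((powWord I.pair.δ a : EvenOperators γ) :
    K →L[ℂ] K) = (List.ofFn fun j => I.R * I.c (a j)).prod := by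
  rw [powWord, wordMap_apply, ← Subalgebra.coe_val, map_list_prod, List.map_ofFn]
  congr 2
  ext1 j
  exact I.coe_δ (a j)

theorem isScale_approxNumber {T : K →L[ℂ] K} {p : ℝ} (hp : 1 ≤ p) (h : IsSchatten p T) :
    IsScale ⌈p⌉₊ (approxNumber T) where
  anti := approxNumber_antitone T
  nonneg := approxNumber_nonneg T
  summable := h.summable_pow (by linarith) (Nat.le_ceil p)

theorem ceil_ne_zero {p : ℝ} (hp : 1 ≤ p) : ⌈p⌉₊ ≠ 0 := (Nat.ceil_pos.2 (by linarith)).ne'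

theorem le_two_mul_iff {p : ℝ} (q : ℕ) : ⌈p⌉₊ ≤ 2 * q + 1 ↔ (p - 1) / 2 ≤ q := by
  rw [Nat.ceil_le]
  push_cast
  constructor <;> intro h <;> linarith

/-- The trace system of the `p`-summable situation. -/
abbrev system (γ : K →L[ℂ] K) {p : ℝ} (hp : 1 ≤ p) : TraceSystem.{u} (EvenOperators γ) :=
  operatorTraceSystem γ ⌈p⌉₊ (ceil_ne_zero hp)

theorem mem_ideal_one {p : ℝ} (hp : 1 ≤ p) {T : EvenOperators γ}
    (h : IsSchatten p (T : K →L[ℂ] K)) : T ∈ (system.{u} γ hp).ideal 1 := fun _ =>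
  ⟨approxNumber (T : K →L[ℂ] K), isScale_approxNumber hp h,
    ⟨1, zero_le_one, fun j => by simp⟩, fun ε hε => Filter.Eventually.of_forall fun _ j => by
      have : approxNumber ((T : K →L[ℂ] K) - (T : K →L[ℂ] K)) j = 0 := by
        rw [sub_self, approxNumber_of_rankLE (rankLE_zero j)]
      exact this.le.trans (mul_nonneg hε.le (pow_nonneg (approxNumber_nonneg _ _) 1))⟩

/-- The difference `R c(a)` of the two homomorphisms is dominated by the approximation numbers of
`R`, locally uniformly in `a`. -/
theorem isQuasi [TopologicalSpace A] {p : ℝ} (hp : 1 ≤ p) (hR : IsSchatten p I.R)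
    (hρ : Continuous ρ) (hc : Continuous I.c) : I.pair.IsQuasi (system γ hp) where
  fst_mem ξ₀ := ⟨_, isScale_zero (ceil_ne_zero hp),
    isControlledAt_zero_iff.2 hρ.continuousAt⟩
  snd_mem ξ₀ := ⟨_, isScale_zero (ceil_ne_zero hp),
    isControlledAt_zero_iff.2
      (hρ.sub (continuous_const.mul hc)).continuousAt⟩
  δ_mem ξ₀ := by
    refine ⟨_, isScale_approxNumber hp hR, ⟨‖I.c ξ₀‖, norm_nonneg _, fun j => ?_⟩, fun ε hε => ?_⟩
    · simp only [coe_δ, pow_one]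
      exact (approxNumber_comp_le_right I.R (I.c ξ₀) j).trans_eq (mul_comm _ _)
    · have h1 := Metric.continuousAt_iff'.1 (hc.continuousAt (x := ξ₀)) ε hε
      filter_upwards [h1] with ξ hξ j
      rw [dist_eq_norm] at hξ
      simp only [coe_δ, pow_one, ← mul_sub]
      refine (approxNumber_comp_le_right I.R (I.c ξ - I.c ξ₀) j).trans ?_
      rw [mul_comm]
      exact mul_le_mul_of_nonneg_right hξ.le (approxNumber_nonneg _ _)

theorem summable_approxNumber_prod [TopologicalSpace A] {p : ℝ} (hp : 1 ≤ p)
    (hQ : I.pair.IsQuasi (system γ hp)) {q : ℕ} (hq : (p - 1) / 2 ≤ q)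
    (a : Fin (2 * q + 1) → A) :
    Summable (approxNumber (List.ofFn fun j => I.R * I.c (a j)).prod) := by
  rw [← coe_powWord]
  obtain ⟨r, hr, ⟨C, hC, h⟩, -⟩ := hQ.powWord_mem a PUnit.unit
  exact h.summable hC hr ((le_two_mul_iff q).2 hq)

theorem isTraceClass_prod [TopologicalSpace A] {p : ℝ} (hp : 1 ≤ p)
    (hQ : I.pair.IsQuasi (system γ hp)) {q : ℕ} (hq : (p - 1) / 2 ≤ q)
    (a : Fin (2 * q + 1) → A) :
    IsTraceClass (List.ofFn fun j => I.R * I.c (a j)).prod :=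
  isTraceClass_iff.2 (I.summable_approxNumber_prod hp hQ hq a)

theorem character_eq [TopologicalSpace A] {p : ℝ} (hp : 1 ≤ p)
    (hQ : I.pair.IsQuasi (system γ hp)) {q : ℕ} (hq : (p - 1) / 2 ≤ q)
    (a : Fin (2 * q + 1) → A) : I.pair.character (system γ hp) (2 * q) a =
      supertrace γ (List.ofFn fun j => I.R * I.c (a j)).prod := by
  have h := I.summable_approxNumber_prod hp hQ hq a
  rw [← coe_powWord] at h
  rw [HomPair.character_apply, ← coe_powWord]
  exact extendedSupertrace_apply γ h

theorem hasClass_cocycle [TopologicalSpace A] {p : ℝ} (hp : 1 ≤ p)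
    (hQ : I.pair.IsQuasi (system γ hp)) {c : HP (continuousCochains A) 0}
    (hc : I.pair.HasClass (system γ hp) c) {q : ℕ} (hq : (p - 1) / 2 ≤ q)
    {f : (Fin (2 * q + 1) → A) → ℂ} (hf : ∀ a, f a =
      tauConst q * supertrace γ (List.ofFn fun j => I.R * I.c (a j)).prod) :
    IsCyclicCocycleOfClass (continuousCochains A) 0 (2 * q) f c := by
  obtain ⟨φ, h1, h2⟩ := hc q ((le_two_mul_iff q).2 hq)
  refine ⟨φ, fun a => ?_, h2⟩
  rw [h1, hf, ← I.character_eq hp hQ hq a]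
  rfl

/-- If `D₁ = m D₀ + W` with `m` invertible and `W` bounded, and `ρ₁' = m ρ₀' m⁻¹`, then the
characters of the two pairs have the same class: `D₁⁻¹ρ₁'D₁` is conjugate to `D₀⁻¹ρ₀'D₀` under
`v = D₁⁻¹ m D₀`, which is `1 - D₁⁻¹W`. -/
theorem hasClass_of_similar [TopologicalSpace A] {p : ℝ} (hp : 1 ≤ p) (I₀ I₁ : OddInverse γ ρ)
    (hQ : I₀.pair.IsQuasi (system γ hp)) {c : HP (continuousCochains A) 0}
    (hc : I₀.pair.HasClass (system γ hp) c) {m m' W : K →L[ℂ] K} (hm : m * m' = 1)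
    (hm' : m' * m = 1) (hmγ : γ * m = m * γ) (hρ : ∀ a, I₁.ρ' a = m * I₀.ρ' a * m')
    (h1 : I₀.R = I₁.R * m + I₁.R * W * I₀.R) (h2 : I₀.R * m' = I₁.R + I₀.R * m' * W * I₁.R)
    (hR : IsSchatten p I₁.R) : I₁.pair.HasClass (system γ hp) c := by
  set v : K →L[ℂ] K := 1 - I₁.R * W with hv
  set v' : K →L[ℂ] K := 1 + I₀.R * m' * W with hv'
  have e1 : v * I₀.R = I₁.R * m := by
    rw [hv, sub_mul, one_mul, sub_eq_iff_eq_add]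
    exact h1
  have e2 : v' * I₁.R = I₀.R * m' := by
    rw [hv', add_mul, one_mul]
    exact h2.symm
  have e3 : v' * v = 1 := eq_of_mul_eq_of_denseRange I₀.dense <| by
    rw [mul_assoc, e1, ← mul_assoc, e2, mul_assoc, hm', mul_one, one_mul]
  have e4 : v * v' = 1 := eq_of_mul_eq_of_denseRange I₁.dense <| by
    rw [mul_assoc, e2, ← mul_assoc, e1, mul_assoc, hm, mul_one, one_mul]
  have hmγ' : γ * m' = m' * γ := by
    calc γ * m' = m' * m * γ * m' := by rw [hm', one_mul]
      _ = m' * (γ * m) * m' := by rw [mul_assoc m', ← hmγ]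
      _ = m' * γ := by rw [mul_assoc, mul_assoc, hm, mul_one]
  have hvγ := commute_of_mul_odd I₀.dense I₀.odd I₁.odd hmγ e1
  have hvγ' := commute_of_mul_odd I₁.dense I₁.odd I₀.odd hmγ' e2
  set g : EvenOperators γ := ⟨v, mem_evenOperators.2 hvγ⟩
  set g' : EvenOperators γ := ⟨v', mem_evenOperators.2 hvγ'⟩
  have hg : g' * g = 1 := Subtype.ext e3
  have hg' : g * g' = 1 := Subtype.ext e4
  have hg1 : g - 1 ∈ (system γ hp).ideal 1 := by
    refine mem_ideal_one hp ?_
    have : v - 1 = -(I₁.R ∘L W) := by rw [hv]; exact sub_sub_cancel_left _ _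
    change IsSchatten p (v - 1)
    rw [this]
    exact (hR.comp_right (by linarith) W).neg
  have hpair : I₁.pair = I₀.pair.conj g g' hg := by
    unfold HomPair.conj pair
    simp only [HomPair.mk.injEq, true_and]
    ext1 a
    refine Subtype.ext ?_
    change I₁.θ a = v * I₀.θ a * v'
    refine eq_of_mul_eq_of_denseRange I₁.dense ?_
    rw [θ_mul_R, hρ, mul_assoc (v * _), e2, mul_assoc v, ← mul_assoc _ I₀.R, θ_mul_R, mul_assoc I₀.R,
      ← mul_assoc v, e1]
    simp only [mul_assoc]
  rw [hpair]
  exact hQ.hasClass_conj hc hg hg' hg1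

end OddInverse

end OddInverse

/-! ### Block operators and the invertible double -/

section Block

variable {H : Type v} [NormedAddCommGroup H] [InnerProductSpace ℂ H] [CompleteSpace H]

/-- The first coordinate of `H ⊕ H`. -/
def fstL (H : Type v) [NormedAddCommGroup H] [InnerProductSpace ℂ H] : Double H →L[ℂ] H :=
  ContinuousLinearMap.fst ℂ H H ∘L (WithLp.prodContinuousLinearEquiv 2 ℂ H H : Double H →L[ℂ] H × H)

/-- The second coordinate of `H ⊕ H`. -/
def sndL (H : Type v) [NormedAddCommGroup H] [InnerProductSpace ℂ H] : Double H →L[ℂ] H :=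
  ContinuousLinearMap.snd ℂ H H ∘L (WithLp.prodContinuousLinearEquiv 2 ℂ H H : Double H →L[ℂ] H × H)

/-- The first inclusion of `H` into `H ⊕ H`. -/
def inlL (H : Type v) [NormedAddCommGroup H] [InnerProductSpace ℂ H] : H →L[ℂ] Double H :=
  ((WithLp.prodContinuousLinearEquiv 2 ℂ H H).symm : H × H →L[ℂ] Double H) ∘L
    ContinuousLinearMap.inl ℂ H H

/-- The second inclusion of `H` into `H ⊕ H`. -/
def inrL (H : Type v) [NormedAddCommGroup H] [InnerProductSpace ℂ H] : H →L[ℂ] Double H :=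
  ((WithLp.prodContinuousLinearEquiv 2 ℂ H H).symm : H × H →L[ℂ] Double H) ∘L
    ContinuousLinearMap.inr ℂ H H

/-- The block operator `(a, b; c, d)` on `H ⊕ H`. -/
def blockOp (a b c d : H →L[ℂ] H) : Double H →L[ℂ] Double H :=
  inlL H ∘L (a ∘L fstL H + b ∘L sndL H) + inrL H ∘L (c ∘L fstL H + d ∘L sndL H)

theorem double_ext {x y : Double H} (h₁ : x.fst = y.fst) (h₂ : x.snd = y.snd) : x = y :=
  WithLp.ofLp_injective 2 (Prod.ext h₁ h₂)

theorem blockOp_fst (a b c d : H →L[ℂ] H) (x : Double H) :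
    (blockOp a b c d x).fst = a x.fst + b x.snd := by
  change (a x.fst + b x.snd) + 0 = _
  rw [add_zero]

theorem blockOp_snd (a b c d : H →L[ℂ] H) (x : Double H) :
    (blockOp a b c d x).snd = c x.fst + d x.snd := by
  change 0 + (c x.fst + d x.snd) = _
  rw [zero_add]

theorem diagonal_eq_blockOp (a d : H →L[ℂ] H) : diagonal a d = blockOp a 0 0 d := by
  ext1 x
  refine double_ext ?_ ?_
  · rw [blockOp_fst]
    exact (add_zero (a x.fst)).symm
  · rw [blockOp_snd]
    exact (zero_add (d x.snd)).symm

theorem blockOp_mul (a b c d a' b' c' d' : H →L[ℂ] H) : blockOp a b c d * blockOp a' b' c' d' =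
    blockOp (a * a' + b * c') (a * b' + b * d') (c * a' + d * c') (c * b' + d * d') := by
  ext1 x
  refine double_ext ?_ ?_
  · rw [mul_apply_eq_comp, blockOp_fst, blockOp_fst, blockOp_fst, blockOp_snd]
    simp only [map_add, add_apply, mul_apply_eq_comp]
    abel
  · rw [mul_apply_eq_comp, blockOp_snd, blockOp_snd, blockOp_fst, blockOp_snd]
    simp only [map_add, add_apply, mul_apply_eq_comp]
    abel

theorem blockOp_add (a b c d a' b' c' d' : H →L[ℂ] H) : blockOp a b c d + blockOp a' b' c' d' =
    blockOp (a + a') (b + b') (c + c') (d + d') := by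
  ext1 x
  refine double_ext ?_ ?_
  · rw [add_apply, WithLp.add_fst, blockOp_fst, blockOp_fst, blockOp_fst]
    simp only [add_apply]
    abel
  · rw [add_apply, WithLp.add_snd, blockOp_snd, blockOp_snd, blockOp_snd]
    simp only [add_apply]
    abel

theorem blockOp_neg (a b c d : H →L[ℂ] H) : -blockOp a b c d = blockOp (-a) (-b) (-c) (-d) := by
  rw [neg_eq_iff_add_eq_zero, blockOp_add]
  simp [blockOp]

theorem blockOp_sub (a b c d a' b' c' d' : H →L[ℂ] H) : blockOp a b c d - blockOp a' b' c' d' =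
    blockOp (a - a') (b - b') (c - c') (d - d') := by
  simp only [sub_eq_add_neg, blockOp_neg, blockOp_add]

theorem blockOp_one : blockOp (1 : H →L[ℂ] H) 0 0 1 = 1 := by
  ext1 x
  refine double_ext ?_ ?_
  · rw [blockOp_fst]
    exact add_zero x.fst
  · rw [blockOp_snd]
    exact zero_add x.snd

theorem IsSchatten.blockOp {p : ℝ} (hp : 0 < p) {a b c d : H →L[ℂ] H} (ha : IsSchatten p a)
    (hb : IsSchatten p b) (hc : IsSchatten p c) (hd : IsSchatten p d) :
    IsSchatten p (blockOp a b c d) :=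
  (((ha.comp_right hp (fstL H)).add hp (hb.comp_right hp (sndL H))).comp_left hp (inlL H)).add hp
    (((hc.comp_right hp (fstL H)).add hp (hd.comp_right hp (sndL H))).comp_left hp (inrL H))

theorem continuous_blockOp {X : Type*} [TopologicalSpace X] {a b c d : X → H →L[ℂ] H}
    (ha : Continuous a) (hb : Continuous b) (hc : Continuous c) (hd : Continuous d) :
    Continuous fun x => blockOp (a x) (b x) (c x) (d x) := by
  unfold blockOp
  exact (continuous_const.clm_comp ((ha.clm_comp continuous_const).add
    (hb.clm_comp continuous_const))).add (continuous_const.clm_comp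
      ((hc.clm_comp continuous_const).add (hd.clm_comp continuous_const)))

theorem trace_corner {T : H →L[ℂ] H} (h : Summable (approxNumber T)) :
    trace (blockOp T 0 0 0) = trace T := by
  have e1 : blockOp T 0 0 0 = inlL H ∘L (T ∘L fstL H) := by simp [blockOp]
  have e2 : (T ∘L fstL H) ∘L inlL H = T := rfl
  rw [e1, trace_comp_comm_of_summable (summable_approxNumber_comp_right h _), e2]

theorem doubleOp_graph {D : H →ₗ.[ℂ] H} {x y : Double H} : (x, y) ∈ (doubleOp D).graph ↔
    ∃ s t, (x.fst, s) ∈ D.graph ∧ (x.snd, t) ∈ D.graph ∧ y.fst = s + x.snd ∧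
      y.snd = x.fst - t := by
  rw [mk_mem_graph_iff]
  constructor
  · rintro ⟨h, rfl⟩
    exact ⟨_, _, graph_of_mem h.1, graph_of_mem h.2, rfl, rfl⟩
  · rintro ⟨s, t, hs, ht, h1, h2⟩
    obtain ⟨hs', rfl⟩ := mk_mem_graph_iff.1 hs
    obtain ⟨ht', rfl⟩ := mk_mem_graph_iff.1 ht
    exact ⟨⟨hs', ht'⟩, double_ext h1.symm h2.symm⟩

theorem dense_doubleOp {D : H →ₗ.[ℂ] H} (hD : Dense (D.domain : Set H)) :
    Dense ((doubleOp D).domain : Set (Double H)) := by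
  have h1 : Dense ((D.domain : Set H) ×ˢ (D.domain : Set H)) := hD.prod hD
  have h2 := (WithLp.prodContinuousLinearEquiv 2 ℂ H H).symm.surjective.denseRange.dense_image
    (WithLp.prodContinuousLinearEquiv 2 ℂ H H).symm.continuous h1
  refine h2.mono ?_
  rintro _ ⟨x, hx, rfl⟩
  exact hx

/-- The inverse of the double of `D`, in terms of `R = (D + i)⁻¹` and `S = (D - i)⁻¹`: the blocks
are `D(D² + 1)⁻¹` and `(D² + 1)⁻¹`. -/
def doubleInverse (R S : H →L[ℂ] H) : Double H →L[ℂ] Double H :=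
  blockOp ((1 / 2 : ℂ) • (R + S)) ((Complex.I / 2) • (R - S)) ((Complex.I / 2) • (R - S))
    (-((1 / 2 : ℂ) • (R + S)))

/-- The resolvents give `F = D(D² + 1)⁻¹` and `Q = (D² + 1)⁻¹` without functional calculus, and
`(F, Q; Q, -F)` inverts `(D, 1; 1, -D)`. -/
theorem isBoundedInverse_doubleInverse {D : H →ₗ.[ℂ] H} {R S : H →L[ℂ] H}
    (hR : IsPerturbedInverse D (Complex.I • 1) R) (hS : IsPerturbedInverse D (-(Complex.I • 1)) S) :
    IsBoundedInverse (doubleOp D) (doubleInverse R S) := by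
  set F := (1 / 2 : ℂ) • (R + S) with hF
  set Q := (Complex.I / 2) • (R - S) with hQ
  have hFr : ∀ y, (F y, y - Q y) ∈ D.graph := fun y => by
    have h1 := graph_smul (1 / 2) (graph_add (hR.right y) (hS.right y))
    have e : y - Q y = (1 / 2 : ℂ) • (y - (Complex.I • (1 : H →L[ℂ] H)) (R y) +
        (y - (-(Complex.I • (1 : H →L[ℂ] H))) (S y))) := by
      change y - (Complex.I / 2) • (R y - S y) =
        (1 / 2 : ℂ) • (y - Complex.I • R y + (y - -(Complex.I • S y)))
      module
    rw [e]
    exact h1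
  have hQr : ∀ y, (Q y, F y) ∈ D.graph := fun y => by
    have h1 := graph_smul (Complex.I / 2) (graph_sub (hR.right y) (hS.right y))
    have e : F y = (Complex.I / 2) • (y - (Complex.I • (1 : H →L[ℂ] H)) (R y) -
        (y - (-(Complex.I • (1 : H →L[ℂ] H))) (S y))) := by
      change (1 / 2 : ℂ) • (R y + S y) =
        (Complex.I / 2) • (y - Complex.I • R y - (y - -(Complex.I • S y)))
      have e' : (Complex.I / 2) • (y - Complex.I • R y - (y - -(Complex.I • S y))) =
        (-(Complex.I * Complex.I) / 2) • (R y + S y) := by module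
      rw [e', Complex.I_mul_I, neg_neg]
    rw [e]
    exact h1
  have hFQl : ∀ x y, (x, y) ∈ D.graph → F y = x - Q x ∧ Q y = F x := fun x y h => by
    have h1 := hR.left x y h
    have h2 := hS.left x y h
    simp only [smul_apply, neg_apply,
      one_apply_eq_self, map_add, map_neg, map_smul] at h1 h2
    have h1' := eq_sub_of_add_eq h1
    have h2' := eq_sub_of_add_eq h2
    constructor
    · simp only [hF, hQ, smul_apply, add_apply,
        sub_apply]
      rw [h1', h2']
      module
    · simp only [hF, hQ, smul_apply, add_apply,
        sub_apply]
      rw [h1', h2']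
      have e : ∀ a b : H, (Complex.I / 2) • (x - Complex.I • a - (x - -(Complex.I • b))) =
          (-(Complex.I * Complex.I) / 2) • (a + b) := fun a b => by module
      rw [e, Complex.I_mul_I]
      norm_num
  rw [isBoundedInverse_iff]
  refine ⟨fun y => ?_, fun x y h => ?_⟩
  · rw [doubleOp_graph]
    refine ⟨(y.fst - Q y.fst) + F y.snd, F y.fst - (y.snd - Q y.snd), ?_, ?_, ?_, ?_⟩
    · rw [doubleInverse, blockOp_fst]
      exact graph_add (hFr _) (hQr _)
    · rw [doubleInverse, blockOp_snd, neg_apply, ← sub_eq_add_neg]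
      exact graph_sub (hQr _) (hFr _)
    · rw [doubleInverse, blockOp_snd, neg_apply]
      abel
    · rw [doubleInverse, blockOp_fst]
      abel
  · obtain ⟨s, t, hs, ht, h1, h2⟩ := doubleOp_graph.1 h
    obtain ⟨hs1, hs2⟩ := hFQl _ _ hs
    obtain ⟨ht1, ht2⟩ := hFQl _ _ ht
    refine double_ext ?_ ?_
    · rw [doubleInverse, blockOp_fst, h1, h2, map_add, map_sub, hs1, ht2]
      abel
    · rw [doubleInverse, blockOp_snd, h1, h2, neg_apply, map_add, map_sub, hs2,
        ht1]
      abel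

theorem doubleOp_isTwistedCommutator {D : H →ₗ.[ℂ] H} {S S' C : H →L[ℂ] H}
    (h : IsTwistedCommutator D S S' C) :
    IsTwistedCommutator (doubleOp D) (diagonal S 0) (diagonal S' 0) (blockOp C (-S') S 0) := by
  rw [isTwistedCommutator_iff] at h ⊢
  intro x y hxy
  obtain ⟨s, t, hs, ht, h1, h2⟩ := doubleOp_graph.1 hxy
  rw [doubleOp_graph]
  refine ⟨C x.fst + S' s, 0, ?_, ?_, ?_, ?_⟩
  · rw [diagonal_eq_blockOp, blockOp_fst]
    simpa using h _ _ hs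
  · rw [diagonal_eq_blockOp, blockOp_snd]
    simp
  · rw [diagonal_eq_blockOp, diagonal_eq_blockOp, WithLp.add_fst, blockOp_fst, blockOp_fst,
      blockOp_snd, h1]
    simp only [zero_apply, neg_apply, map_add]
    abel
  · rw [diagonal_eq_blockOp, diagonal_eq_blockOp, WithLp.add_snd, blockOp_snd, blockOp_snd,
      blockOp_fst]
    simp

end Block

/-! ### The conformal deformation -/

section Deformation

variable {A : Type u} [Ring A] [Algebra ℂ A] [StarRing A] [StarModule ℂ A]
  {H : Type v} [NormedAddCommGroup H] [InnerProductSpace ℂ H] [CompleteSpace H]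
  {X : TripleData A H} {k : Aˣ}

theorem π_mul_inv (X : TripleData A H) (k : Aˣ) : X.π k * X.π ↑k⁻¹ = 1 := by
  rw [← map_mul, Units.mul_inv, map_one]

theorem π_inv_mul (X : TripleData A H) (k : Aˣ) : X.π ↑k⁻¹ * X.π k = 1 := by
  rw [← map_mul, Units.inv_mul, map_one]

theorem π_mul_inv_apply (X : TripleData A H) (k : Aˣ) (x : H) : X.π k (X.π ↑k⁻¹ x) = x :=
  DFunLike.congr_fun (π_mul_inv X k) x

theorem π_inv_mul_apply (X : TripleData A H) (k : Aˣ) (x : H) : X.π ↑k⁻¹ (X.π k x) = x :=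
  DFunLike.congr_fun (π_inv_mul X k) x

theorem sandwich_graph {κ : H →L[ℂ] H} {D : H →ₗ.[ℂ] H} {x y : H} :
    (x, y) ∈ (sandwich κ D).graph ↔ ∃ z, (κ x, z) ∈ D.graph ∧ y = κ z := by
  rw [mk_mem_graph_iff]
  constructor
  · rintro ⟨h, rfl⟩
    exact ⟨_, graph_of_mem (D := D) (x := κ x) h, rfl⟩
  · rintro ⟨z, hz, rfl⟩
    obtain ⟨h, rfl⟩ := mk_mem_graph_iff.1 hz
    exact ⟨h, rfl⟩

theorem IsTwistedSpectralTriple.isTwistedCommutator (hX : IsTwistedSpectralTriple X) (a : A) :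
    IsTwistedCommutator X.D (X.π a) (X.π (X.σ a)) (X.commutator a) :=
  isTwistedCommutator_twistedCommutator (hX.D_commutator a)

theorem IsTwistedSpectralTriple.graph_π (hX : IsTwistedSpectralTriple X) (a : A) {x y : H}
    (h : (x, y) ∈ X.D.graph) :
    (X.π a x, X.commutator a x + X.π (X.σ a) y) ∈ X.D.graph :=
  isTwistedCommutator_iff.1 (hX.isTwistedCommutator a) x y h

theorem IsTwistedSpectralTriple.graph_γ (hX : IsTwistedSpectralTriple X) {x y : H}
    (h : (x, y) ∈ X.D.graph) : (X.γ x, -X.γ y) ∈ X.D.graph := by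
  obtain ⟨hx, rfl⟩ := mk_mem_graph_iff.1 h
  exact mk_mem_graph_iff.2 (hX.D_odd ⟨x, hx⟩)

theorem conformalTwist_apply (σ : A ≃ₐ[ℂ] A) (k : Aˣ) (a : A) :
    conformalTwist σ k a = k * σ (k * a * ↑k⁻¹) * ↑k⁻¹ := rfl

theorem conformalTwist_symm_apply (σ : A ≃ₐ[ℂ] A) (k : Aˣ) (a : A) :
    (conformalTwist σ k).symm a = ↑k⁻¹ * σ.symm (↑k⁻¹ * a * k) * k := rfl

/-- The commutator for the deformed triple is `[kDk, a]_σ̂ = k [D, kak⁻¹]_σ k`. -/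
theorem isTwistedCommutator_deformation (hX : IsTwistedSpectralTriple X) (k : Aˣ) (a : A) :
    IsTwistedCommutator (X.conformalDeformation k).D ((X.conformalDeformation k).π a)
      ((X.conformalDeformation k).π ((X.conformalDeformation k).σ a))
      (X.π k * X.commutator (k * a * ↑k⁻¹) * X.π k) := by
  rw [isTwistedCommutator_iff]
  intro x y h
  obtain ⟨z, hz, rfl⟩ := sandwich_graph.1 h
  have h1 := hX.graph_π (k * a * ↑k⁻¹) hz
  refine sandwich_graph.2
    ⟨X.commutator (k * a * ↑k⁻¹) (X.π k x) + X.π (X.σ (k * a * ↑k⁻¹)) z, ?_, ?_⟩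
  · convert h1 using 2
    change X.π k (X.π a x) = _
    rw [map_mul, map_mul, mul_apply_eq_comp, mul_apply_eq_comp,
      π_inv_mul_apply]
  · change _ + X.π (k * X.σ (k * a * ↑k⁻¹) * ↑k⁻¹) (X.π k z) = _
    have e : X.π (k * X.σ (k * a * ↑k⁻¹) * ↑k⁻¹) (X.π k z) =
        X.π k (X.π (X.σ (k * a * ↑k⁻¹)) z) := by
      rw [map_mul, map_mul, mul_apply_eq_comp, mul_apply_eq_comp,
        π_inv_mul_apply]
    rw [e, map_add]
    rfl

theorem dense_deformation (hX : IsTwistedSpectralTriple X) (k : Aˣ) :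
    Dense ((X.conformalDeformation k).D.domain : Set H) := by
  refine hX.D_dense.mono fun x hx => ?_
  exact mem_domain_of_graph (D := X.D) (hX.graph_π k (graph_of_mem hx))

theorem commutator_deformation (hX : IsTwistedSpectralTriple X) (k : Aˣ) (a : A) :
    (X.conformalDeformation k).commutator a = X.π k * X.commutator (k * a * ↑k⁻¹) * X.π k :=
  twistedCommutator_eq (dense_deformation hX k) (isTwistedCommutator_deformation hX k a)

theorem IsPositiveElement.isSelfAdjoint_π (hk : IsPositiveElement X k) : IsSelfAdjoint (X.π k) :=
  hk.1.map X.π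

theorem IsPositiveElement.star_inv (hk : IsPositiveElement X k) :
    star (↑k⁻¹ : A) = (↑k⁻¹ : A) := by
  have h1 : star k = k := Units.ext hk.1
  rw [← Units.coe_star_inv, h1]

theorem IsPositiveElement.inner_π (hk : IsPositiveElement X k) (x y : H) :
    inner ℂ (X.π k x) y = inner ℂ x (X.π k y) :=
  (ContinuousLinearMap.isSelfAdjoint_iff_isSymmetric.1 hk.isSelfAdjoint_π) x y

theorem IsPositiveElement.inner_π_inv (hk : IsPositiveElement X k) (x y : H) :
    inner ℂ (X.π ↑k⁻¹ x) y = inner ℂ x (X.π ↑k⁻¹ y) := by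
  have : IsSelfAdjoint (X.π ↑k⁻¹) := IsSelfAdjoint.map (x := (↑k⁻¹ : A)) hk.star_inv X.π
  exact (ContinuousLinearMap.isSelfAdjoint_iff_isSymmetric.1 this) x y

theorem isSelfAdjoint_deformation (hX : IsTwistedSpectralTriple X) (hk : IsPositiveElement X k) :
    IsSelfAdjoint (X.conformalDeformation k).D := by
  refine isSelfAdjoint_of_graph (dense_deformation hX k) ?_ ?_
  · intro x y x' y' h h'
    obtain ⟨z, hz, rfl⟩ := sandwich_graph.1 h
    obtain ⟨z', hz', rfl⟩ := sandwich_graph.1 h'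
    rw [hk.inner_π, ← hk.inner_π x]
    exact graph_inner_eq hX.D_selfAdjoint hz hz'
  · intro z w h
    have h1 : (X.π k z, X.π ↑k⁻¹ w) ∈ X.D.graph := by
      refine mem_graph_of_forall_inner hX.D_selfAdjoint fun x y hxy => ?_
      have h2 : (X.π ↑k⁻¹ x, X.π k y) ∈ (X.conformalDeformation k).D.graph :=
        sandwich_graph.2 ⟨y, by rwa [π_mul_inv_apply], rfl⟩
      rw [hk.inner_π, hk.inner_π_inv]
      exact h _ _ h2
    exact mem_domain_of_graph (D := X.D) h1

/-- The operator `kDk + i = k(D + ik⁻²)k` is invertible, by the Fredholm alternative for `D + ik⁻²`. -/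
theorem exists_resolvent_deformation (hX : IsTwistedSpectralTriple X) (hk : IsPositiveElement X k)
    {R : H →L[ℂ] H} (hR : IsPerturbedInverse X.D (Complex.I • 1) R) (hc : IsCompactOperator R) :
    ∃ U, IsPerturbedInverse (X.conformalDeformation k).D (Complex.I • 1)
      (X.π ↑k⁻¹ * (R * U) * X.π ↑k⁻¹) := by
  -- `kDk + i = k (D + i k⁻²) k`
  have hadj : ContinuousLinearMap.adjoint (X.π ↑k⁻¹) = X.π ↑k⁻¹ := by
    rw [← ContinuousLinearMap.star_eq_adjoint, ← map_star, hk.star_inv]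
  obtain ⟨U, hU⟩ := hR.exists_of_injective (W := Complex.I • (X.π ↑k⁻¹ * X.π ↑k⁻¹)) hc
    fun x y hxy h => eq_zero_of_graph_add_I hX.D_selfAdjoint (S := X.π ↑k⁻¹)
      (fun x hx => by rw [← π_mul_inv_apply X k x, hx, map_zero]) hxy (by
        rw [hadj]
        exact h)
  refine ⟨U, ⟨fun y => ?_, fun x y h => ?_⟩⟩
  · refine sandwich_graph.2
      ⟨X.π ↑k⁻¹ y - Complex.I • X.π ↑k⁻¹ (X.π ↑k⁻¹ ((R * U) (X.π ↑k⁻¹ y))), ?_, ?_⟩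
    · have h1 := hU.right (X.π ↑k⁻¹ y)
      convert h1 using 2
      · exact π_mul_inv_apply X k _
      · rfl
    · rw [map_sub, map_smul, π_mul_inv_apply, π_mul_inv_apply]
      rfl
  · obtain ⟨z, hz, rfl⟩ := sandwich_graph.1 h
    have h1 := hU.left _ _ hz
    have h2 : X.π ↑k⁻¹ (X.π k z + Complex.I • x) =
        z + (Complex.I • (X.π ↑k⁻¹ * X.π ↑k⁻¹)) (X.π k x) := by
      rw [map_add, map_smul, π_inv_mul_apply, smul_apply,
        mul_apply_eq_comp, π_inv_mul_apply]
    change X.π ↑k⁻¹ ((R * U) (X.π ↑k⁻¹ (X.π k z + Complex.I • x))) = x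
    rw [h2, h1, π_inv_mul_apply]

theorem isTwistedSpectralTriple_deformation (hX : IsTwistedSpectralTriple X)
    (hk : IsPositiveElement X k) : IsTwistedSpectralTriple (X.conformalDeformation k) where
  γ_mul_self := hX.γ_mul_self
  γ_selfAdjoint := hX.γ_selfAdjoint
  π_even := hX.π_even
  σ_star a := by
    have hk1 : star (k : A) = k := hk.1
    change star (conformalTwist X.σ k a) = (conformalTwist X.σ k).symm (star a)
    rw [conformalTwist_apply, conformalTwist_symm_apply, star_mul, star_mul, hX.σ_star, star_mul,
      star_mul, hk1, hk.star_inv, mul_assoc, mul_assoc]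
  D_dense := dense_deformation hX k
  D_selfAdjoint := isSelfAdjoint_deformation hX hk
  D_odd x := by
    have h1 := graph_of_mem x.2
    obtain ⟨z, hz, h2⟩ := sandwich_graph.1 h1
    have hkγ : ∀ x, X.π k (X.γ x) = X.γ (X.π k x) := fun x =>
      DFunLike.congr_fun (hX.π_even k) x
    refine mk_mem_graph_iff.1 (sandwich_graph.2 ⟨-X.γ z, ?_, ?_⟩)
    · have := hX.graph_γ hz
      rw [← hkγ] at this
      exact this
    · rw [map_neg, hkγ, ← h2]
      rfl
  D_compactResolvent := by
    obtain ⟨R, hc, hR⟩ := hasCompactResolvent_iff.1 hX.D_compactResolvent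
    obtain ⟨U, hU⟩ := exists_resolvent_deformation hX hk hR hc
    refine hasCompactResolvent_iff.2 ⟨_, ?_, hU⟩
    exact ((hc.comp_clm U).clm_comp (X.π ↑k⁻¹)).comp_clm (X.π ↑k⁻¹)
  D_commutator a := ⟨_, isTwistedCommutator_deformation hX k a⟩

theorem exists_schatten_resolvent (hX : IsTwistedSpectralTriple X) {p : ℝ} (hp : 1 ≤ p)
    (hXp : IsSummable X.D p) : ∃ R : H →L[ℂ] H, IsCompactOperator R ∧
      IsPerturbedInverse X.D (Complex.I • 1) R ∧ IsSchatten p R := by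
  have hp0 : 0 < p := by linarith
  obtain ⟨R, hc, hR⟩ := hasCompactResolvent_iff.1 hX.D_compactResolvent
  obtain ⟨P, hP, hPp⟩ := hXp
  exact ⟨R, hc, hR, hP.isSchatten_resolvent hp0 ((isTraceClass_cfc_rpow_iff hP.1 hp0).1 hPp) hR hc⟩

theorem isSummable_deformation (hX : IsTwistedSpectralTriple X) (hk : IsPositiveElement X k)
    {p : ℝ} (hp : 1 ≤ p) (hXp : IsSummable X.D p) :
    IsSummable (X.conformalDeformation k).D p := by
  have hp0 : 0 < p := by linarith
  obtain ⟨R, hc, hR, hRp⟩ := exists_schatten_resolvent hX hp hXp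
  obtain ⟨U, hU⟩ := exists_resolvent_deformation hX hk hR hc
  obtain ⟨P, hP, hPp⟩ := exists_isPartialInverse (isSelfAdjoint_deformation hX hk) hp0 hU
    (((hc.comp_clm U).clm_comp (X.π ↑k⁻¹)).comp_clm (X.π ↑k⁻¹))
    (((hRp.comp_right hp0 U).comp_left hp0 (X.π ↑k⁻¹)).comp_right hp0 (X.π ↑k⁻¹))
  exact ⟨P, hP, (isTraceClass_cfc_rpow_iff hP.1 hp0).2 hPp⟩

theorem isSmooth_deformation [TopologicalSpace A] [IsTopologicalRing A]
    (hX : IsTwistedSpectralTriple X) (hs : IsSmooth X) (k : Aˣ) :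
    IsSmooth (X.conformalDeformation k) where
  π_continuous := hs.π_continuous
  commutator_continuous := by
    simp only [commutator_deformation hX]
    exact (continuous_const.mul (hs.commutator_continuous.comp
      ((continuous_const.mul continuous_id).mul continuous_const))).mul continuous_const
  σ_continuous := (continuous_const.mul (hs.σ_continuous.comp
    ((continuous_const.mul continuous_id).mul continuous_const))).mul continuous_const
  σ_symm_continuous := (continuous_const.mul (hs.σ_symm_continuous.comp
    ((continuous_const.mul continuous_id).mul continuous_const))).mul continuous_const

end Deformation

/-! ### The Connes-Chern character -/

section Comparison

variable {K : Type v} [NormedAddCommGroup K] [InnerProductSpace ℂ K] [CompleteSpace K]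
  {D : K →ₗ.[ℂ] K}

theorem IsBoundedInverse.sub_mul_mul {R S S' C : K →L[ℂ] K} (hR : IsBoundedInverse D R)
    (h : IsTwistedCommutator D S S' C) : (S - R * C) * R = R * S' := by
  rw [isBoundedInverse_iff] at hR
  rw [isTwistedCommutator_iff] at h
  ext y
  have h1 := hR.2 _ _ (h _ _ (hR.1 y))
  rw [map_add] at h1
  change S (R y) - R (C (R y)) = R (S' y)
  rw [← h1]
  abel

theorem IsBoundedInverse.odd {R γ : K →L[ℂ] K} (hR : IsBoundedInverse D R)
    (h : ∀ x y, (x, y) ∈ D.graph → (γ x, -γ y) ∈ D.graph) : γ * R = -(R * γ) := by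
  rw [isBoundedInverse_iff] at hR
  ext y
  have h1 := hR.2 _ _ (h _ _ (hR.1 y))
  rw [map_neg] at h1
  exact h1.symm

theorem IsBoundedInverse.denseRange {R : K →L[ℂ] K} (hR : IsBoundedInverse D R)
    (hD : Dense (D.domain : Set K)) : DenseRange R :=
  (isPerturbedInverse_zero_iff.2 hR).dense_range hD

/-- The relations between the inverses of `D₀` and of `D₁ = m D₀ + W`. -/
theorem IsBoundedInverse.similar {D₁ : K →ₗ.[ℂ] K} {R R₁ m m' W : K →L[ℂ] K}
    (hR : IsBoundedInverse D R) (hR₁ : IsBoundedInverse D₁ R₁) (hm' : m' * m = 1)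
    (h : ∀ x y, (x, y) ∈ D.graph → (x, m y + W x) ∈ D₁.graph)
    (hdom : ∀ x y, (x, y) ∈ D₁.graph → x ∈ D.domain) :
    R = R₁ * m + R₁ * W * R ∧ R * m' = R₁ + R * m' * W * R₁ := by
  rw [isBoundedInverse_iff] at hR hR₁
  constructor
  · ext y
    have h1 := hR₁.2 _ _ (h _ _ (hR.1 y))
    rw [map_add] at h1
    exact h1.symm
  · ext y
    have h1 := graph_of_mem (hdom _ _ (hR₁.1 y))
    set z := D ⟨R₁ y, hdom _ _ (hR₁.1 y)⟩
    have h2 := graph_unique (hR₁.1 y) (h _ _ h1)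
    have h3 : m' y = z + m' (W (R₁ y)) := by
      have h4 : m' (m z) = z := DFunLike.congr_fun hm' z
      nth_rw 1 [h2]
      rw [map_add, h4]
    change R (m' y) = R₁ y + R (m' (W (R₁ y)))
    rw [h3, map_add, hR.2 _ _ h1]

theorem eq_mul_one_add_mul_neg_mul {S : Type*} [Ring S] {t b r : S} (h : t = r + t * b * r) :
    r = t * 1 + t * -b * r := by
  rw [mul_one, mul_neg, neg_mul, ← sub_eq_add_neg, eq_sub_iff_add_eq]
  exact h.symm

theorem mul_one_eq_add_mul_neg_mul {S : Type*} [Ring S] {t b r : S} (h : t = r + r * b * t) :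
    r * 1 = t + r * 1 * -b * t := by
  rw [mul_one, mul_neg, neg_mul, ← sub_eq_add_neg, eq_sub_iff_add_eq]
  exact h.symm

/-- The relations between the inverses of the invertible double of `D` and of `diag(D, -D)`. -/
theorem IsBoundedInverse.similar_double {T : K →L[ℂ] K} {R : Double K →L[ℂ] Double K}
    (hT : IsBoundedInverse D T) (hR : IsBoundedInverse (doubleOp D) R) :
    blockOp T 0 0 (-T) = R + blockOp T 0 0 (-T) * blockOp 0 1 1 0 * R ∧
      blockOp T 0 0 (-T) = R + R * blockOp 0 1 1 0 * blockOp T 0 0 (-T) := by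
  rw [isBoundedInverse_iff] at hT hR
  constructor
  · ext1 y
    obtain ⟨s, t, hs, ht, h1, h2⟩ := doubleOp_graph.1 (hR.1 y)
    have hs' := hT.2 _ _ hs
    have ht' := hT.2 _ _ ht
    refine double_ext ?_ ?_
    · change _ = (R y).fst + (blockOp T 0 0 (-T) (blockOp 0 1 1 0 (R y))).fst
      rw [blockOp_fst, blockOp_fst, blockOp_fst, h1, map_add, hs']
      simp
    · change _ = (R y).snd + (blockOp T 0 0 (-T) (blockOp 0 1 1 0 (R y))).snd
      rw [blockOp_snd, blockOp_snd, blockOp_snd, h2, map_sub]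
      simp [ht', add_comm]
  · ext1 y
    have h1 : (blockOp T 0 0 (-T) y, y + blockOp 0 1 1 0 (blockOp T 0 0 (-T) y)) ∈
        (doubleOp D).graph := by
      refine doubleOp_graph.2 ⟨y.fst, -y.snd, ?_, ?_, ?_, ?_⟩
      · rw [blockOp_fst]
        simpa using hT.1 y.fst
      · rw [blockOp_snd]
        have := graph_smul (-1) (hT.1 y.snd)
        simpa using this
      · rw [WithLp.add_fst, blockOp_fst]
        simp
      · rw [WithLp.add_snd, blockOp_snd]
        simp [add_comm]
    have h2 := hR.2 _ _ h1
    rw [map_add] at h2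
    exact h2.symm

theorem doubleOp_odd {γ : K →L[ℂ] K} (h : ∀ x y, (x, y) ∈ D.graph → (γ x, -γ y) ∈ D.graph) :
    ∀ x y, (x, y) ∈ (doubleOp D).graph →
      (diagonal γ (-γ) x, -diagonal γ (-γ) y) ∈ (doubleOp D).graph := by
  intro x y hxy
  obtain ⟨s, t, hs, ht, h1, h2⟩ := doubleOp_graph.1 hxy
  rw [diagonal_eq_blockOp]
  refine doubleOp_graph.2 ⟨-γ s, γ t, ?_, ?_, ?_, ?_⟩
  · rw [blockOp_fst]
    simpa using h _ _ hs
  · rw [blockOp_snd]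
    have := graph_smul (-1) (h _ _ ht)
    simpa using this
  · rw [WithLp.neg_fst, blockOp_fst, blockOp_snd, h1]
    simp only [map_add, zero_apply, neg_apply]
    abel
  · rw [WithLp.neg_snd, blockOp_snd, blockOp_fst, h2]
    simp

theorem prod_blockOp_corner {n : ℕ} (x : Fin (n + 1) → K →L[ℂ] K) :
    (List.ofFn fun j => blockOp (x j) 0 0 0).prod = blockOp (List.ofFn x).prod 0 0 0 := by
  induction n with
  | zero => simp [List.ofFn_succ]
  | succ n ih =>
    rw [List.ofFn_succ, List.prod_cons, ih, List.ofFn_succ (f := x), List.prod_cons, blockOp_mul]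
    simp

end Comparison

section Character

variable {A : Type u} [Ring A] [Algebra ℂ A]
  {H : Type v} [NormedAddCommGroup H] [InnerProductSpace ℂ H] [CompleteSpace H]

/-- The nonunital action `a ↦ diag(φ(a), 0)` on `H ⊕ H`. -/
def cornerHom (φ : A →ₙₐ[ℂ] (H →L[ℂ] H)) : A →ₙₐ[ℂ] (Double H →L[ℂ] Double H) where
  toFun a := diagonal (φ a) 0
  map_smul' c a := by
    ext1 x
    refine double_ext ?_ ?_ <;> simp [diagonal_eq_blockOp, blockOp_fst, blockOp_snd]
  map_zero' := by simp [diagonal_eq_blockOp, blockOp]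
  map_add' a b := by simp [diagonal_eq_blockOp, blockOp_add]
  map_mul' a b := by simp [diagonal_eq_blockOp, blockOp_mul]

theorem cornerHom_apply (φ : A →ₙₐ[ℂ] (H →L[ℂ] H)) (a : A) :
    cornerHom φ a = diagonal (φ a) 0 := rfl

theorem cornerHom_even {φ : A →ₙₐ[ℂ] (H →L[ℂ] H)} {γ : H →L[ℂ] H} (h : ∀ a, γ * φ a = φ a * γ)
    (a : A) : diagonal γ (-γ) * cornerHom φ a = cornerHom φ a * diagonal γ (-γ) := by
  simp [cornerHom_apply, diagonal_eq_blockOp, blockOp_mul, h]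

theorem diagonal_neg_sq {γ : H →L[ℂ] H} (h : γ * γ = 1) :
    diagonal γ (-γ) * diagonal γ (-γ) = 1 := by
  simp [diagonal_eq_blockOp, blockOp_mul, h, blockOp_one]

variable [StarRing A] [StarModule ℂ A] {X : TripleData A H}

/-- The action of `A`. -/
def TripleData.action (X : TripleData A H) : A →ₙₐ[ℂ] (H →L[ℂ] H) where
  toFun a := X.π a
  map_smul' c a := map_smul X.π c a
  map_zero' := map_zero X.π
  map_add' := map_add X.π
  map_mul' := map_mul X.π

/-- The action `a ↦ σ(a)` of `A`. -/
def TripleData.twistedAction (X : TripleData A H) : A →ₙₐ[ℂ] (H →L[ℂ] H) where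
  toFun a := X.π (X.σ a)
  map_smul' c a := by simp
  map_zero' := by simp
  map_add' := by simp
  map_mul' := by simp

theorem IsTwistedSpectralTriple.action_even (hX : IsTwistedSpectralTriple X) (a : A) :
    X.γ * X.action a = X.action a * X.γ := (hX.π_even a).symm

theorem IsTwistedSpectralTriple.twistedAction_even (hX : IsTwistedSpectralTriple X) (a : A) :
    X.γ * X.twistedAction a = X.twistedAction a * X.γ := (hX.π_even (X.σ a)).symm

/-- The inverse of the double of `D`, in terms of `R = (D + i)⁻¹`; here `(D - i)⁻¹ = -γRγ`. -/
def TripleData.doubleInv (X : TripleData A H) (R : H →L[ℂ] H) : Double H →L[ℂ] Double H :=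
  doubleInverse R (-(X.γ * R * X.γ))

theorem isBoundedInverse_doubleInv (hX : IsTwistedSpectralTriple X) {R : H →L[ℂ] H}
    (hR : IsPerturbedInverse X.D (Complex.I • 1) R) :
    IsBoundedInverse (doubleOp X.D) (X.doubleInv R) := by
  have hγ : ∀ x, X.γ (X.γ x) = x := fun x => DFunLike.congr_fun hX.γ_mul_self x
  refine isBoundedInverse_doubleInverse hR ⟨fun y => ?_, fun x y h => ?_⟩
  · have h1 := graph_smul (-1) (hX.graph_γ (hR.right (X.γ y)))
    have e : y - (-(Complex.I • (1 : H →L[ℂ] H))) ((-(X.γ * R * X.γ)) y) =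
        (-1 : ℂ) • -X.γ (X.γ y - (Complex.I • (1 : H →L[ℂ] H)) (R (X.γ y))) := by
      change y - -(Complex.I • -(X.γ (R (X.γ y)))) =
        (-1 : ℂ) • -X.γ (X.γ y - Complex.I • R (X.γ y))
      rw [map_sub, hγ, map_smul]
      module
    have e2 : (-(X.γ * R * X.γ)) y = (-1 : ℂ) • X.γ (R (X.γ y)) := by
      rw [neg_one_smul]
      rfl
    rw [e, e2]
    exact h1
  · have h1 := hR.left' (z := -X.γ (y + (-(Complex.I • (1 : H →L[ℂ] H))) x)) (hX.graph_γ h) (by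
      change -X.γ y + Complex.I • X.γ x = -X.γ (y + -(Complex.I • x))
      rw [map_add, map_neg, map_smul]
      abel)
    change -(X.γ (R (X.γ _))) = x
    rw [map_neg] at h1
    rw [← map_neg, h1, hγ]

/-- The bounded form of the invertible double of a twisted spectral triple. -/
def IsTwistedSpectralTriple.double (hX : IsTwistedSpectralTriple X) {R : H →L[ℂ] H}
    (hR : IsPerturbedInverse X.D (Complex.I • 1) R) :
    OddInverse (diagonal X.γ (-X.γ)) (cornerHom X.action) where
  R := X.doubleInv R
  ρ' := cornerHom X.twistedAction
  c a := blockOp (X.commutator a) (-X.π (X.σ a)) (X.π a) 0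
  sq := diagonal_neg_sq hX.γ_mul_self
  odd := (isBoundedInverse_doubleInv hX hR).odd (doubleOp_odd fun _ _ => hX.graph_γ)
  dense := (isBoundedInverse_doubleInv hX hR).denseRange (dense_doubleOp hX.D_dense)
  even := cornerHom_even hX.action_even
  even' := cornerHom_even hX.twistedAction_even
  rel a := (isBoundedInverse_doubleInv hX hR).sub_mul_mul
    (doubleOp_isTwistedCommutator (hX.isTwistedCommutator a))

/-- For invertible `D`, the bounded form of `diag(D, -D)`, with the action `a ↦ diag(a, 0)`. -/
def IsTwistedSpectralTriple.corner (hX : IsTwistedSpectralTriple X) {T : H →L[ℂ] H}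
    (hT : IsBoundedInverse X.D T) :
    OddInverse (diagonal X.γ (-X.γ)) (cornerHom X.action) where
  R := blockOp T 0 0 (-T)
  ρ' := cornerHom X.twistedAction
  c a := blockOp (X.commutator a) 0 0 0
  sq := diagonal_neg_sq hX.γ_mul_self
  odd := by
    have h := hT.odd (γ := X.γ) fun _ _ => hX.graph_γ
    rw [diagonal_eq_blockOp, blockOp_mul, blockOp_mul, blockOp_neg]
    simp [h]
  dense := by
    have h1 := hT.denseRange hX.D_dense
    have h2 : Dense (Set.range T ×ˢ Set.range T) := Dense.prod h1 h1
    have h3 := (WithLp.prodContinuousLinearEquiv 2 ℂ H H).symm.surjective.denseRange.dense_image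
      (WithLp.prodContinuousLinearEquiv 2 ℂ H H).symm.continuous h2
    refine h3.mono ?_
    rintro _ ⟨⟨_, _⟩, ⟨⟨x, rfl⟩, ⟨y, rfl⟩⟩, rfl⟩
    refine ⟨WithLp.toLp 2 (x, -y), double_ext ?_ ?_⟩
    · rw [blockOp_fst]
      exact add_zero _
    · rw [blockOp_snd]
      change 0 + -(T (-y)) = T y
      rw [map_neg, neg_neg, zero_add]
  even := cornerHom_even hX.action_even
  even' := cornerHom_even hX.twistedAction_even
  rel a := by
    have h := hT.sub_mul_mul (hX.isTwistedCommutator a)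
    have h' : (X.action a - T * X.commutator a) * T = T * X.twistedAction a := h
    rw [cornerHom_apply, cornerHom_apply, diagonal_eq_blockOp, diagonal_eq_blockOp, blockOp_mul,
      blockOp_sub, blockOp_mul, blockOp_mul]
    simp [h']

theorem IsSchatten.doubleInv {p : ℝ} (hp : 0 < p) {R : H →L[ℂ] H} (h : IsSchatten p R) :
    IsSchatten p (X.doubleInv R) := by
  have h1 : IsSchatten p (-(X.γ * R * X.γ)) :=
    ((h.comp_left hp X.γ).comp_right hp X.γ).neg
  have h2 := (h.add hp h1).smul hp (1 / 2)
  have h3 := (h.sub hp h1).smul hp (Complex.I / 2)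
  exact IsSchatten.blockOp hp h2 h3 h3 h2.neg

variable [TopologicalSpace A]

theorem continuous_cornerHom {φ : A →ₙₐ[ℂ] (H →L[ℂ] H)} (h : Continuous φ) :
    Continuous (cornerHom φ) := by
  have : (cornerHom φ : A → Double H →L[ℂ] Double H) = fun a => blockOp (φ a) 0 0 0 :=
    funext fun a => by rw [cornerHom_apply, diagonal_eq_blockOp]
  rw [this]
  exact continuous_blockOp h continuous_const continuous_const continuous_const

theorem IsSmooth.isQuasi_double (hs : IsSmooth X) (hX : IsTwistedSpectralTriple X) {R : H →L[ℂ] H}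
    (hR : IsPerturbedInverse X.D (Complex.I • 1) R) {p : ℝ} (hp : 1 ≤ p) (hRp : IsSchatten p R) :
    (hX.double hR).pair.IsQuasi (OddInverse.system _ hp) :=
  (hX.double hR).isQuasi hp (hRp.doubleInv (by linarith))
    (continuous_cornerHom (φ := X.action) hs.π_continuous)
    (continuous_blockOp hs.commutator_continuous (hs.π_continuous.comp hs.σ_continuous).neg
      hs.π_continuous continuous_const)

theorem IsSmooth.isQuasi_corner (hs : IsSmooth X) (hX : IsTwistedSpectralTriple X) {T : H →L[ℂ] H}
    (hT : IsBoundedInverse X.D T) {p : ℝ} (hp : 1 ≤ p) (hTp : IsSchatten p T) :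
    (hX.corner hT).pair.IsQuasi (OddInverse.system _ hp) := by
  have hp0 : 0 < p := by linarith
  have h0 : IsSchatten p (0 : H →L[ℂ] H) := IsSchatten.of_rankLE hp0 (rankLE_zero 0)
  exact (hX.corner hT).isQuasi hp (IsSchatten.blockOp hp0 hTp h0 h0 hTp.neg)
    (continuous_cornerHom (φ := X.action) hs.π_continuous)
    (continuous_blockOp hs.commutator_continuous continuous_const continuous_const
      continuous_const)

/-- The class of the quasihomomorphism of the invertible double is the Connes-Chern character. -/
theorem isConnesChernCharacter_of_hasClass (hs : IsSmooth X) (hX : IsTwistedSpectralTriple X)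
    {R : H →L[ℂ] H} (hR : IsPerturbedInverse X.D (Complex.I • 1) R) {p : ℝ} (hp : 1 ≤ p)
    (hRp : IsSchatten p R) {c : HP (continuousCochains A) 0}
    (hc : (hX.double hR).pair.HasClass (OddInverse.system _ hp) c) :
    IsConnesChernCharacter (continuousCochains A) X p c := by
  have hp0 : 0 < p := by linarith
  have hQ := hs.isQuasi_double hX hR hp hRp
  have hdense := dense_doubleOp hX.D_dense
  intro q hq
  refine ⟨?_, fun hinv => ?_⟩
  · have hop : ∀ a, X.tauBarOp q a =
        (List.ofFn fun j => (hX.double hR).R * (hX.double hR).c (a j)).prod := fun a => by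
      have e1 := inverse_eq (isBoundedInverse_doubleInv hX hR)
      have e2 : ∀ a, twistedCommutator (doubleOp X.D) (diagonal (X.π a) 0)
          (diagonal (X.π (X.σ a)) 0) = (hX.double hR).c a := fun a =>
        twistedCommutator_eq hdense (doubleOp_isTwistedCommutator (hX.isTwistedCommutator a))
      unfold TripleData.tauBarOp tauOperator
      simp only [e1, e2]
      rfl
    refine ⟨fun a => ?_, ?_⟩
    · rw [hop]
      exact (hX.double hR).isTraceClass_prod hp hQ hq a
    · exact (hX.double hR).hasClass_cocycle hp hQ hc hq fun a => by
        rw [TripleData.tauBar, hop]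
  · obtain ⟨T, hT⟩ := hinv
    have hTp : IsSchatten p T :=
      hR.isSchatten_of_isSchatten hp0 (isPerturbedInverse_zero_iff.2 hT) hRp
    have h0 : IsSchatten p (0 : H →L[ℂ] H) := IsSchatten.of_rankLE hp0 (rankLE_zero 0)
    have hQ' := hs.isQuasi_corner hX hT hp hTp
    have hsim := hT.similar_double (isBoundedInverse_doubleInv hX hR)
    -- `diag(D, -D)` is the double of `D` minus the bounded operator `(0, 1; 1, 0)`
    have hc' : (hX.corner hT).pair.HasClass (OddInverse.system _ hp) c := by
      refine OddInverse.hasClass_of_similar hp (hX.double hR) (hX.corner hT) hQ hc (m := 1)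
        (m' := 1) (W := -blockOp 0 1 1 0) (mul_one 1) (mul_one 1) (by rw [mul_one, one_mul])
        (fun a => by rw [one_mul, mul_one]; rfl) ?_ ?_
        (IsSchatten.blockOp hp0 hTp h0 h0 hTp.neg)
      · change X.doubleInv R = blockOp T 0 0 (-T) * 1 +
          blockOp T 0 0 (-T) * -blockOp 0 1 1 0 * X.doubleInv R
        exact eq_mul_one_add_mul_neg_mul hsim.1
      · change X.doubleInv R * 1 = blockOp T 0 0 (-T) +
          X.doubleInv R * 1 * -blockOp 0 1 1 0 * blockOp T 0 0 (-T)
        exact mul_one_eq_add_mul_neg_mul hsim.2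
    have hop : ∀ a, (List.ofFn fun j => (hX.corner hT).R * (hX.corner hT).c (a j)).prod =
        blockOp (X.tauOp q a) 0 0 0 := fun a => by
      have e1 := inverse_eq hT
      have e2 : ∀ a, (hX.corner hT).R * (hX.corner hT).c a =
          blockOp (T * X.commutator a) 0 0 0 := fun a => by
        change blockOp T 0 0 (-T) * blockOp (X.commutator a) 0 0 0 = _
        rw [blockOp_mul]
        simp
      simp only [e2]
      rw [prod_blockOp_corner]
      unfold TripleData.tauOp tauOperator
      rw [e1]
      rfl
    have hsum : ∀ a, Summable (approxNumber (X.tauOp q a)) := fun a => by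
      have h1 := (hX.corner hT).summable_approxNumber_prod hp hQ' hq a
      rw [hop] at h1
      have e : X.tauOp q a = (fstL H ∘L blockOp (X.tauOp q a) 0 0 0) ∘L inlL H := by
        ext x
        change _ = (blockOp (X.tauOp q a) 0 0 0 (inlL H x)).fst
        rw [blockOp_fst]
        exact (add_zero _).symm
      rw [e]
      exact summable_approxNumber_comp_right (summable_approxNumber_comp_left _ h1) _
    refine ⟨fun a => isTraceClass_iff.2 (hsum a), ?_⟩
    refine (hX.corner hT).hasClass_cocycle hp hQ' hc' hq fun a => ?_
    rw [hop, TripleData.tau, supertrace, supertrace, diagonal_eq_blockOp, blockOp_mul]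
    simp only [mul_zero, zero_mul, add_zero]
    have h := trace_corner (T := X.γ * X.tauOp q a) (summable_approxNumber_comp_left _ (hsum a))
    rw [h]

/-- The double of `kDk` is `m D̄ + W` for the double `D̄` of `D`, with
`m = diag(kσ(k), kσ(k))` and `W` bounded. -/
theorem hasClass_deformation (hs : IsSmooth X) (hX : IsTwistedSpectralTriple X) {k : Aˣ}
    (hX' : IsTwistedSpectralTriple (X.conformalDeformation k))
    {R R' : H →L[ℂ] H} (hR : IsPerturbedInverse X.D (Complex.I • 1) R)
    (hR' : IsPerturbedInverse (X.conformalDeformation k).D (Complex.I • 1) R') {p : ℝ}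
    (hp : 1 ≤ p) (hRp : IsSchatten p R) (hRp' : IsSchatten p R') {c : HP (continuousCochains A) 0}
    (hc : (hX.double hR).pair.HasClass (OddInverse.system _ hp) c) :
    (hX'.double hR').pair.HasClass (OddInverse.system _ hp) c := by
  have hp0 : 0 < p := by linarith
  have hQ := hs.isQuasi_double hX hR hp hRp
  set n : H →L[ℂ] H := X.π (k * X.σ k) with hn
  set n' : H →L[ℂ] H := X.π (X.σ ↑k⁻¹ * ↑k⁻¹) with hn'
  set C : H →L[ℂ] H := X.π k * X.commutator k with hC
  have hσ : X.σ (k : A) * X.σ (↑k⁻¹ : A) = 1 := by rw [← map_mul, Units.mul_inv, map_one]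
  have hσ' : X.σ (↑k⁻¹ : A) * X.σ (k : A) = 1 := by rw [← map_mul, Units.inv_mul, map_one]
  have hnn' : n * n' = 1 := by
    rw [hn, hn', ← map_mul, mul_assoc, ← mul_assoc (X.σ (k : A)), hσ, one_mul, Units.mul_inv,
      map_one]
  have hnn : n' * n = 1 := by
    rw [hn, hn', ← map_mul, mul_assoc, Units.inv_mul_cancel_left, hσ', map_one]
  -- on `dom D`, `kDk = kσ(k) D + k [D, k]_σ`
  have hgraph : ∀ x y, (x, y) ∈ X.D.graph →
      (x, n y + C x) ∈ (X.conformalDeformation k).D.graph := fun x y h => by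
    refine sandwich_graph.2 ⟨_, hX.graph_π k h, ?_⟩
    rw [map_add, add_comm, hn, map_mul]
    rfl
  have hdom : ∀ x y, (x, y) ∈ (X.conformalDeformation k).D.graph → x ∈ X.D.domain :=
    fun x y h => by
      obtain ⟨z, hz, -⟩ := sandwich_graph.1 h
      have := mem_domain_of_graph (hX.graph_π (↑k⁻¹ : A) hz)
      rwa [π_inv_mul_apply] at this
  set m : Double H →L[ℂ] Double H := blockOp n 0 0 n with hm
  set m' : Double H →L[ℂ] Double H := blockOp n' 0 0 n' with hm'
  set W : Double H →L[ℂ] Double H := blockOp C (1 - n) (1 - n) (-C) with hW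
  have hmm' : m * m' = 1 := by
    rw [hm, hm', blockOp_mul, hnn']
    simp [blockOp_one]
  have hmm : m' * m = 1 := by
    rw [hm, hm', blockOp_mul, hnn]
    simp [blockOp_one]
  have hsim := (isBoundedInverse_doubleInv hX hR).similar (m := m) (W := W)
    (isBoundedInverse_doubleInv hX' hR') hmm (fun x y hxy => by
      obtain ⟨s, t, hs, ht, h1, h2⟩ := doubleOp_graph.1 hxy
      refine doubleOp_graph.2 ⟨_, _, hgraph _ _ hs, hgraph _ _ ht, ?_, ?_⟩
      · rw [WithLp.add_fst, hm, hW, blockOp_fst, blockOp_fst, h1]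
        simp only [map_add, zero_apply, sub_apply,
          one_apply_eq_self]
        abel
      · rw [WithLp.add_snd, hm, hW, blockOp_snd, blockOp_snd, h2]
        simp only [map_sub, zero_apply, sub_apply,
          one_apply_eq_self, neg_apply]
        abel) (fun x y hxy => by
      obtain ⟨s, t, hs, ht, -, -⟩ := doubleOp_graph.1 hxy
      exact ⟨hdom _ _ hs, hdom _ _ ht⟩)
  refine OddInverse.hasClass_of_similar hp (hX.double hR) (hX'.double hR') hQ hc hmm' hmm ?_ ?_
    hsim.1 hsim.2 (hRp'.doubleInv hp0)
  · have h1 : X.γ * n = n * X.γ := (hX.π_even (k * X.σ k)).symm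
    rw [diagonal_eq_blockOp, hm, blockOp_mul, blockOp_mul]
    simp [h1]
  · intro a
    change diagonal (X.π (conformalTwist X.σ k a)) 0 = m * diagonal (X.π (X.σ a)) 0 * m'
    have h1 : X.π (conformalTwist X.σ k a) = n * X.π (X.σ a) * n' := by
      rw [hn, hn', ← map_mul, ← map_mul, conformalTwist_apply, map_mul X.σ, map_mul X.σ]
      simp only [mul_assoc]
    rw [diagonal_eq_blockOp, diagonal_eq_blockOp, hm, hm', blockOp_mul, blockOp_mul, h1]
    simp

theorem exists_common_character [IsTopologicalRing A] (hs : IsSmooth X)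
    (hX : IsTwistedSpectralTriple X) {p : ℝ} (hp : 1 ≤ p) (hXp : IsSummable X.D p) {k : Aˣ}
    (hk : IsPositiveElement X k) :
    ∃ c, IsConnesChernCharacter (continuousCochains A) X p c ∧
      IsConnesChernCharacter (continuousCochains A) (X.conformalDeformation k) p c := by
  have hX' := isTwistedSpectralTriple_deformation hX hk
  obtain ⟨R, -, hR, hRp⟩ := exists_schatten_resolvent hX hp hXp
  obtain ⟨R', -, hR', hRp'⟩ :=
    exists_schatten_resolvent hX' hp (isSummable_deformation hX hk hp hXp)
  obtain ⟨c, hc⟩ := (hs.isQuasi_double hX hR hp hRp).exists_hasClass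
  exact ⟨c, isConnesChernCharacter_of_hasClass hs hX hR hp hRp hc,
    isConnesChernCharacter_of_hasClass (isSmooth_deformation hX hs k) hX' hR' hp hRp'
      (hasClass_deformation hs hX hX' hR hR' hp hRp hRp' hc)⟩

end Character

section Uniqueness

variable {A : Type u} [Ring A] [Algebra ℂ A] [StarRing A] [StarModule ℂ A]
  {H : Type v} [NormedAddCommGroup H] [InnerProductSpace ℂ H] [CompleteSpace H]
  {X : TripleData A H} {V : ∀ m, Submodule ℂ (Cochain A m)} {p : ℝ}

theorem IsConnesChernCharacter.unique {c c' : HP V 0} (h : IsConnesChernCharacter V X p c)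
    (h' : IsConnesChernCharacter V X p c') : c = c' := by
  obtain ⟨q, hq⟩ := exists_nat_ge ((p - 1) / 2)
  exact (h q hq).1.2.unique (h' q hq).1.2

theorem IsConnesChernCharacter.connesChern_eq {c : HP V 0} (h : IsConnesChernCharacter V X p c) :
    connesChern V X p = c := by
  have h1 : ∃ c, IsConnesChernCharacter V X p c := ⟨c, h⟩
  rw [connesChern, dif_pos h1]
  exact h1.choose_spec.unique h

theorem connesChern_of_common {Y : TripleData A H} (h : ∃ c, IsConnesChernCharacter V X p c ∧
    IsConnesChernCharacter V Y p c) :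
    IsConnesChernCharacter V X p (connesChern V X p) ∧
      IsConnesChernCharacter V Y p (connesChern V Y p) ∧
      connesChern V Y p = connesChern V X p := by
  obtain ⟨c, h1, h2⟩ := h
  rw [h1.connesChern_eq, h2.connesChern_eq]
  exact ⟨h1, h2, rfl⟩

theorem continuousCochains_eq_allCochains [TopologicalSpace A] [DiscreteTopology A] :
    continuousCochains A = allCochains A := by
  ext m φ
  exact ⟨fun _ => Submodule.mem_top, fun _ =>
    continuous_of_discreteTopology (f := fun a : Fin (m + 1) → A => φ a)⟩

theorem isSmooth_of_discreteTopology [TopologicalSpace A] [DiscreteTopology A]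
    (X : TripleData A H) : IsSmooth X :=
  ⟨continuous_of_discreteTopology, continuous_of_discreteTopology, continuous_of_discreteTopology,
    continuous_of_discreteTopology⟩

/-- Without continuity, the statement is the continuous one for the discrete topology. -/
theorem exists_common_character_algebraic (hX : IsTwistedSpectralTriple X) (hp : 1 ≤ p)
    (hXp : IsSummable X.D p) {k : Aˣ} (hk : IsPositiveElement X k) :
    ∃ c, IsConnesChernCharacter (allCochains A) X p c ∧
      IsConnesChernCharacter (allCochains A) (X.conformalDeformation k) p c := by
  let _ : TopologicalSpace A := ⊥
  have : DiscreteTopology A := ⟨rfl⟩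
  have := exists_common_character (isSmooth_of_discreteTopology X) hX hp hXp hk
  rwa [continuousCochains_eq_allCochains] at this

end Uniqueness

end TwistedST

end

theorem mainTheorem4 {A : Type*} [Ring A] [Algebra ℂ A] [StarRing A] [StarModule ℂ A]
    {H : Type*} [NormedAddCommGroup H] [InnerProductSpace ℂ H] [CompleteSpace H]
    (X : TwistedST.TripleData A H) (hX : TwistedST.IsTwistedSpectralTriple X)
    (p : ℝ) (hp : 1 ≤ p) (hXp : TwistedST.IsSummable X.D p)
    (k : Aˣ) (hk : TwistedST.IsPositiveElement X k) :
    (TwistedST.IsTwistedSpectralTriple (X.conformalDeformation k) ∧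
      TwistedST.IsSummable (X.conformalDeformation k).D p) ∧
    (TwistedST.IsConnesChernCharacter (TwistedST.allCochains A) X p
        (TwistedST.connesChern (TwistedST.allCochains A) X p) ∧
      TwistedST.IsConnesChernCharacter (TwistedST.allCochains A) (X.conformalDeformation k) p
        (TwistedST.connesChern (TwistedST.allCochains A) (X.conformalDeformation k) p) ∧
      TwistedST.connesChern (TwistedST.allCochains A) (X.conformalDeformation k) p =
        TwistedST.connesChern (TwistedST.allCochains A) X p) ∧
    (∀ [TopologicalSpace A] [IsTopologicalRing A] [ContinuousSMul ℂ A] [LocallyConvexSpace ℝ A]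
        [ContinuousStar A], TwistedST.IsSmooth X →
      TwistedST.IsSmooth (X.conformalDeformation k) ∧
      TwistedST.IsConnesChernCharacter (TwistedST.continuousCochains A) X p
        (TwistedST.connesChern (TwistedST.continuousCochains A) X p) ∧
      TwistedST.IsConnesChernCharacter (TwistedST.continuousCochains A)
        (X.conformalDeformation k) p
        (TwistedST.connesChern (TwistedST.continuousCochains A) (X.conformalDeformation k) p) ∧
      TwistedST.connesChern (TwistedST.continuousCochains A) (X.conformalDeformation k) p =
        TwistedST.connesChern (TwistedST.continuousCochains A) X p) := by
  refine ⟨⟨TwistedST.isTwistedSpectralTriple_deformation hX hk,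
    TwistedST.isSummable_deformation hX hk hp hXp⟩,
    TwistedST.connesChern_of_common (TwistedST.exists_common_character_algebraic hX hp hXp hk),
    ?_⟩
  intro _ _ _ _ _ hs
  exact ⟨TwistedST.isSmooth_deformation hX hs k,
    TwistedST.connesChern_of_common (TwistedST.exists_common_character hs hX hp hXp hk)⟩
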